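/- **Setting.** Let $d\ge 2$, let $(p_\lambda)_{\lambda\in M}$ be a holomorphic family of complex polynomials of degree $d$ parametrized by a complex manifold $M$, and suppose that $0$ is periodic for every $p_\lambda$: $p_\lambda^{m_0}(0)=0$ with a fixed period $m_0\ge 1$. Put $\rho(\lambda):=(p_\lambda^{m_0})'(0)$, and suppose that for some $\lambda_0\in M$ the number $\rho(\lambda_0)$ is a primitive $t_0$-th root of unity ($t_0\ge1$). Let $m_1:=m_0t_0$ and $b_i:=(p_{\lambda_0}^{m_1-i-1})'\big(p_{\lambda_0}^{i+1}(0)\big)$ for $0\le i\le m_1-1$. Let $q$ be a polynomial of degree $d$ and let $r_1,r_2,r_3$ be repelling periodic points of $q$ of period $m_1$ (that is, $q^{m_1}(r_j)=r_j$ and $|(q^{m_1})'(r_j)|>1$) which do not belong to the postcritical set $\bigcup_{n\ge1}q^n(\{q'=0\})$. Put $$c_j:=\sum_{i=0}^{m_1-1}b_i\,q^i(r_j),\qquad j=1,2,3 .$$ **Definitions.** A compact set $\Lambda\subset\mathbb C^2$ with $g(\Lambda)=\Lambda$, where $g$ is holomorphic near $\Lambda$, is *hyperbolic* for $g$ if over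 the space of backward orbits $\widehat x=(x_i)_{i\le0}$ of $g$ in $\Lambda$ there are a continuous $Dg$-invariant splitting $\mathbb C^2=E^s_{\widehat x}\oplus E^u_{\widehat x}$ and constants $C>0$, $0<\kappa<1$ with $\|Dg^n_{x_0}u\|\le C\kappa^n\|u\|$ for $u\in E^s_{\widehat x}$ and $\|v\|\le C\kappa^n\|Dg^n_{x_0}v\|$ for $v\in E^u_{\widehat x}$, $n\ge0$. It is *repelling* if $\dim E^s=0$, and *saddle* if $\dim E^s=\dim E^u=1$. *Repelling type.* Let $b=q^{N}$ with $N\geq 1$ and $F$ be holomorphic on $\mathbb C^2$. A set $\Lambda$ is a blender of repelling type of $F$ (over $b$ and $r_1,r_2,r_3$) if there are non-empty open sets $H_1,H_2,H_3\subset\mathbb C$, connected open neighbourhoods $V_i$ of $r_i$ with $|b'|>1$ on $V_i$, $\overline{V_1\cup V_2\cup V_3}\subset b(V_i)$ and $b:V_i\cap b^{-1}(V_j)\to V_j$ biholomorphic for all $i,j$, a compact $K\subset\bigcup_iH_i$, numbers $\delta,\alpha>0$ and, with $Z:=\bigcup_iH_i\times V_i$, a holomorphic map $g:Z\to K\times\mathbb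 C$ of the form $g(z,w)=(h(z,w),b(w))$ such that: (1) for some $0<\delta'<\delta$, $D_xg$ maps the cone $\{(u,v)\in\mathbb C^2:|u|<\delta|v|\}$ into $\{(u,v):|u|<\delta'|v|\}$ for all $x\in Z$; (2) for every holomorphic $f$ on $Z$ with $\|f-g\|_{C^1,Z}\le\alpha$, every $i$ and every holomorphic $\sigma:V_i\to H_i$ with $|\sigma'|<\delta$, the set $\bigcap_{n\ge0}f^{-n}(\overline Z)$ meets the graph $\{(\sigma(w),w):w\in V_i\}$; (3) $\|F-g\|_{C^1,Z}\le\alpha'$ for some $0\le\alpha'<\alpha$; (4) $\Lambda=\bigcap_{n\ge0}F^{-n}(\overline Z)$, and $\Lambda$ is contained in a repelling hyperbolic set of $F$. *Saddle type.* Let $F$ be a self-map of $\mathbb C^2$ that extends to a holomorphic endomorphism of $\mathbb P^2$ of degree $D$. A set $\Lambda$ is a blender of saddle type of $F$ if there is a non-empty bounded open set $Z\subset\mathbb C^2$ with $\overline Z\subset F(Z)$ such that, for all holomorphic endomorphisms $g$ of $\mathbb P^2$ of degree $D$ sufficiently close to $F$, the set $\bigcap_{n\ge0}g^{-n}(\overline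 Z)$ is a saddle hyperbolic set of $g$, and $\Lambda=\bigcap_{n\ge0}F^{-n}(\overline Z)$. **Theorem.** Assume that $c_1,c_2,c_3$ are not aligned (over $\mathbb R$) and that $c_1+c_2+c_3=0$. Let $(\lambda_n)$ be a sequence in $M$ converging to $\lambda_0$ such that $|\rho(\lambda_n)|>1$ for all $n$ (resp. $|\rho(\lambda_n)|<1$ for all $n$). Then there exist a sequence $(l_n)$ of positive integers and a sequence $(\beta_n)$ in $\mathbb C^*$ with $\lim_{n\to\infty}\beta_n=0$, and an integer $n_0$, such that for all $n\ge n_0$ and all $\alpha\in\mathbb C$ with $0<|\alpha|<1$ the $(m_1l_n)$-th iterate of $$f_{n,\alpha}(z,w):=(p_{\lambda_n}(z)+\alpha\beta_nw,\;q(w))$$ has a blender $\Lambda_{n,\alpha}$ of repelling type, over $q^{m_1l_n}$ and $r_1,r_2,r_3$ (resp. of saddle type, with $D=d^{m_1l_n}$). -/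

import Mathlib

open scoped Manifold ContDiff

noncomputable section

namespace Blender

/-! ### One variable -/

/-- The self-map of `ℂ` defined by a polynomial. -/
def pmap (p : Polynomial ℂ) : ℂ → ℂ := fun z => p.eval z

/-- The derivative `(p^m)'(z)` of the `m`-th iterate; the multiplier of `z` if `p^m(z) = z`. -/
def multiplier (p : Polynomial ℂ) (m : ℕ) (z : ℂ) : ℂ := deriv (pmap p)^[m] z

/-- The postcritical set: the union over `n ≥ 1` of the `n`-th images of the critical set. -/
def postcritical (q : Polynomial ℂ) : Set ℂ :=
  {w | ∃ n : ℕ, 1 ≤ n ∧ ∃ c : ℂ, q.derivative.eval c = 0 ∧ (pmap q)^[n] c = w}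

/-- `b_i = (p^(m - i - 1))'(p^(i + 1)(0))`, used for `0 ≤ i ≤ m - 1`. -/
def bCoeff (p : Polynomial ℂ) (m i : ℕ) : ℂ :=
  multiplier p (m - (i + 1)) ((pmap p)^[i + 1] 0)

/-- `c(r) = ∑_{i = 0}^{m - 1} b_i q^i(r)`. -/
def cValue (p q : Polynomial ℂ) (m : ℕ) (r : ℂ) : ℂ :=
  ∑ i ∈ Finset.range m, bCoeff p m i * (pmap q)^[i] r

/-- The skew product `(z, w) ↦ (p(z) + s w, q(w))` of `ℂ²`. -/
def skew (p q : Polynomial ℂ) (s : ℂ) : ℂ × ℂ → ℂ × ℂ :=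
  fun x => (pmap p x.1 + s * x.2, pmap q x.2)

/-! ### Hyperbolic sets in `ℂ²` -/

/-- The natural extension of `g` on `Λ`: backward orbits in `Λ`, where `x i` stands for `x_{-i}`. -/
def naturalExtension (g : ℂ × ℂ → ℂ × ℂ) (Λ : Set (ℂ × ℂ)) : Set (ℕ → ℂ × ℂ) :=
  {x | (∀ i, x i ∈ Λ) ∧ ∀ i, g (x (i + 1)) = x i}

/-- `Λ` is a hyperbolic set of `g` with `s` stable directions. The continuous splitting
`E^s ⊕ E^u` over the natural extension is given by the continuous family of projections `P x` with
range `E^s_x` and kernel `E^u_x`. The backward orbit `fun i => x (i + 1)` is the preimage of `x`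
under the shift of the natural extension, so the commutation of `P` with the derivative is the
invariance of both bundles. -/
def IsHyperbolicSet (g : ℂ × ℂ → ℂ × ℂ) (Λ : Set (ℂ × ℂ)) (s : ℕ) : Prop :=
  IsCompact Λ ∧ g '' Λ = Λ ∧ (∀ x ∈ Λ, DifferentiableAt ℂ g x) ∧
  ∃ P : (ℕ → ℂ × ℂ) → (ℂ × ℂ →L[ℂ] ℂ × ℂ),
    ContinuousOn P (naturalExtension g Λ) ∧
    (∀ x ∈ naturalExtension g Λ, (P x).comp (P x) = P x) ∧
    (∀ x ∈ naturalExtension g Λ, Module.finrank ℂ (P x).range = s) ∧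
    (∀ x ∈ naturalExtension g Λ,
      (fderiv ℂ g (x 1)).comp (P fun i => x (i + 1)) = (P x).comp (fderiv ℂ g (x 1))) ∧
    ∃ C κ : ℝ, 0 < C ∧ 0 < κ ∧ κ < 1 ∧
      ∀ x ∈ naturalExtension g Λ, ∀ n : ℕ, ∀ v : ℂ × ℂ,
        (P x v = v → ‖fderiv ℂ g^[n] (x 0) v‖ ≤ C * κ ^ n * ‖v‖) ∧
        (P x v = 0 → ‖v‖ ≤ C * κ ^ n * ‖fderiv ℂ g^[n] (x 0) v‖)

/-- The set `⋂_{n ≥ 0} f^{-n}(closure Z)`. -/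
def staySet (f : ℂ × ℂ → ℂ × ℂ) (Z : Set (ℂ × ℂ)) : Set (ℂ × ℂ) :=
  {x | ∀ n : ℕ, f^[n] x ∈ closure Z}

/-! ### Blenders of repelling type -/

/-- The cone `{(a, b) : |a| < δ |b|}`. -/
def cone (δ : ℝ) : Set (ℂ × ℂ) := {v | ‖v.1‖ < δ * ‖v.2‖}

/-- `g` contracts the cone field of opening `δ` on `U`. -/
def ContractsCone (g : ℂ × ℂ → ℂ × ℂ) (δ : ℝ) (U : Set (ℂ × ℂ)) : Prop :=
  ∃ δ' : ℝ, 0 < δ' ∧ δ' < δ ∧ ∀ x ∈ U, ∀ v ∈ cone δ, fderiv ℂ g x v ∈ cone δ'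

/-- `f` and `g` are at distance at most `α` in the `C^1` topology on `Z`. -/
def C1Close (f g : ℂ × ℂ → ℂ × ℂ) (Z : Set (ℂ × ℂ)) (α : ℝ) : Prop :=
  ∀ x ∈ Z, ‖f x - g x‖ ≤ α ∧ ‖fderiv ℂ f x - fderiv ℂ g x‖ ≤ α

/-- The sets `V_1, V_2, V_3` are connected open neighbourhoods of `r_1, r_2, r_3` on which `b` is
expanding, each of whose images contains the closure of their union, and such that `b` is a
biholomorphism from `V_i ∩ b^{-1}(V_j)` onto `V_j`. -/
structure IsVerticalSystem (b : ℂ → ℂ) (r : Fin 3 → ℂ) (V : Fin 3 → Set ℂ) : Prop where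
  isOpen : ∀ i, IsOpen (V i)
  connected : ∀ i, IsConnected (V i)
  mem : ∀ i, r i ∈ V i
  expanding : ∀ i, ∀ w ∈ V i, 1 < ‖deriv b w‖
  covering : ∀ i, closure (⋃ j, V j) ⊆ b '' V i
  bijOn : ∀ i j, Set.BijOn b (V i ∩ b ⁻¹' V j) (V j)

/-- `Z = ⋃_i H_i × V_i`. -/
def boxUnion (H V : Fin 3 → Set ℂ) : Set (ℂ × ℂ) := ⋃ i, H i ×ˢ V i

/-- For every holomorphic map `f` on `Z = ⋃_i H_i × V_i` that is `α`-close to `g` in the `C^1`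
topology on `Z`, the set `⋂_n f^{-n}(closure Z)` meets each vertical graph over some `V_i` in
`H_i × V_i` with slope smaller than `δ`. -/
def RobustlyMeetsGraphs (g : ℂ × ℂ → ℂ × ℂ) (H V : Fin 3 → Set ℂ) (δ α : ℝ) : Prop :=
  ∀ f : ℂ × ℂ → ℂ × ℂ, DifferentiableOn ℂ f (boxUnion H V) → C1Close f g (boxUnion H V) α →
    ∀ (i : Fin 3) (σ : ℂ → ℂ), DifferentiableOn ℂ σ (V i) → Set.MapsTo σ (V i) (H i) →
      (∀ w ∈ V i, ‖deriv σ w‖ < δ) → ∃ w ∈ V i, (σ w, w) ∈ staySet f (boxUnion H V)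

/-- `Λ` is a blender of repelling type of `F`, over the base map `b` and the points `r_i`: there is
a holomorphic skew product `g = (h, b)` from `Z = ⋃_i H_i × V_i` to `K × ℂ`, with `K` a compact
subset of `⋃_i H_i`, which contracts a cone field of opening `δ` and for which the vertical graphs
of slope less than `δ` are met robustly, `F` lies inside the ball of maps around `g` for
which this holds, `Λ = ⋂_n F^{-n}(closure Z)`, and `Λ` is contained in a repelling hyperbolic set
of `F`. -/
def IsRepellingBlender (b : ℂ → ℂ) (r : Fin 3 → ℂ) (F : ℂ × ℂ → ℂ × ℂ)
    (Λ : Set (ℂ × ℂ)) : Prop :=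
  ∃ (H V : Fin 3 → Set ℂ) (K : Set ℂ) (δ α α' : ℝ) (g : ℂ × ℂ → ℂ × ℂ),
    (∀ i, IsOpen (H i) ∧ (H i).Nonempty) ∧ IsVerticalSystem b r V ∧
    IsCompact K ∧ K ⊆ (⋃ i, H i) ∧ 0 < δ ∧ 0 ≤ α' ∧ α' < α ∧
    DifferentiableOn ℂ g (boxUnion H V) ∧
    (∀ x ∈ boxUnion H V, (g x).1 ∈ K ∧ (g x).2 = b x.2) ∧
    ContractsCone g δ (boxUnion H V) ∧
    RobustlyMeetsGraphs g H V δ α ∧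
    DifferentiableOn ℂ F (boxUnion H V) ∧ C1Close F g (boxUnion H V) α' ∧
    Λ = staySet F (boxUnion H V) ∧
    ∃ Λ' : Set (ℂ × ℂ), Λ ⊆ Λ' ∧ IsHyperbolicSet F Λ' 0

/-! ### Endomorphisms of the projective plane and blenders of saddle type -/

/-- `G` is a lift to `ℂ³` of a holomorphic endomorphism of `ℙ²` of (algebraic) degree `D`: three
homogeneous polynomials of degree `D` whose only common zero is the origin. -/
structure IsEndoLift (D : ℕ) (G : Fin 3 → MvPolynomial (Fin 3) ℂ) : Prop where
  homogeneous : ∀ i, (G i).IsHomogeneous D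
  nondegenerate : ∀ v : Fin 3 → ℂ, (∀ i, MvPolynomial.eval v (G i) = 0) → v = 0

/-- The value at `[1 : z : w]` of the `i`-th homogeneous coordinate of a lift. -/
def coord (G : Fin 3 → MvPolynomial (Fin 3) ℂ) (i : Fin 3) (x : ℂ × ℂ) : ℂ :=
  MvPolynomial.eval ![1, x.1, x.2] (G i)

/-- The endomorphism of `ℙ²` with lift `G`, read in the affine chart `(z, w) ↦ [1 : z : w]`; it is
meaningful where `coord G 0` does not vanish, i.e. where the image is not at infinity. -/
def affineMap (G : Fin 3 → MvPolynomial (Fin 3) ℂ) : ℂ × ℂ → ℂ × ℂ :=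
  fun x => (coord G 1 x / coord G 0 x, coord G 2 x / coord G 0 x)

/-- The set `⋂_{n ≥ 0} g^{-n}(closure Z)` for the endomorphism `g` of `ℙ²` with lift `G` and a
bounded subset `Z` of the affine chart: the orbit has to stay in `closure Z`, hence in the chart. -/
def projStaySet (G : Fin 3 → MvPolynomial (Fin 3) ℂ) (Z : Set (ℂ × ℂ)) : Set (ℂ × ℂ) :=
  {x | ∀ n : ℕ, (affineMap G)^[n] x ∈ closure Z ∧ coord G 0 ((affineMap G)^[n] x) ≠ 0}

/-- `F` is a self-map of `ℂ²` which extends to an endomorphism of degree `D` of `ℙ²`, and `Λ` is a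
blender of saddle type of it, in the affine chart: for some non-empty bounded open set `Z` with
`closure Z ⊆ F(Z)` and all endomorphisms `g` of degree `D` of `ℙ²` close enough to `F` (closeness
of the coefficients of suitable lifts), `⋂_n g^{-n}(closure Z)` is a saddle hyperbolic set of `g`,
and `Λ` is this set for `g = F`. -/
def IsSaddleBlender (D : ℕ) (F : ℂ × ℂ → ℂ × ℂ) (Λ : Set (ℂ × ℂ)) : Prop :=
  ∃ (G : Fin 3 → MvPolynomial (Fin 3) ℂ) (Z : Set (ℂ × ℂ)),
    IsEndoLift D G ∧ (∀ x, coord G 0 x ≠ 0 ∧ affineMap G x = F x) ∧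
    IsOpen Z ∧ Z.Nonempty ∧ Bornology.IsBounded Z ∧ closure Z ⊆ F '' Z ∧
    Λ = staySet F Z ∧
    ∃ ε : ℝ, 0 < ε ∧ ∀ G' : Fin 3 → MvPolynomial (Fin 3) ℂ, IsEndoLift D G' →
      (∀ i m, ‖(G' i).coeff m - (G i).coeff m‖ < ε) →
      IsHyperbolicSet (affineMap G') (projStaySet G' Z) 1

end Blender

end

noncomputable section

namespace Blender

open Set Metric Filter Topology

/-! ### Entire functions -/

/-! Put m = m₀t₀, Q = q^m, and let μ be the derivative of p^m at its fixed point 0; along λ_n it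
tends to ρ(λ₀)^t₀ = 1. To first order at z = s = 0, the (ml)-th iterate of the skew product with
coupling s has first coordinate μ^l z + s ∑_{t<l} μ^(l-1-t) c(Q^t w), where c is `cValue`. For w in
a suitable neighbourhood V_i of r_i the distances |Q^t w - r_i|, t < l, have a sum bounded
independently of l, so the inner sum is τ c_i + O(1) with τ = 1 + … + μ^(l-1) = (μ^l - 1)/(μ - 1).
If l is chosen so that |μ^l| differs from 1 by a small but definite amount, then |τ| is large
because μ is near 1. The bounded error is then negligible against τ, and so is the quadratic one
once s is small. At the scale |sτ| the iterate is thus C¹-close to the model (z, w) ↦ (Az + sτ c_i,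
Q^l(w)) with A = μ^l (`exists_isModelSystem`, `eventually_isModelSystem`,
`eventually_exists_repelling_time`, `eventually_exists_attracting_time`).

Since the c_i are not aligned and have sum 0, for every direction some c_i points inwards, and the
three translations bring each point of a large disc into a strictly smaller one
(`exists_covering_translations`). When |A| > 1, the image of a nearly vertical graph over V_i
contains a graph over every V_j, and for a suitable j that graph lies in the box over V_j with room
to spare. The graph transform can therefore be repeated forever, also for perturbations, and nested
compact sets give a point whose orbit stays (`exists_graph_transform`,
`exists_robustlyMeetsGraphs`). When |A| < 1, the same covering shows that the image of a disc times
⋃ V_i contains its closure. This survives perturbation because the derivative is invertible, and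
domination of the derivative gives the saddle splitting (`exists_robust_saddle`,
`IsDominated.isHyperbolicSet`).

The V_i exist because the preimages of each r_j accumulate at each r_i: the Poincaré function of r_i
is entire and takes the value r_j (`exists_eq_of_poincare`). As the r_j are not postcritical, these
preimages are unramified; they are joined to r_i by thickened paths, which are then pulled back by
the contracting inverse branch at r_i (`exists_isBaseSystem`). -/

theorem exists_entire_log {f : ℂ → ℂ} (hf : Differentiable ℂ f) (h0 : ∀ z, f z ≠ 0) :
    ∃ h : ℂ → ℂ, Differentiable ℂ h ∧ ∀ z, f z = Complex.exp (h z) := by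
  have hd : Differentiable ℂ (deriv f) := by
    have := (hf.contDiff (n := 2)).iterate_deriv' 1 1
    simpa using this.differentiable (by simp)
  obtain ⟨g, hg⟩ := (hd.div hf h0).isExactOn_univ
  have hg' : ∀ z, HasDerivAt g (deriv f z / f z) z := fun z => hg z (mem_univ z)
  have key : ∀ z, HasDerivAt (fun z => f z * Complex.exp (-g z)) 0 z := by
    intro z
    have h1 := (hf z).hasDerivAt.mul ((hg' z).neg.cexp)
    refine h1.congr_deriv ?_
    have := h0 z
    simp only [Pi.neg_apply]
    field_simp
    ring
  have hconst : ∀ z, f z * Complex.exp (-g z) = f 0 * Complex.exp (-g 0) := fun z =>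
    is_const_of_deriv_eq_zero (fun z => (key z).differentiableAt) (fun z => (key z).deriv) z 0
  have hc : f 0 * Complex.exp (-g 0) ≠ 0 := mul_ne_zero (h0 0) (Complex.exp_ne_zero _)
  refine ⟨fun z => g z + Complex.log (f 0 * Complex.exp (-g 0)),
    fun z => ((hg' z).differentiableAt).add_const _, fun z => ?_⟩
  rw [Complex.exp_add, Complex.exp_log hc, ← hconst z, mul_left_comm, ← Complex.exp_add]
  simp

/-- Borel–Carathéodory on a disc of twice the radius. -/
theorem norm_le_of_re_le_two_mul {h : ℂ → ℂ} (hh : Differentiable ℂ h) {M R : ℝ} (hM : 0 < M)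
    (hR : 0 < R) (hre : ∀ z, ‖z‖ < 2 * R → (h z).re ≤ M) (z : ℂ) (hz : ‖z‖ ≤ R) :
    ‖h z‖ ≤ 2 * M + 3 * ‖h 0‖ := by
  have hb := Complex.borelCaratheodory (z := z) (R := 2 * R) hM hh.differentiableOn
    (fun x hx => hre x (by simpa using hx)) (by linarith)
    (by simp only [mem_ball, dist_zero_right]; linarith)
  have hp : 0 < 2 * R - ‖z‖ := by linarith
  have h1 : 2 * M * ‖z‖ / (2 * R - ‖z‖) ≤ 2 * M := by
    rw [div_le_iff₀ hp]; nlinarith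
  have h2 : ‖h 0‖ * (2 * R + ‖z‖) / (2 * R - ‖z‖) ≤ 3 * ‖h 0‖ := by
    rw [div_le_iff₀ hp]; nlinarith [norm_nonneg (h 0)]
  linarith

/-- Liouville's argument: Cauchy's estimate on the circle of radius R about z, which lies in the
disc of radius 2R about 0 once R > ‖z‖. -/
theorem eq_const_of_sublinear {h : ℂ → ℂ} (hh : Differentiable ℂ h) {g : ℝ → ℝ}
    (hg : Tendsto (fun R => g R / R) atTop (𝓝 0))
    (hb : ∀ᶠ R : ℝ in atTop, ∀ z, ‖z‖ ≤ R → ‖h z‖ ≤ g R) (z w : ℂ) : h z = h w := by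
  refine is_const_of_deriv_eq_zero hh (fun z => ?_) z w
  have hlim : Tendsto (fun R => 2 * (g (2 * R) / (2 * R))) atTop (𝓝 0) := by
    simpa using (hg.comp (tendsto_id.const_mul_atTop (two_pos (α := ℝ)))).const_mul 2
  have hle : ∀ᶠ R : ℝ in atTop, ‖deriv h z‖ ≤ 2 * (g (2 * R) / (2 * R)) := by
    filter_upwards [(tendsto_id.const_mul_atTop (two_pos (α := ℝ))).eventually hb,
      eventually_gt_atTop ‖z‖, eventually_gt_atTop 0] with R h1 h2 h3
    have := Complex.norm_deriv_le_of_forall_mem_sphere_norm_le (C := g (2 * R)) h3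
      hh.diffContOnCl (c := z) (fun x hx => h1 x (by
        have : ‖x - z‖ = R := by simpa [dist_eq_norm] using hx
        have h4 : ‖x‖ ≤ ‖x - z‖ + ‖z‖ := by simpa using norm_add_le (x - z) z
        simp only [id]; linarith))
    refine this.trans (le_of_eq ?_)
    field_simp
  have := ge_of_tendsto hlim hle
  simpa using le_antisymm this (norm_nonneg _)

/-- A logarithm of u has real part O(log R) on the disc of radius 2R. Borel–Carathéodory turns this
into a bound O(log R) for its modulus, which is sublinear. -/
theorem eq_const_of_ne_zero_of_polynomial_growth {u : ℂ → ℂ} (hu : Differentiable ℂ u)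
    (h0 : ∀ z, u z ≠ 0) {C : ℝ} {N : ℕ} (hb : ∀ z, ‖u z‖ ≤ C * (1 + ‖z‖) ^ N) (z w : ℂ) :
    u z = u w := by
  obtain ⟨h, hh, hexp⟩ := exists_entire_log hu h0
  have hC : 0 < C := by
    have h1 := hb 0
    have h2 := norm_pos_iff.2 (h0 0)
    simp at h1; linarith
  suffices h z = h w by rw [hexp, hexp, this]
  refine eq_const_of_sublinear hh
    (g := fun R => 2 * (|Real.log C| + 1 + N * Real.log (1 + 2 * R)) + 3 * ‖h 0‖) ?_ ?_ z w
  · have hlog : Tendsto (fun R : ℝ => Real.log (1 + 2 * R) / R) atTop (𝓝 0) := by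
      have h1 : Tendsto (fun R : ℝ => 1 + 2 * R) atTop atTop :=
        tendsto_atTop_add_const_left _ _ (tendsto_id.const_mul_atTop two_pos)
      have h2 : Tendsto (fun R : ℝ => Real.log (1 + 2 * R) / (1 + 2 * R)) atTop (𝓝 0) :=
        (Real.isLittleO_log_id_atTop.tendsto_div_nhds_zero).comp h1
      have h3 : Tendsto (fun R : ℝ => (1 : ℝ) / R + 2) atTop (𝓝 (0 + 2)) :=
        (tendsto_const_nhds.div_atTop tendsto_id).add_const 2
      have h4 := h2.mul h3
      rw [zero_mul] at h4
      refine h4.congr' ?_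
      filter_upwards [eventually_gt_atTop 0] with R hR
      have : (1 + 2 * R) ≠ 0 := by positivity
      field_simp
    have hinv : Tendsto (fun R : ℝ => (2 * (|Real.log C| + 1) + 3 * ‖h 0‖) / R) atTop (𝓝 0) :=
      tendsto_const_nhds.div_atTop tendsto_id
    have := hinv.add (hlog.const_mul (2 * (N : ℝ)))
    rw [mul_zero, add_zero] at this
    refine this.congr (fun R => ?_)
    ring
  · filter_upwards [eventually_gt_atTop 0] with R hR z hz
    have hl : 0 ≤ Real.log (1 + 2 * R) := Real.log_nonneg (by linarith)
    refine norm_le_of_re_le_two_mul hh (by positivity) hR (fun x hx => ?_) z hz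
    have h1 : (h x).re = Real.log ‖u x‖ := by
      rw [hexp, Complex.norm_exp, Real.log_exp]
    rw [h1]
    have h2 : Real.log ‖u x‖ ≤ Real.log (C * (1 + 2 * R) ^ N) := by
      refine Real.log_le_log (norm_pos_iff.2 (h0 x)) ((hb x).trans ?_)
      gcongr
    rw [Real.log_mul hC.ne' (by positivity), Real.log_pow] at h2
    linarith [le_abs_self (Real.log C)]

/-- Enlarging the radius by the factor ‖m‖ enlarges the bound by at most D + 1. With D + 1 < ‖m‖^N
this is growth of order N in the radius. -/
theorem exists_re_le_of_functional_bound {h : ℂ → ℂ} (hh : Continuous h) {m : ℂ} (hm : 1 < ‖m‖)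
    {D C : ℝ} (hD : 0 ≤ D) (hC : 0 ≤ C)
    (hfun : ∀ z, (h (m * z)).re ≤ D * max (h z).re 0 + C) :
    ∃ (C' : ℝ) (N : ℕ), 0 < C' ∧ ∀ z, (h z).re ≤ C' * (1 + ‖z‖) ^ N := by
  have hm0 : m ≠ 0 := norm_pos_iff.1 (by linarith)
  obtain ⟨M, hM⟩ := (isCompact_closedBall (0 : ℂ) 1).exists_bound_of_continuousOn hh.continuousOn
  set M₀ := max M 1 with hM₀
  have hM₀p : 0 < M₀ := lt_of_lt_of_le one_pos (le_max_right _ _)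
  have hind : ∀ k : ℕ, ∀ z, ‖z‖ ≤ ‖m‖ ^ k → (h z).re ≤ (D + 1) ^ k * (M₀ + C) := by
    intro k
    induction k with
    | zero =>
      intro z hz
      have h1 := hM z (by simpa using hz)
      have h2 := (Complex.re_le_norm (h z))
      have h3 := le_max_left M 1
      simp only [pow_zero, one_mul]; linarith
    | succ k ih =>
      intro z hz
      have h1 := hfun (z / m)
      rw [mul_div_cancel₀ _ hm0] at h1
      have h2 : ‖z / m‖ ≤ ‖m‖ ^ k := by
        rw [norm_div, div_le_iff₀ (by linarith)]; simpa [pow_succ] using hz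
      have h3 : max (h (z / m)).re 0 ≤ (D + 1) ^ k * (M₀ + C) := max_le (ih _ h2) (by positivity)
      have h4 : (1 : ℝ) ≤ (D + 1) ^ k := one_le_pow₀ (by linarith)
      calc (h z).re ≤ D * ((D + 1) ^ k * (M₀ + C)) + C :=
            h1.trans (by gcongr)
        _ ≤ (D + 1) ^ (k + 1) * (M₀ + C) := by
            rw [pow_succ]; nlinarith [mul_le_mul h4 (le_refl (M₀ + C)) (by positivity) (by positivity)]
  obtain ⟨N, hN⟩ := pow_unbounded_of_one_lt (D + 1) hm
  refine ⟨(‖m‖ ^ N) * (M₀ + C), N, by positivity, fun z => ?_⟩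
  obtain ⟨k, hk1, hk2⟩ := exists_nat_pow_near (x := 1 + ‖z‖) (by linarith [norm_nonneg z]) hm
  refine (hind (k + 1) z (by linarith)).trans ?_
  have h5 : (D + 1) ^ (k + 1) ≤ ‖m‖ ^ N * (1 + ‖z‖) ^ N := by
    calc (D + 1) ^ (k + 1) ≤ (‖m‖ ^ N) ^ (k + 1) := by gcongr
      _ = ‖m‖ ^ N * (‖m‖ ^ k) ^ N := by rw [← pow_mul, ← pow_mul, ← pow_add]; ring_nf
      _ ≤ _ := by gcongr
  calc (D + 1) ^ (k + 1) * (M₀ + C) ≤ (‖m‖ ^ N * (1 + ‖z‖) ^ N) * (M₀ + C) := by gcongr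
    _ = _ := by ring

theorem norm_eval_le_pow (p : Polynomial ℂ) :
    ∃ C : ℝ, 0 < C ∧ ∀ y, ‖p.eval y‖ ≤ C * (1 + ‖y‖) ^ p.natDegree := by
  refine ⟨∑ i ∈ Finset.range (p.natDegree + 1), ‖p.coeff i‖ + 1, by positivity, fun y => ?_⟩
  rw [Polynomial.eval_eq_sum_range]
  calc _ ≤ ∑ i ∈ Finset.range (p.natDegree + 1), ‖p.coeff i‖ * (1 + ‖y‖) ^ p.natDegree := by
        refine norm_sum_le_of_le _ (fun i hi => ?_)
        rw [norm_mul, norm_pow]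
        have h1 : ‖y‖ ^ i ≤ (1 + ‖y‖) ^ i := by gcongr; linarith
        have h2 : (1 + ‖y‖) ^ i ≤ (1 + ‖y‖) ^ p.natDegree :=
          pow_le_pow_right₀ (by linarith [norm_nonneg y]) (by have := Finset.mem_range.1 hi; omega)
        gcongr; linarith
    _ ≤ _ := by
        rw [← Finset.sum_mul, add_mul]
        have : (0 : ℝ) ≤ 1 * (1 + ‖y‖) ^ p.natDegree := by positivity
        linarith

/-- An entire non-constant solution of `Φ(mz) = Q(Φ(z))` takes each fixed value `a` of `Q` with
`Q'(a) ≠ 0`. -/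
theorem exists_eq_of_poincare {Q : Polynomial ℂ} (hQ : 2 ≤ Q.natDegree) {Φ : ℂ → ℂ}
    (hΦ : Differentiable ℂ Φ) {m : ℂ} (hm : 1 < ‖m‖) (hfun : ∀ z, Φ (m * z) = Q.eval (Φ z))
    (hnc : ∃ z w, Φ z ≠ Φ w) {a : ℂ} (ha : Q.eval a = a) (ha' : Q.derivative.eval a ≠ 0) :
    ∃ z, Φ z = a := by
  by_contra! hne
  obtain ⟨h, hh, hexp⟩ := exists_entire_log (hΦ.sub_const a) (fun z => sub_ne_zero.2 (hne z))
  -- another preimage of `a`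
  obtain ⟨b, hba, hb⟩ : ∃ b, b ≠ a ∧ Q.eval b = a := by
    have hroot : (Q - Polynomial.C a).IsRoot a := by simp [ha]
    obtain ⟨R, hR⟩ := Polynomial.dvd_iff_isRoot.2 hroot
    have hdeg : 1 ≤ R.natDegree := by
      have h1 : (Q - Polynomial.C a).natDegree = Q.natDegree := Polynomial.natDegree_sub_C
      have hR0 : R ≠ 0 := by
        rintro rfl
        rw [hR] at h1; simp at h1; omega
      rw [hR, Polynomial.natDegree_mul (Polynomial.X_sub_C_ne_zero a) hR0,
        Polynomial.natDegree_X_sub_C] at h1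
      omega
    obtain ⟨b, hb⟩ := IsAlgClosed.exists_root R (by
      intro h0
      rw [Polynomial.natDegree_eq_of_degree_eq_some (n := 0) (by simpa using h0)] at hdeg
      omega)
    -- If b = a, then a would be a double root of Q - a, against Q'(a) ≠ 0.
    refine ⟨b, ?_, ?_⟩
    · rintro rfl
      apply ha'
      have : Q = (Polynomial.X - Polynomial.C b) * R + Polynomial.C b := by rw [← hR]; ring
      rw [this]
      simp [Polynomial.derivative_mul, hb.eq_zero]
    · have := congrArg (Polynomial.eval b) hR
      simp [hb.eq_zero, sub_eq_zero] at this
      exact this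
  obtain ⟨K, hK, hKb⟩ := norm_eval_le_pow (Q.comp (Polynomial.X + Polynomial.C a) - Polynomial.C a)
  set D := (Q.comp (Polynomial.X + Polynomial.C a) - Polynomial.C a).natDegree
  -- The functional equation reads exp(h(mz)) = Q(a + exp(h(z))) - a; the logarithms of the moduli
  -- are compared.
  have hre : ∀ z, (h (m * z)).re ≤ (D : ℝ) * max (h z).re 0 + (|Real.log K| + D * Real.log 2) := by
    intro z
    have h1 : Complex.exp (h (m * z)) =
        (Q.comp (Polynomial.X + Polynomial.C a) - Polynomial.C a).eval (Complex.exp (h z)) := by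
      rw [← hexp, ← hexp, hfun]; simp
    have h2 := hKb (Complex.exp (h z))
    rw [← h1, Complex.norm_exp, Complex.norm_exp] at h2
    have h3 : 1 + Real.exp (h z).re ≤ 2 * Real.exp (max (h z).re 0) := by
      have := Real.exp_le_exp.2 (le_max_left (h z).re 0)
      have := Real.exp_le_exp.2 (le_max_right (h z).re 0)
      rw [Real.exp_zero] at this; linarith
    have h4 : Real.exp (h (m * z)).re ≤ K * (2 * Real.exp (max (h z).re 0)) ^ D :=
      h2.trans (by gcongr)
    have h5 := Real.log_le_log (Real.exp_pos _) h4
    rw [Real.log_exp, Real.log_mul hK.ne' (by positivity), Real.log_pow,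
      Real.log_mul two_ne_zero (Real.exp_pos _).ne', Real.log_exp] at h5
    linarith [le_abs_self (Real.log K)]
  obtain ⟨C', N, hC', hgrow⟩ := exists_re_le_of_functional_bound hh.continuous hm (Nat.cast_nonneg D)
    (by have := Real.log_nonneg (one_le_two (α := ℝ)); positivity) hre
  have hnorm : ∀ z, ‖h z‖ ≤ (2 * C' * 3 ^ N + 3 * ‖h 0‖) * (1 + ‖z‖) ^ N := by
    intro z
    have h1 : ‖h z‖ ≤ 2 * (C' * (1 + 2 * (1 + ‖z‖)) ^ N) + 3 * ‖h 0‖ := by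
      refine norm_le_of_re_le_two_mul hh (by positivity) (R := 1 + ‖z‖) (by positivity)
        (fun x hx => (hgrow x).trans ?_) z (by linarith)
      gcongr
    have h2 : (1 + 2 * (1 + ‖z‖)) ^ N ≤ 3 ^ N * (1 + ‖z‖) ^ N := by
      rw [← mul_pow]; gcongr; linarith [norm_nonneg z]
    have h3 : (1 : ℝ) ≤ (1 + ‖z‖) ^ N := one_le_pow₀ (by linarith [norm_nonneg z])
    nlinarith [norm_nonneg (h 0)]
  -- Φ omits b as well, since Φ(z) = b gives Φ(mz) = a. Hence h omits L, and h - L is a zero-free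
  -- entire function of polynomial growth, so constant.
  set L := Complex.log (b - a)
  have hu0 : ∀ z, h z - L ≠ 0 := by
    intro z hz
    have h1 : Φ z = b := by
      have := hexp z
      rw [sub_eq_zero.1 hz, Complex.exp_log (sub_ne_zero.2 hba)] at this
      linear_combination this
    exact hne (m * z) (by rw [hfun, h1, hb])
  obtain ⟨z, w, hzw⟩ := hnc
  have hconst := eq_const_of_ne_zero_of_polynomial_growth (hh.sub_const L) hu0
    (C := 2 * C' * 3 ^ N + 3 * ‖h 0‖ + ‖L‖) (N := N) (fun z => by
      have h3 : (1 : ℝ) ≤ (1 + ‖z‖) ^ N := one_le_pow₀ (by linarith [norm_nonneg z])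
      have := norm_sub_le (h z) L
      nlinarith [hnorm z, norm_nonneg L]) z w
  apply hzw
  have h1 : h z = h w := by linear_combination hconst
  have h2 := hexp z
  rw [h1, ← hexp w] at h2
  linear_combination h2

/-! ### Repelling fixed points and their Poincaré functions -/

theorem exists_quadratic_remainder (p : Polynomial ℂ) (x : ℂ) (W : ℝ) :
    ∃ C : ℝ, 0 < C ∧ ∀ y, ‖y‖ ≤ W →
      ‖p.eval (x + y) - p.eval x - p.derivative.eval x * y‖ ≤ C * ‖y‖ ^ 2 := by
  set t := p.taylor x with ht
  have h1 : ∀ y, p.eval (x + y) = p.eval x + p.derivative.eval x * y +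
      (t.divX.divX).eval y * y ^ 2 := by
    intro y
    have e1 : t.eval y = p.eval (x + y) := by rw [ht, Polynomial.taylor_eval, add_comm]
    have e2 : t.divX.divX * Polynomial.X + Polynomial.C (t.divX.coeff 0) = t.divX :=
      Polynomial.divX_mul_X_add _
    have e3 : t.divX * Polynomial.X + Polynomial.C (t.coeff 0) = t := Polynomial.divX_mul_X_add _
    have e4 : t.coeff 0 = p.eval x := Polynomial.taylor_coeff_zero _ _
    have e5 : t.divX.coeff 0 = p.derivative.eval x := by
      rw [Polynomial.coeff_divX, zero_add]; exact Polynomial.taylor_coeff_one _ _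
    have e6 := congrArg (Polynomial.eval y) e3
    have e7 := congrArg (Polynomial.eval y) e2
    simp only [Polynomial.eval_add, Polynomial.eval_mul, Polynomial.eval_X, Polynomial.eval_C,
      e4, e5] at e6 e7
    rw [← e1, ← e6, ← e7]
    ring
  obtain ⟨M, hM⟩ := (isCompact_closedBall (0 : ℂ) W).exists_bound_of_continuousOn
    (t.divX.divX).continuous.continuousOn
  refine ⟨max M 1, by positivity, fun y hy => ?_⟩
  rw [h1]
  have : p.eval x + p.derivative.eval x * y + (t.divX.divX).eval y * y ^ 2 - p.eval x -
      p.derivative.eval x * y = (t.divX.divX).eval y * y ^ 2 := by ring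
  rw [this, norm_mul, norm_pow]
  gcongr
  exact (hM y (by simpa using hy)).trans (le_max_left _ _)

theorem pmap_iterate_succ' (Q : Polynomial ℂ) (k : ℕ) (z : ℂ) :
    (pmap Q)^[k + 1] z = Q.eval ((pmap Q)^[k] z) := Function.iterate_succ_apply' _ _ _

theorem continuous_pmap_iterate (Q : Polynomial ℂ) (k : ℕ) : Continuous (pmap Q)^[k] :=
  Continuous.iterate Q.continuous k

theorem differentiable_pmap_iterate (Q : Polynomial ℂ) (k : ℕ) :
    Differentiable ℂ (pmap Q)^[k] := Differentiable.iterate Q.differentiable k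

/-- Koenigs' construction: Φ is the limit of Q^k(r + z/m^k). Convergence is geometric near 0 and is
carried to the whole plane by the relation Φ(z) = Q^N(Φ(z/m^N)). -/
theorem exists_poincare_function {Q : Polynomial ℂ} {r m : ℂ} (hr : Q.eval r = r)
    (hm : Q.derivative.eval r = m) (hm1 : 1 < ‖m‖) :
    ∃ Φ : ℂ → ℂ, Differentiable ℂ Φ ∧ Φ 0 = r ∧ (∀ z, Φ (m * z) = Q.eval (Φ z)) ∧
      ∃ z w, Φ z ≠ Φ w := by
  have hm0 : m ≠ 0 := norm_pos_iff.1 (by linarith)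
  have hmp : 0 < ‖m‖ := by linarith
  -- local constants
  set L := (‖m‖ + ‖m‖ ^ 2) / 2 with hL
  have hmm : ‖m‖ < ‖m‖ ^ 2 := by nlinarith
  have hLm : ‖m‖ < L := by rw [hL]; linarith
  set θ := L / ‖m‖ ^ 2 with hθ
  have hθ1 : θ < 1 := by rw [hθ, div_lt_one (by positivity)]; rw [hL]; linarith
  have hθ0 : 0 < θ := by positivity
  obtain ⟨B, hB, hquad⟩ := exists_quadratic_remainder Q r 1
  have hderiv : ∀ᶠ x in 𝓝 r, ‖Q.derivative.eval x‖ < L := by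
    have : Tendsto (fun x => ‖Q.derivative.eval x‖) (𝓝 r) (𝓝 ‖m‖) := by
      rw [← hm]; exact (Q.derivative.continuous.norm).continuousAt
    exact this.eventually_lt_const hLm
  obtain ⟨ρ₁, hρ₁, hball⟩ := Metric.eventually_nhds_iff_ball.1 hderiv
  have hlip : ∀ x ∈ ball r ρ₁, ∀ y ∈ ball r ρ₁, ‖Q.eval y - Q.eval x‖ ≤ L * ‖y - x‖ := by
    intro x hx y hy
    refine (convex_ball r ρ₁).norm_image_sub_le_of_norm_deriv_le (f := fun x => Q.eval x)
      (fun x _ => Q.differentiableAt) (fun x hx => ?_) hx hy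
    rw [Polynomial.deriv]; exact (hball x hx).le
  set ρ := min (min (ρ₁ / 2) 1) ((1 - θ) / (2 * B)) with hρ
  have h1θ : 0 < 1 - θ := by linarith
  have hρ0 : 0 < ρ := by positivity
  have hρa : ρ ≤ ρ₁ / 2 := (min_le_left _ _).trans (min_le_left _ _)
  have hρb : ρ ≤ 1 := (min_le_left _ _).trans (min_le_right _ _)
  have hρc : ρ * B ≤ (1 - θ) / 2 := by
    have : ρ ≤ (1 - θ) / (2 * B) := min_le_right _ _
    rw [le_div_iff₀ (by positivity)] at this; linarith
  set f : ℕ → ℂ → ℂ := fun k z => (pmap Q)^[k] (r + z / m ^ k) with hf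
  have hf0 : ∀ z, f 0 z = r + z := by intro z; simp [hf]
  have hfs : ∀ k z, f (k + 1) z = Q.eval (f k (z / m)) := by
    intro k z
    simp only [hf]
    rw [pmap_iterate_succ', div_div, pow_succ']
  have hfcont : ∀ k, Differentiable ℂ (f k) := by
    intro k
    exact (differentiable_pmap_iterate Q k).comp (by fun_prop)
  have hgeom : ∀ k, ∑ j ∈ Finset.range k, θ ^ j ≤ 1 / (1 - θ) := by
    intro k
    rw [geom_sum_eq hθ1.ne, ← neg_div_neg_eq, neg_sub, neg_sub]
    gcongr
    linarith [pow_pos hθ0 k]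
  have hnear : ∀ k z, ‖z‖ ≤ ρ →
      ‖f k z - (r + z)‖ ≤ B * ‖z‖ ^ 2 * ∑ j ∈ Finset.range k, θ ^ j → ‖f k z - (r + z)‖ ≤ ‖z‖ / 2 := by
    intro k z hz h
    refine h.trans ?_
    calc B * ‖z‖ ^ 2 * ∑ j ∈ Finset.range k, θ ^ j ≤ B * ‖z‖ ^ 2 * (1 / (1 - θ)) := by
          gcongr; exact hgeom k
      _ = (B * ‖z‖ / (1 - θ)) * ‖z‖ := by ring
      _ ≤ (1 / 2) * ‖z‖ := by
          refine mul_le_mul_of_nonneg_right ?_ (norm_nonneg _)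
          rw [div_le_iff₀ h1θ]
          nlinarith
      _ = _ := by ring
  have hdivle : ∀ z : ℂ, ‖z‖ ≤ ρ → ‖z / m‖ ≤ ρ := by
    intro z hz
    rw [norm_div, div_le_iff₀ hmp]; nlinarith
  have hmem : ∀ k z, ‖z‖ ≤ ρ → ‖f k z - (r + z)‖ ≤ ‖z‖ / 2 → f k z ∈ ball r ρ₁ := by
    intro k z hz h
    rw [mem_ball, dist_eq_norm]
    have := norm_add_le (f k z - (r + z)) z
    rw [show f k z - (r + z) + z = f k z - r by ring] at this
    linarith
  -- The two estimates need each other: the first keeps f k in the ball where Q is L-Lipschitz, and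
  -- the second, summed, gives the first at the next stage.
  have key : ∀ k, ∀ z, ‖z‖ ≤ ρ → ‖f k z - (r + z)‖ ≤ B * ‖z‖ ^ 2 * ∑ j ∈ Finset.range k, θ ^ j ∧
      ‖f (k + 1) z - f k z‖ ≤ B * θ ^ k * ‖z‖ ^ 2 := by
    intro k
    induction k with
    | zero =>
      intro z hz
      refine ⟨by simp [hf0], ?_⟩
      rw [hfs, hf0, hf0]
      have h1 := hquad (z / m) ((hdivle z hz).trans hρb)
      rw [hr, hm, mul_div_cancel₀ _ hm0] at h1
      rw [show Q.eval (r + z / m) - (r + z) = Q.eval (r + z / m) - r - z by ring]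
      refine h1.trans ?_
      rw [pow_zero, mul_one]
      gcongr
      rw [norm_div]
      exact div_le_self (norm_nonneg _) hm1.le
    | succ k ih =>
      intro z hz
      obtain ⟨h1, h2⟩ := ih z hz
      have h3 : ‖f (k + 1) z - (r + z)‖ ≤ B * ‖z‖ ^ 2 * ∑ j ∈ Finset.range (k + 1), θ ^ j := by
        rw [Finset.sum_range_succ]
        have := norm_add_le (f (k + 1) z - f k z) (f k z - (r + z))
        rw [sub_add_sub_cancel] at this
        linarith
      refine ⟨h3, ?_⟩
      obtain ⟨h4, h5⟩ := ih (z / m) (hdivle z hz)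
      have h6 := hnear _ _ (hdivle z hz) h4
      have h7 : ‖f (k + 1) (z / m) - (r + z / m)‖ ≤ ‖z / m‖ / 2 := by
        refine hnear _ _ (hdivle z hz) ?_
        rw [Finset.sum_range_succ]
        have := norm_add_le (f (k + 1) (z / m) - f k (z / m)) (f k (z / m) - (r + z / m))
        rw [sub_add_sub_cancel] at this
        linarith
      rw [hfs (k + 1) z, hfs k z]
      refine (hlip _ (hmem _ _ (hdivle z hz) h6) _ (hmem _ _ (hdivle z hz) h7)).trans ?_
      calc L * ‖f (k + 1) (z / m) - f k (z / m)‖ ≤ L * (B * θ ^ k * ‖z / m‖ ^ 2) := by gcongr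
        _ = B * θ ^ (k + 1) * ‖z‖ ^ 2 := by
          rw [norm_div, div_pow, pow_succ, hθ]; ring_nf
  -- pointwise convergence near the origin
  have hcau : ∀ z, ‖z‖ ≤ ρ → ∀ k, dist (f k z) (f (k + 1) z) ≤ B * ‖z‖ ^ 2 * θ ^ k := by
    intro z hz k
    rw [dist_comm, dist_eq_norm]
    refine ((key k z hz).2).trans (le_of_eq ?_); ring_nf
  have hlim0 : ∀ z, ‖z‖ ≤ ρ → ∃ x, Tendsto (fun k => f k z) atTop (𝓝 x) := fun z hz =>
    cauchySeq_tendsto_of_complete (cauchySeq_of_le_geometric θ _ hθ1 (hcau z hz))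
  have hfadd : ∀ N k z, f (k + N) z = (pmap Q)^[N] (f k (z / m ^ N)) := by
    intro N k z
    simp only [hf]
    rw [← Function.iterate_add_apply, add_comm N k, div_div, ← pow_add, add_comm N k]
  have hscale : ∀ z : ℂ, ∃ N : ℕ, ‖z / m ^ N‖ < ρ := by
    intro z
    obtain ⟨N, hN⟩ := pow_unbounded_of_one_lt (‖z‖ / ρ) hm1
    refine ⟨N, ?_⟩
    rw [norm_div, norm_pow, div_lt_iff₀ (by positivity)]
    rw [div_lt_iff₀ hρ0] at hN; linarith
  have hlim : ∀ z, ∃ x, Tendsto (fun k => f k z) atTop (𝓝 x) := by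
    intro z
    obtain ⟨N, hN⟩ := hscale z
    obtain ⟨x, hx⟩ := hlim0 _ hN.le
    refine ⟨(pmap Q)^[N] x, ?_⟩
    rw [← tendsto_add_atTop_iff_nat N]
    simp only [hfadd]
    exact ((continuous_pmap_iterate Q N).tendsto x).comp hx
  choose Φ hΦ using hlim
  have hiter : ∀ N z, Φ z = (pmap Q)^[N] (Φ (z / m ^ N)) := by
    intro N z
    refine tendsto_nhds_unique (f := fun k => f (k + N) z) ((tendsto_add_atTop_iff_nat N).2 (hΦ z)) ?_
    simp only [hfadd]
    exact ((continuous_pmap_iterate Q N).tendsto _).comp (hΦ _)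
  have hunif : TendstoUniformlyOn f Φ atTop (ball 0 ρ) := by
    rw [Metric.tendstoUniformlyOn_iff]
    intro ε hε
    have hto : Tendsto (fun n : ℕ => B * 1 ^ 2 * θ ^ n / (1 - θ)) atTop (𝓝 0) := by
      have := ((tendsto_pow_atTop_nhds_zero_of_lt_one hθ0.le hθ1).const_mul (B * 1 ^ 2)).div_const
        (1 - θ)
      simpa using this
    filter_upwards [hto.eventually_lt_const hε] with n hn z hz
    have hz' : ‖z‖ ≤ ρ := by simpa using (mem_ball.1 hz).le
    have h1 := dist_le_of_le_geometric_of_tendsto θ _ hθ1 (hcau z hz') (hΦ z) n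
    rw [dist_comm]
    refine (h1.trans ?_).trans_lt hn
    gcongr
    linarith
  have hdiff0 : DifferentiableOn ℂ Φ (ball 0 ρ) :=
    hunif.tendstoLocallyUniformlyOn.differentiableOn
      (Eventually.of_forall fun n => (hfcont n).differentiableOn) isOpen_ball
  have hdiff : Differentiable ℂ Φ := by
    intro z
    obtain ⟨N, hN⟩ := hscale z
    have h1 : Φ = fun z => (pmap Q)^[N] (Φ (z / m ^ N)) := funext (hiter N)
    rw [h1]
    have h2 : DifferentiableAt ℂ Φ (z / m ^ N) :=
      hdiff0.differentiableAt (isOpen_ball.mem_nhds (by simpa using hN))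
    exact (differentiable_pmap_iterate Q N _).comp z
      (h2.comp z (differentiableAt_id.div_const _))
  have hclose : ∀ z, ‖z‖ ≤ ρ → ‖Φ z - (r + z)‖ ≤ ‖z‖ / 2 := by
    intro z hz
    exact le_of_tendsto ((hΦ z).sub_const _).norm
      (Eventually.of_forall fun k => hnear k z hz (key k z hz).1)
  have hΦ0 : Φ 0 = r := by
    have := hclose 0 (by simpa using hρ0.le)
    simpa [sub_eq_zero] using this
  -- Φ is not constant because Φ(ρ) is within ρ/2 of r + ρ, whereas Φ(0) = r.
  refine ⟨Φ, hdiff, hΦ0, fun z => ?_, (ρ : ℂ), 0, fun h => ?_⟩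
  · have := hiter 1 (m * z)
    rw [pow_one, mul_div_cancel_left₀ _ hm0] at this
    simpa [pmap] using this
  · have hn : ‖(ρ : ℂ)‖ = ρ := by simp [abs_of_pos hρ0]
    have := hclose ρ hn.le
    rw [h, hΦ0, hn] at this
    simp [abs_of_pos hρ0] at this
    linarith

/-- The backward orbit of a non-critical fixed point accumulates at every repelling fixed point. -/
theorem exists_preimage_near {Q : Polynomial ℂ} (hQ : 2 ≤ Q.natDegree) {r a : ℂ}
    (hr : Q.eval r = r) (hrep : 1 < ‖Q.derivative.eval r‖) (ha : Q.eval a = a)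
    (ha' : Q.derivative.eval a ≠ 0) {U : Set ℂ} (hU : U ∈ 𝓝 r) :
    ∃ K : ℕ, ∀ k ≥ K, ∃ y ∈ U, (pmap Q)^[k] y = a := by
  obtain ⟨Φ, hd, h0, hfun, hnc⟩ := exists_poincare_function hr rfl hrep
  obtain ⟨z, hz⟩ := exists_eq_of_poincare hQ hd hrep hfun hnc ha ha'
  set m := Q.derivative.eval r
  have hm0 : m ≠ 0 := norm_pos_iff.1 (by linarith)
  have hiter : ∀ k z, Φ z = (pmap Q)^[k] (Φ (z / m ^ k)) := by
    intro k
    induction k with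
    | zero => simp
    | succ k ih =>
      intro z
      have h1 := hfun (z / m ^ (k + 1))
      rw [ih, Function.iterate_succ_apply, show pmap Q _ = Q.eval _ from rfl, ← h1]
      congr 2
      field_simp
      ring
  have hlim : Tendsto (fun k : ℕ => Φ (z / m ^ k)) atTop (𝓝 r) := by
    rw [← h0]
    refine (hd.continuous.tendsto 0).comp ?_
    have : Tendsto (fun k : ℕ => z * (m⁻¹) ^ k) atTop (𝓝 (z * 0)) :=
      (tendsto_pow_atTop_nhds_zero_of_norm_lt_one (by
        rw [norm_inv]; exact inv_lt_one_of_one_lt₀ hrep)).const_mul z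
    rw [mul_zero] at this
    refine this.congr (fun k => ?_)
    rw [inv_pow, div_eq_mul_inv]
  obtain ⟨K, hK⟩ := eventually_atTop.1 (hlim.eventually hU)
  exact ⟨K, fun k hk => ⟨_, hK k hk, by rw [← hiter, hz]⟩⟩

/-! ### Holomorphic local sections -/

theorem hasStrictDerivAt_of_differentiable {f : ℂ → ℂ} (hf : Differentiable ℂ f) (a : ℂ) :
    HasStrictDerivAt f (deriv f a) a :=
  ((hf.contDiff (n := 1)).contDiffAt).hasStrictDerivAt (by norm_num)

theorem continuous_deriv_of_differentiable {f : ℂ → ℂ} (hf : Differentiable ℂ f) :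
    Continuous (deriv f) :=
  (hf.contDiff (n := 1)).continuous_deriv le_rfl

theorem deriv_section {f φ : ℂ → ℂ} (hf : Differentiable ℂ f) {s : Set ℂ} (hs : IsOpen s)
    (hφ : DifferentiableOn ℂ φ s) (hsec : ∀ y ∈ s, f (φ y) = y) {y : ℂ} (hy : y ∈ s) :
    deriv f (φ y) * deriv φ y = 1 := by
  have h1 : HasDerivAt (fun y => f (φ y)) (deriv f (φ y) * deriv φ y) y :=
    (hf (φ y)).hasDerivAt.comp y (hφ.differentiableAt (hs.mem_nhds hy)).hasDerivAt
  have h2 : HasDerivAt (fun y => f (φ y)) 1 y :=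
    (hasDerivAt_id y).congr_of_eventuallyEq
      (Filter.eventually_of_mem (hs.mem_nhds hy) fun z hz => hsec z hz)
  exact h1.unique h2

theorem exists_local_section {f : ℂ → ℂ} (hf : Differentiable ℂ f) {a : ℂ} (ha : deriv f a ≠ 0)
    {N : Set ℂ} (hN : N ∈ 𝓝 a) :
    ∃ (φ : ℂ → ℂ) (η : ℝ), 0 < η ∧ DifferentiableOn ℂ φ (ball (f a) η) ∧
      MapsTo φ (ball (f a) η) N ∧ (∀ y ∈ ball (f a) η, f (φ y) = y) ∧ φ (f a) = a := by
  set hs := (hasStrictDerivAt_of_differentiable hf a).hasStrictFDerivAt_equiv ha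
  set e := hs.toOpenPartialHomeomorph f
  have hae : a ∈ e.source := hs.mem_toOpenPartialHomeomorph_source
  have hfe : f a ∈ e.target := hs.image_mem_toOpenPartialHomeomorph_target
  have hsymm : e.symm (f a) = a := e.left_inv hae
  have hcont : ContinuousAt e.symm (f a) := e.continuousAt_symm hfe
  have hnhds : ∀ᶠ y in 𝓝 (f a), y ∈ e.target ∧ e.symm y ∈ N ∧ deriv f (e.symm y) ≠ 0 := by
    refine Eventually.and (e.open_target.mem_nhds hfe)
      (Eventually.and (hcont (by rw [hsymm]; exact hN)) ?_)
    exact hcont.eventually (by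
      rw [hsymm]; exact (continuous_deriv_of_differentiable hf).continuousAt.eventually_ne ha)
  obtain ⟨η, hη, hb⟩ := Metric.eventually_nhds_iff_ball.1 hnhds
  refine ⟨e.symm, η, hη, fun y hy => ?_, fun y hy => (hb y hy).2.1,
    fun y hy => e.right_inv (hb y hy).1, hsymm⟩
  obtain ⟨h1, -, h3⟩ := hb y hy
  have h4 : ∀ᶠ x in 𝓝 (e.symm y), e.symm (f x) = x := by
    filter_upwards [e.open_source.mem_nhds (e.map_target h1)] with x hx using e.left_inv hx
  have h5 := (hasStrictDerivAt_of_differentiable hf (e.symm y)).to_local_left_inverse h3 h4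
  have h6 : f (e.symm y) = y := e.right_inv h1
  rw [h6] at h5
  exact h5.hasDerivAt.differentiableAt.differentiableWithinAt

theorem exists_injOn_nhds {f : ℂ → ℂ} (hf : Differentiable ℂ f) {a : ℂ} (ha : deriv f a ≠ 0) :
    ∃ N ∈ 𝓝 a, InjOn f N := by
  set hs := (hasStrictDerivAt_of_differentiable hf a).hasStrictFDerivAt_equiv ha
  set e := hs.toOpenPartialHomeomorph f
  exact ⟨e.source, e.open_source.mem_nhds hs.mem_toOpenPartialHomeomorph_source, e.injOn⟩

/-- The contracting inverse branch at a repelling fixed point. -/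
theorem exists_contracting_branch {f : ℂ → ℂ} (hf : Differentiable ℂ f) {r : ℂ} (hr : f r = r)
    (hrep : 1 < ‖deriv f r‖) :
    ∃ (g : ℂ → ℂ) (ρ θ : ℝ), 0 < ρ ∧ 0 < θ ∧ θ < 1 ∧ DifferentiableOn ℂ g (ball r ρ) ∧ g r = r ∧
      (∀ x ∈ ball r ρ, f (g x) = x) ∧ (∀ x ∈ ball r ρ, ‖g x - r‖ ≤ θ * ‖x - r‖) ∧
      ∀ x ∈ ball r ρ, θ⁻¹ ≤ ‖deriv f (g x)‖ := by
  set lam := (1 + ‖deriv f r‖) / 2 with hlam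
  have h1 : 1 < lam := by rw [hlam]; linarith
  have hN : ∀ᶠ x in 𝓝 r, lam < ‖deriv f x‖ :=
    (continuous_deriv_of_differentiable hf).norm.continuousAt.eventually_const_lt
      (by rw [hlam]; linarith)
  obtain ⟨g, ρ, hρ, hg, hmaps, hsec, hgr⟩ :=
    exists_local_section hf (norm_pos_iff.1 (by linarith : 0 < ‖deriv f r‖)) hN
  rw [hr] at hg hmaps hsec hgr
  refine ⟨g, ρ, lam⁻¹, hρ, by positivity, inv_lt_one_of_one_lt₀ h1, hg, hgr, hsec, fun x hx => ?_,
    fun x hx => by rw [inv_inv]; exact (hmaps hx).le⟩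
  have h2 := (convex_ball r ρ).norm_image_sub_le_of_norm_deriv_le (f := g) (C := lam⁻¹)
    (fun y hy => hg.differentiableAt (isOpen_ball.mem_nhds hy)) (fun y hy => ?_)
    (mem_ball_self hρ) hx
  · rwa [hgr] at h2
  · have h3 := deriv_section hf isOpen_ball hg hsec hy
    have h4 : ‖deriv f (g y)‖ * ‖deriv g y‖ = 1 := by rw [← norm_mul, h3, norm_one]
    have h5 : lam < ‖deriv f (g y)‖ := hmaps hy
    rw [← one_div, le_div_iff₀ (by linarith), ← h4]
    nlinarith [norm_nonneg (deriv g y)]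

/-! ### Thickened paths -/

/-- The ball is homeomorphic to the plane, where the complement of a countable set is path
connected. -/
theorem joinedIn_ball_diff {c : ℂ} {ρ : ℝ} (hρ : 0 < ρ) {S : Set ℂ} (hS : S.Finite) {x y : ℂ}
    (hx : x ∈ ball c ρ \ S) (hy : y ∈ ball c ρ \ S) : JoinedIn (ball c ρ \ S) x y := by
  set e := OpenPartialHomeomorph.univBall c ρ (E := ℂ) (P := ℂ)
  have hsrc : e.source = univ := OpenPartialHomeomorph.univBall_source c ρ
  have htgt : e.target = ball c ρ := OpenPartialHomeomorph.univBall_target c hρ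
  have hinj : Function.Injective e := by
    intro a b hab
    exact e.injOn (by rw [hsrc]; trivial) (by rw [hsrc]; trivial) hab
  have hcont : Continuous e := by
    rw [← continuousOn_univ, ← hsrc]; exact e.continuousOn
  have hpre : (e ⁻¹' S).Finite := hS.preimage hinj.injOn
  have h1 : IsPathConnected (e ⁻¹' S)ᶜ :=
    hpre.countable.isPathConnected_compl_of_one_lt_rank (by simp)
  have h2 : e '' (e ⁻¹' S)ᶜ = ball c ρ \ S := by
    ext z
    constructor
    · rintro ⟨w, hw, rfl⟩
      exact ⟨htgt ▸ e.map_source (by rw [hsrc]; trivial), hw⟩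
    · rintro ⟨hz, hzS⟩
      have : e (e.symm z) = z := e.right_inv (by rw [htgt]; exact hz)
      exact ⟨e.symm z, by simpa [this] using hzS, this⟩
  have h3 : IsPathConnected (ball c ρ \ S) := h2 ▸ h1.image hcont
  exact h3.joinedIn x hx y hy

/-- A function with small derivative near a path has small oscillation along it. -/
theorem exists_oscillation_bound_path {a b : ℂ} (γ : Path a b) {η : ℝ} (hη : 0 < η) :
    ∃ C : ℝ, 0 ≤ C ∧ ∀ (f : ℂ → ℂ) (δ : ℝ), 0 ≤ δ →
      (∀ t, ∀ x ∈ ball (γ t) η, DifferentiableAt ℂ f x ∧ ‖deriv f x‖ ≤ δ) →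
      ∀ t, ‖f (γ t) - f a‖ ≤ C * δ := by
  have huc := CompactSpace.uniformContinuous_of_continuous γ.continuous
  obtain ⟨ε, hε, hdist⟩ := Metric.uniformContinuous_iff.1 huc η hη
  obtain ⟨N, hN⟩ := exists_nat_one_div_lt hε
  refine ⟨(N + 1) * η, by positivity, fun f δ hδ hf t => ?_⟩
  -- The subdivision of [0, t] into N + 1 equal steps; the minimum only keeps later indices inside
  -- the unit interval. Consecutive points have images at distance less than η, so the convex
  -- estimate applies on each ball.
  set s : ℕ → unitInterval := fun k => ⟨(t : ℝ) * (min (k : ℝ) (N + 1) / (N + 1)), by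
    have h1 : (min (k : ℝ) (N + 1) / (N + 1)) ≤ 1 := by
      rw [div_le_one (by positivity)]; exact min_le_right _ _
    have h2 : 0 ≤ (min (k : ℝ) (N + 1) / (N + 1)) := by positivity
    exact ⟨mul_nonneg t.2.1 h2, mul_le_one₀ t.2.2 h2 h1⟩⟩ with hs
  have hs0 : s 0 = 0 := by
    apply Subtype.ext
    have : min (0 : ℝ) (N + 1) = 0 := min_eq_left (by positivity)
    simp [hs, this]
  have hsN : s (N + 1) = t := by
    apply Subtype.ext
    have : ((N : ℝ) + 1) ≠ 0 := by positivity
    simp [hs, this]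
  have hstep : ∀ k < N + 1, ‖f (γ (s (k + 1))) - f (γ (s k))‖ ≤ δ * η := by
    intro k hk
    have hk' : (k : ℝ) + 1 ≤ N + 1 := by exact_mod_cast hk
    have h1 : dist (s (k + 1)) (s k) < ε := by
      rw [Subtype.dist_eq, Real.dist_eq]
      simp only [hs]
      push_cast
      rw [min_eq_left hk', min_eq_left (by linarith : (k : ℝ) ≤ N + 1)]
      have : (t : ℝ) * (((k : ℝ) + 1) / (N + 1)) - t * (k / (N + 1)) = t * (1 / (N + 1)) := by ring
      rw [this, abs_mul, abs_of_nonneg t.2.1, abs_of_nonneg (by positivity)]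
      calc (t : ℝ) * (1 / (N + 1)) ≤ 1 * (1 / (N + 1)) := by gcongr; exact t.2.2
        _ < ε := by rw [one_mul]; exact hN
    have h2 := hdist h1
    have h3 := (convex_ball (γ (s k)) η).norm_image_sub_le_of_norm_deriv_le (f := f) (C := δ)
      (fun x hx => (hf _ x hx).1) (fun x hx => (hf _ x hx).2) (mem_ball_self hη) (mem_ball.2 h2)
    refine h3.trans ?_
    rw [← dist_eq_norm]
    gcongr
  have hsum : ∀ k ≤ N + 1, ‖f (γ (s k)) - f a‖ ≤ k * (δ * η) := by
    intro k
    induction k with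
    | zero => intro _; simp [hs0]
    | succ k ih =>
      intro hk
      have h1 := ih (by omega)
      have h2 := hstep k (by omega)
      have h3 := norm_add_le (f (γ (s (k + 1))) - f (γ (s k))) (f (γ (s k)) - f a)
      rw [sub_add_sub_cancel] at h3
      push_cast
      linarith
  have := hsum (N + 1) le_rfl
  rw [hsN] at this
  push_cast at this
  linarith

/-- A neighbourhood of the points `y_j` on which a polynomial `F` has no critical points and takes
values close to `r_j` only near `y_j`. -/
theorem exists_adapted_neighbourhood {F : Polynomial ℂ} (hF : 0 < F.natDegree) {c : ℂ} {ρ : ℝ}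
    (hρ : 0 < ρ) {r y : Fin 3 → ℂ} (hr : Function.Injective r) (hy : ∀ j, y j ∈ ball c ρ)
    (hyr : ∀ j, F.eval (y j) = r j) (hcrit : ∀ j, F.derivative.eval (y j) ≠ 0) {i : Fin 3}
    (hi : y i = c) :
    ∃ (U : Set ℂ) (η c₀ C : ℝ), IsOpen U ∧ IsConnected U ∧ U ⊆ ball c ρ ∧ c ∈ U ∧ 0 < η ∧
      0 < c₀ ∧ 0 ≤ C ∧ (∀ x ∈ U, c₀ ≤ ‖F.derivative.eval x‖) ∧
      (∃ φ : Fin 3 → ℂ → ℂ, ∀ j, DifferentiableOn ℂ (φ j) (ball (r j) η) ∧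
        MapsTo (φ j) (ball (r j) η) U ∧ (∀ z ∈ ball (r j) η, F.eval (φ j z) = z) ∧
        ∀ x ∈ U, F.eval x ∈ ball (r j) η → φ j (F.eval x) = x) ∧
      ∀ (f : ℂ → ℂ) (δ : ℝ), 0 ≤ δ → DifferentiableOn ℂ f U → (∀ x ∈ U, ‖deriv f x‖ ≤ δ) →
        ∀ x ∈ U, ∀ x' ∈ U, ‖f x - f x'‖ ≤ C * δ := by
  have hFd : F.derivative ≠ 0 := by
    intro h
    exact hF.ne' (Polynomial.derivative_eq_zero.1 h)
  have hFdiff : Differentiable ℂ (fun x => F.eval x) := F.differentiable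
  -- The finitely many points to avoid: critical points, and preimages of the r j other than the
  -- chosen y j. A thickening of paths in the complement then meets the fibres of F over the r j
  -- only in the chosen points.
  set S : Set ℂ := ({x | F.derivative.eval x = 0} ∪ ⋃ j, {x | F.eval x = r j}) \ range y with hS
  have hfin : S.Finite := by
    refine Finite.subset (Finite.union ?_ (finite_iUnion fun j => ?_)) sdiff_subset
    · refine (F.derivative.roots.toFinset.finite_toSet).subset (fun x hx => ?_)
      simpa [hFd] using hx
    · have hne : F - Polynomial.C (r j) ≠ 0 := by
        intro h
        have : F.natDegree = 0 := by rw [sub_eq_zero.1 h, Polynomial.natDegree_C]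
        omega
      refine ((F - Polynomial.C (r j)).roots.toFinset.finite_toSet).subset (fun x hx => ?_)
      simpa [hne, sub_eq_zero] using hx
  have hyO : ∀ j, y j ∈ ball c ρ \ S := fun j => ⟨hy j, fun h => h.2 ⟨j, rfl⟩⟩
  have hO : IsOpen (ball c ρ \ S) := isOpen_ball.sdiff hfin.isClosed
  have hjoin : ∀ j, JoinedIn (ball c ρ \ S) c (y j) := fun j =>
    joinedIn_ball_diff hρ hfin (hi ▸ hyO i) (hyO j)
  choose γ hγ using hjoin
  set K : Set ℂ := ⋃ j, range (γ j) with hK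
  have hKc : IsCompact K := isCompact_iUnion fun j => isCompact_range (γ j).continuous
  have hKO : K ⊆ ball c ρ \ S := iUnion_subset fun j => range_subset_iff.2 (hγ j)
  obtain ⟨η₁, hη₁, hthick⟩ := hKc.exists_cthickening_subset_open hO hKO
  set U := thickening η₁ K with hU
  have hUc : U ⊆ cthickening η₁ K := thickening_subset_cthickening _ _
  have hcc : IsCompact (cthickening η₁ K) := hKc.cthickening
  have hyK : ∀ j, y j ∈ K := fun j => mem_iUnion.2 ⟨j, 1, (γ j).target⟩
  have hyU : ∀ j, y j ∈ U := fun j => self_subset_thickening hη₁ _ (hyK j)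
  have hUopen : IsOpen U := isOpen_thickening
  have hUmem : ∀ x ∈ U, ∃ j t, x ∈ ball (γ j t) η₁ := by
    intro x hx
    obtain ⟨z, hz, hd⟩ := mem_thickening_iff.1 hx
    obtain ⟨j, t, rfl⟩ := mem_iUnion.1 hz
    exact ⟨j, t, hd⟩
  have hballU : ∀ j t, ball (γ j t) η₁ ⊆ U := fun j t =>
    ball_subset_thickening (show γ j t ∈ K from mem_iUnion.2 ⟨j, t, rfl⟩) _
  have hcU : c ∈ U := hi ▸ hyU i
  have hUconn : IsConnected U := by
    refine ⟨⟨c, hcU⟩, isPreconnected_of_forall c fun x hx => ?_⟩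
    obtain ⟨j, t, hd⟩ := hUmem x hx
    refine ⟨range (γ j) ∪ ball (γ j t) η₁, union_subset ?_ (hballU j t),
      Or.inl ⟨0, (γ j).source⟩, Or.inr hd, ?_⟩
    · rintro _ ⟨t', rfl⟩
      exact hballU j t' (mem_ball_self hη₁)
    · exact (isPreconnected_range (γ j).continuous).union (γ j t) ⟨t, rfl⟩ (mem_ball_self hη₁)
        isPreconnected_ball
  -- non-vanishing derivative
  obtain ⟨c₀, hc₀, hc₀b⟩ : ∃ c₀ > 0, ∀ x ∈ cthickening η₁ K, c₀ ≤ ‖F.derivative.eval x‖ := by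
    obtain ⟨x₀, hx₀, hmin⟩ := hcc.exists_isMinOn ⟨c, hUc hcU⟩
      F.derivative.continuous.norm.continuousOn
    refine ⟨‖F.derivative.eval x₀‖, norm_pos_iff.2 fun h0 => ?_, fun x hx => hmin hx⟩
    by_cases hr' : x₀ ∈ range y
    · obtain ⟨j, rfl⟩ := hr'; exact hcrit j h0
    · exact (hthick hx₀).2 ⟨Or.inl h0, hr'⟩
  -- local sections
  have hlocal : ∀ j, ∃ (φ : ℂ → ℂ) (η : ℝ), 0 < η ∧ ∀ η' ≤ η,
      DifferentiableOn ℂ φ (ball (r j) η') ∧ MapsTo φ (ball (r j) η') U ∧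
      (∀ z ∈ ball (r j) η', F.eval (φ z) = z) ∧
      ∀ x ∈ U, F.eval x ∈ ball (r j) η' → φ (F.eval x) = x := by
    intro j
    have hd : deriv (fun x => F.eval x) (y j) ≠ 0 := by
      rw [Polynomial.deriv]; exact hcrit j
    obtain ⟨N, hN, hinj⟩ := exists_injOn_nhds hFdiff hd
    obtain ⟨N', hN'N, hN'o, hyN'⟩ := _root_.mem_nhds_iff.1 (inter_mem hN (hUopen.mem_nhds (hyU j)))
    obtain ⟨φ, η, hη, hφ, hmaps, hsec, -⟩ := exists_local_section hFdiff hd (hN'o.mem_nhds hyN')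
    rw [hyr] at hφ hmaps hsec
    -- Compactness: away from N' the value r j is not taken, as the only preimages kept are the y j'
    -- and r is injective. Hence values within η₂ of r j come from N', where F is injective.
    obtain ⟨η₂, hη₂, hη₂b⟩ : ∃ η₂ > 0, ∀ x ∈ cthickening η₁ K \ N', η₂ ≤ ‖F.eval x - r j‖ := by
      rcases (cthickening η₁ K \ N').eq_empty_or_nonempty with he | hne
      · exact ⟨1, one_pos, by simp [he]⟩
      · obtain ⟨x₀, hx₀, hmin⟩ := (hcc.diff hN'o).exists_isMinOn hne
          (f := fun x => ‖F.eval x - r j‖) ((F.continuous.sub continuous_const).norm.continuousOn)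
        refine ⟨‖F.eval x₀ - r j‖, norm_pos_iff.2 fun h0 => ?_, fun x hx => hmin hx⟩
        by_cases hr' : x₀ ∈ range y
        · obtain ⟨j', rfl⟩ := hr'
          rw [hyr, sub_eq_zero] at h0
          exact hx₀.2 (hr h0 ▸ hyN')
        · exact (hthick hx₀.1).2 ⟨Or.inr (mem_iUnion.2 ⟨j, sub_eq_zero.1 h0⟩), hr'⟩
    refine ⟨φ, min η η₂, by positivity, fun η' hη' => ?_⟩
    have hsub : ball (r j) η' ⊆ ball (r j) η := ball_subset_ball (hη'.trans (min_le_left _ _))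
    refine ⟨hφ.mono hsub, fun z hz => (hN'N (hmaps (hsub hz))).2, fun z hz => hsec z (hsub hz),
      fun x hx hFx => ?_⟩
    have hxN' : x ∈ N' := by
      by_contra hx'
      have h1 := hη₂b x ⟨hUc hx, hx'⟩
      have h2 := mem_ball.1 hFx
      rw [dist_eq_norm] at h2
      have h3 := hη'.trans (min_le_right η η₂)
      linarith
    exact hinj (hN'N (hmaps (hsub hFx))).1 (hN'N hxN').1 (hsec _ (hsub hFx))
  choose φ η hη hφ using hlocal
  -- oscillation
  choose D hD hDb using fun j => exists_oscillation_bound_path (γ j) hη₁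
  set C := ∑ j, D j with hC
  have hDC : ∀ j, D j ≤ C := fun j => Finset.single_le_sum (fun j _ => hD j) (Finset.mem_univ j)
  have hC0 : 0 ≤ C := Finset.sum_nonneg fun j _ => hD j
  refine ⟨U, min (η 0) (min (η 1) (η 2)), c₀, 2 * (C + η₁), hUopen, hUconn,
    fun x hx => (hthick (hUc hx)).1, hcU, lt_min (hη 0) (lt_min (hη 1) (hη 2)), hc₀, by positivity,
    fun x hx => hc₀b x (hUc hx), ⟨φ, fun j => hφ j _ ?_⟩, fun f δ hδ hf hfd => ?_⟩
  · fin_cases j <;> simp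
  · have hpt : ∀ x ∈ U, DifferentiableAt ℂ f x ∧ ‖deriv f x‖ ≤ δ := fun x hx =>
      ⟨hf.differentiableAt (hUopen.mem_nhds hx), hfd x hx⟩
    have h1 : ∀ x ∈ U, ‖f x - f c‖ ≤ (C + η₁) * δ := by
      intro x hx
      obtain ⟨j, t, hd⟩ := hUmem x hx
      have h2 := hDb j f δ hδ (fun t x hx => hpt x (hballU j t hx)) t
      have h3 := (convex_ball (γ j t) η₁).norm_image_sub_le_of_norm_deriv_le (f := f) (C := δ)
        (fun x hx => (hpt x (hballU j t hx)).1) (fun x hx => (hpt x (hballU j t hx)).2)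
        (mem_ball_self hη₁) hd
      rw [← dist_eq_norm x] at h3
      have h4 := norm_add_le (f x - f (γ j t)) (f (γ j t) - f c)
      rw [sub_add_sub_cancel] at h4
      have h5 : D j * δ ≤ C * δ := by gcongr; exact hDC j
      have h6 : δ * dist x (γ j t) ≤ δ * η₁ := by gcongr; exact (mem_ball.1 hd).le
      linarith
    intro x hx x' hx'
    have h2 := norm_sub_le (f x - f c) (f x' - f c)
    rw [sub_sub_sub_cancel_right] at h2
    linarith [h1 x hx, h1 x' hx']

/-! ### The vertical system -/

theorem deriv_iterate_add {f : ℂ → ℂ} (hf : Differentiable ℂ f) (a b : ℕ) (w : ℂ) :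
    deriv f^[a + b] w = deriv f^[a] (f^[b] w) * deriv f^[b] w := by
  rw [Function.iterate_add]
  exact deriv_comp w ((hf.iterate a) _) ((hf.iterate b) _)

/-- `g` is an inverse branch of `f` on `ball r ρ`, contracting to the fixed point `r`. -/
structure IsContractingBranch (f g : ℂ → ℂ) (r : ℂ) (ρ θ : ℝ) : Prop where
  rho_pos : 0 < ρ
  theta_pos : 0 < θ
  theta_lt : θ < 1
  diff : DifferentiableOn ℂ g (ball r ρ)
  fixed : g r = r
  right_inv : ∀ x ∈ ball r ρ, f (g x) = x
  contr : ∀ x ∈ ball r ρ, ‖g x - r‖ ≤ θ * ‖x - r‖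
  le_deriv : ∀ x ∈ ball r ρ, θ⁻¹ ≤ ‖deriv f (g x)‖

namespace IsContractingBranch

variable {f g : ℂ → ℂ} {r : ℂ} {ρ θ : ℝ}

theorem norm_iterate_le (h : IsContractingBranch f g r ρ θ) {x : ℂ} (hx : x ∈ ball r ρ) (t : ℕ) :
    g^[t] x ∈ ball r ρ ∧ ‖g^[t] x - r‖ ≤ θ ^ t * ρ := by
  have hx' : ‖x - r‖ < ρ := by simpa [dist_eq_norm] using hx
  suffices H : ‖g^[t] x - r‖ ≤ θ ^ t * ‖x - r‖ by
    have h1 : θ ^ t ≤ 1 := pow_le_one₀ h.theta_pos.le h.theta_lt.le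
    refine ⟨?_, H.trans ?_⟩
    · rw [mem_ball, dist_eq_norm]
      nlinarith [norm_nonneg (x - r)]
    · have := pow_pos h.theta_pos t
      gcongr
  induction t with
  | zero => simp
  | succ t ih =>
    rw [Function.iterate_succ_apply']
    have h1 : θ ^ t ≤ 1 := pow_le_one₀ h.theta_pos.le h.theta_lt.le
    have h2 : g^[t] x ∈ ball r ρ := by
      rw [mem_ball, dist_eq_norm]
      nlinarith [norm_nonneg (x - r)]
    refine (h.contr _ h2).trans ?_
    rw [pow_succ']
    have := h.theta_pos
    calc θ * ‖g^[t] x - r‖ ≤ θ * (θ ^ t * ‖x - r‖) := by gcongr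
      _ = _ := by ring

theorem iterate_right_inv (h : IsContractingBranch f g r ρ θ) {x : ℂ} (hx : x ∈ ball r ρ) (s t : ℕ) :
    f^[s] (g^[t + s] x) = g^[t] x := by
  induction s with
  | zero => rfl
  | succ s ih =>
    rw [← add_assoc, Function.iterate_succ_apply' g, Function.iterate_succ_apply f,
      h.right_inv _ (h.norm_iterate_le hx _).1, ih]

theorem iterate_section (h : IsContractingBranch f g r ρ θ) {x : ℂ} (hx : x ∈ ball r ρ) (t : ℕ) :
    f^[t] (g^[t] x) = x := by
  simpa using h.iterate_right_inv hx t 0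

theorem diff_iterate (h : IsContractingBranch f g r ρ θ) (t : ℕ) :
    DifferentiableOn ℂ g^[t] (ball r ρ) := by
  induction t with
  | zero => exact differentiableOn_id
  | succ t ih =>
    rw [Function.iterate_succ']
    exact h.diff.comp ih fun x hx => (h.norm_iterate_le hx t).1

theorem le_deriv_iterate (h : IsContractingBranch f g r ρ θ) (hf : Differentiable ℂ f) {x : ℂ}
    (hx : x ∈ ball r ρ) (s t : ℕ) : (θ ^ s)⁻¹ ≤ ‖deriv f^[s] (g^[t + s] x)‖ := by
  have hθ := h.theta_pos
  induction s with
  | zero => simp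
  | succ s ih =>
    have h1 : f (g^[t + (s + 1)] x) = g^[t + s] x := by
      simpa [add_assoc] using h.iterate_right_inv hx 1 (t + s)
    rw [deriv_iterate_add hf s 1, Function.iterate_one, h1, norm_mul, pow_succ, mul_inv]
    have h2 : θ⁻¹ ≤ ‖deriv f (g^[t + (s + 1)] x)‖ := by
      rw [← add_assoc, Function.iterate_succ_apply']
      exact h.le_deriv _ (h.norm_iterate_le hx _).1
    gcongr

/-- The s iterations still to come expand by at least θ⁻ˢ. Thus the derivatives along an orbit,
compared with the final one, are dominated by a geometric series. -/
theorem norm_deriv_iterate_le (h : IsContractingBranch f g r ρ θ) (hf : Differentiable ℂ f) {x : ℂ}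
    (hx : x ∈ ball r ρ) (t s : ℕ) :
    ‖deriv f^[t] (g^[t + s] x)‖ ≤ θ ^ s * ‖deriv f^[t + s] (g^[t + s] x)‖ := by
  have hθ := h.theta_pos
  rw [add_comm t s, deriv_iterate_add hf s t, norm_mul, h.iterate_right_inv hx t s, ← mul_assoc]
  have h1 := h.le_deriv_iterate hf hx s 0
  rw [zero_add, inv_le_iff_one_le_mul₀ (by positivity)] at h1
  rw [mul_comm] at h1
  nlinarith [norm_nonneg (deriv f^[t] (g^[s + t] x))]

theorem isOpen_image (h : IsContractingBranch f g r ρ θ) (hf : Differentiable ℂ f) {U : Set ℂ}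
    (hU : IsOpen U) (hUb : U ⊆ ball r ρ) (t : ℕ) : IsOpen (g^[t] '' U) := by
  rw [isOpen_iff_mem_nhds]
  rintro _ ⟨u, hu, rfl⟩
  have h1 : HasStrictDerivAt g^[t] (deriv g^[t] u) u :=
    ((h.diff_iterate t).analyticAt (isOpen_ball.mem_nhds (hUb hu))).hasStrictDerivAt
  have h2 := deriv_section (hf.iterate t) isOpen_ball (h.diff_iterate t)
    (fun y hy => h.iterate_section hy t) (hUb hu)
  rw [← h1.map_nhds_eq (right_ne_zero_of_mul (h2 ▸ one_ne_zero))]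
  exact image_mem_map (hU.mem_nhds hu)

end IsContractingBranch

theorem geom_sum_reflect_le {θ : ℝ} (h0 : 0 < θ) (h1 : θ < 1) (L : ℕ) :
    ∑ t ∈ Finset.range L, θ ^ (L - t) ≤ 1 / (1 - θ) := by
  have e : ∑ t ∈ Finset.range L, θ ^ (L - t) ≤ ∑ t ∈ Finset.range L, θ ^ (L - 1 - t) :=
    Finset.sum_le_sum fun t ht => pow_le_pow_of_le_one h0.le h1.le (by omega)
  refine e.trans ?_
  rw [Finset.sum_range_reflect (fun t => θ ^ t), geom_sum_eq h1.ne, ← neg_div_neg_eq, neg_sub,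
    neg_sub]
  have : 0 < 1 - θ := by linarith
  gcongr
  linarith [pow_pos h0 L]

/-- The data of the base dynamics: the vertical system `V` of `b = Q^l`, the inverse branches
`ψ i j : V_j → V_i` of `b`, and the estimates along the first `l` iterates of `Q`. -/
structure IsBaseSystem (Q : ℂ → ℂ) (l : ℕ) (r : Fin 3 → ℂ) (V : Fin 3 → Set ℂ)
    (ψ : Fin 3 → Fin 3 → ℂ → ℂ) (η C : ℝ) : Prop where
  vertical : IsVerticalSystem Q^[l] r V
  subset : ∀ i, V i ⊆ ball (r i) η
  diff : ∀ i j, DifferentiableOn ℂ (ψ i j) (ball (r j) (2 * η))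
  maps : ∀ i j, MapsTo (ψ i j) (ball (r j) (2 * η)) (V i)
  right_inv : ∀ i j, ∀ z ∈ ball (r j) (2 * η), Q^[l] (ψ i j z) = z
  four_le : ∀ i, ∀ w ∈ V i, 4 ≤ ‖deriv Q^[l] w‖
  sum_dist : ∀ i, ∀ w ∈ V i, ∑ t ∈ Finset.range l, ‖Q^[t] w - r i‖ ≤ C
  sum_deriv : ∀ i, ∀ w ∈ V i, ∑ t ∈ Finset.range l, ‖deriv Q^[t] w‖ ≤ C * ‖deriv Q^[l] w‖
  oscillation : ∀ i, ∀ (f : ℂ → ℂ) (δ : ℝ), 0 ≤ δ → DifferentiableOn ℂ f (V i) →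
    (∀ x ∈ V i, ‖deriv f x‖ ≤ δ) → ∀ x ∈ V i, ∀ x' ∈ V i, ‖f x - f x'‖ ≤ C * δ

/-- With l = k + L, the set V_i is g_i^L(U_i): g_i is the contracting inverse branch at r_i, and U_i
contains, for each j, an unramified preimage of r_j under Q^k. The constants do not depend on l,
because the first L iterates contribute geometric sums and only the k last ones, with k fixed, leave
the linear regime. -/
theorem exists_isBaseSystem {Q : Polynomial ℂ} (hQ : 2 ≤ Q.natDegree) {r : Fin 3 → ℂ}
    (hr : Function.Injective r) (hfix : ∀ i, Q.eval (r i) = r i)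
    (hrep : ∀ i, 1 < ‖Q.derivative.eval (r i)‖)
    (hpost : ∀ j k y, (pmap Q)^[k] y = r j → deriv (pmap Q)^[k] y ≠ 0) :
    ∃ η C : ℝ, 0 < η ∧ 0 < C ∧ ∃ L₀ : ℕ, ∀ l ≥ L₀, ∃ V ψ, IsBaseSystem (pmap Q) l r V ψ η C := by
  have hQd : Differentiable ℂ (pmap Q) := Q.differentiable
  have hderiv : ∀ x, deriv (pmap Q) x = Q.derivative.eval x := fun x => Polynomial.deriv Q
  have hbr : ∀ i, ∃ (g : ℂ → ℂ) (ρ θ : ℝ), IsContractingBranch (pmap Q) g (r i) ρ θ := by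
    intro i
    obtain ⟨g, ρ, θ, h1, h2, h3, h4, h5, h6, h7, h8⟩ :=
      exists_contracting_branch hQd (hfix i) (by rw [hderiv]; exact hrep i)
    exact ⟨g, ρ, θ, h1, h2, h3, h4, h5, h6, h7, h8⟩
  choose g ρ θ hg using hbr
  have hne : ∀ j, Q.derivative.eval (r j) ≠ 0 := fun j => norm_pos_iff.1 (by linarith [hrep j])
  -- a common time `k`
  choose K hK using fun i j => exists_preimage_near hQ (hfix i) (hrep i) (hfix j) (hne j)
    (ball_mem_nhds (r i) (hg i).rho_pos)
  set k := ∑ i, ∑ j, K i j with hk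
  have hKk : ∀ i j, K i j ≤ k := fun i j =>
    (Finset.single_le_sum (f := fun j => K i j) (fun _ _ => Nat.zero_le _) (Finset.mem_univ j)).trans
      (Finset.single_le_sum (f := fun i => ∑ j, K i j) (fun _ _ => Nat.zero_le _)
        (Finset.mem_univ i))
  -- For i = j the preimage is the fixed point itself, so that r_i lies in U_i and hence in V_i.
  have hy : ∀ i j, ∃ y ∈ ball (r i) (ρ i), (pmap Q)^[k] y = r j ∧ (i = j → y = r i) := by
    intro i j
    by_cases hij : i = j
    · subst hij
      exact ⟨r i, mem_ball_self (hg i).rho_pos, Function.iterate_fixed (hfix i) k, fun _ => rfl⟩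
    · obtain ⟨y, hy1, hy2⟩ := hK i j k (hKk i j)
      exact ⟨y, hy1, hy2, fun h => absurd h hij⟩
  choose y hyb hyr hyi using hy
  set F : Polynomial ℂ := Q.comp^[k] Polynomial.X with hF
  have hFe : (fun x => F.eval x) = (pmap Q)^[k] := by
    funext x
    rw [hF, Polynomial.iterate_comp_eval, Polynomial.eval_X]
    rfl
  have hFx : ∀ x, F.eval x = (pmap Q)^[k] x := fun x => congrFun hFe x
  have hFd : ∀ x, F.derivative.eval x = deriv (pmap Q)^[k] x := by
    intro x
    rw [← hFe, Polynomial.deriv]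
  have hFdeg : 0 < F.natDegree := by
    rw [hF, Polynomial.natDegree_iterate_comp, Polynomial.natDegree_X, mul_one]
    positivity
  choose U η c₀ C hUo hUc hUb hcU hη hc₀ hC hcd hφ hosc using fun i =>
    exists_adapted_neighbourhood (F := F) hFdeg (hg i).rho_pos hr (hyb i)
      (fun j => by rw [hFx]; exact hyr i j)
      (fun j => by rw [hFd]; exact hpost j k _ (hyr i j)) (hyi i i rfl)
  choose φ hφ using hφ
  -- uniform constants
  set η' := min (η 0) (min (η 1) (η 2)) / 2 with hη'
  have hη'pos : 0 < η' := half_pos (lt_min (hη 0) (lt_min (hη 1) (hη 2)))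
  have hη'le : ∀ i, 2 * η' ≤ η i := by
    intro i
    have : 2 * η' = min (η 0) (min (η 1) (η 2)) := by rw [hη']; ring
    rw [this]
    fin_cases i <;> simp
  have hbd : ∀ i, ∃ M : ℝ, 0 ≤ M ∧ ∀ s < k, ∀ x ∈ ball (r i) (ρ i),
      ‖(pmap Q)^[s] x - r i‖ ≤ M ∧ ‖deriv (pmap Q)^[s] x‖ ≤ M := by
    intro i
    have h1 : ∀ s : ℕ, ∃ M : ℝ, ∀ x ∈ closedBall (r i) (ρ i),
        ‖(pmap Q)^[s] x - r i‖ + ‖deriv (pmap Q)^[s] x‖ ≤ M := by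
      intro s
      obtain ⟨M, hM⟩ := (isCompact_closedBall (r i) (ρ i)).exists_bound_of_continuousOn
        (f := fun x => ‖(pmap Q)^[s] x - r i‖ + ‖deriv (pmap Q)^[s] x‖)
        (((continuous_pmap_iterate Q s).sub continuous_const).norm.add
          (continuous_deriv_of_differentiable (differentiable_pmap_iterate Q s)).norm).continuousOn
      exact ⟨M, fun x hx => (le_abs_self _).trans (hM x hx)⟩
    choose M hM using h1
    have hM0 : ∀ s, 0 ≤ M s := fun s =>
      le_trans (by positivity) (hM s (r i) (mem_closedBall_self (hg i).rho_pos.le))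
    refine ⟨∑ s ∈ Finset.range k, M s, Finset.sum_nonneg fun s _ => hM0 s, fun s hs x hx => ?_⟩
    have h2 := hM s x (ball_subset_closedBall hx)
    have h3 : M s ≤ ∑ s ∈ Finset.range k, M s :=
      Finset.single_le_sum (fun s _ => hM0 s) (Finset.mem_range.2 hs)
    constructor <;> linarith [norm_nonneg ((pmap Q)^[s] x - r i), norm_nonneg (deriv (pmap Q)^[s] x)]
  choose M hM0 hM using hbd
  set D : Fin 3 → ℝ := fun i => (1 / (1 - θ i)) * ρ i + k * M i + (1 / (1 - θ i) + k * M i) / c₀ i +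
    C i with hD
  have h1θ : ∀ i, 0 < 1 - θ i := fun i => by linarith [(hg i).theta_lt]
  have hDparts : ∀ i, 0 ≤ (1 / (1 - θ i)) * ρ i ∧ 0 ≤ k * M i ∧
      0 ≤ (1 / (1 - θ i) + k * M i) / c₀ i := fun i => by
    have := h1θ i; have := (hg i).rho_pos; have := hM0 i; have := hc₀ i
    refine ⟨by positivity, by positivity, by positivity⟩
  have hD0 : ∀ i, 0 ≤ D i := fun i => by
    have := hDparts i; have := hC i
    simp only [hD]; linarith
  set C' := ∑ i, D i + 1 with hC'
  have hDC : ∀ i, D i ≤ C' := fun i => by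
    have := Finset.single_le_sum (fun i _ => hD0 i) (Finset.mem_univ i)
    linarith
  have hlarge : ∀ i, ∀ᶠ L : ℕ in atTop, θ i ^ L * ρ i < η' ∧ 4 * θ i ^ L ≤ c₀ i := by
    intro i
    have h1 := tendsto_pow_atTop_nhds_zero_of_lt_one (hg i).theta_pos.le (hg i).theta_lt
    have h2 := h1.mul_const (ρ i)
    have h3 := h1.const_mul 4
    rw [zero_mul] at h2
    rw [mul_zero] at h3
    filter_upwards [h2.eventually_lt_const hη'pos, h3.eventually_lt_const (hc₀ i)] with L h4 h5
    exact ⟨h4, h5.le⟩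
  obtain ⟨L₁, hL₁⟩ := eventually_atTop.1 (eventually_all.2 hlarge)
  refine ⟨η', C', hη'pos, by have := Finset.sum_nonneg fun i (_ : i ∈ Finset.univ) => hD0 i; linarith,
    L₁ + k, fun l hl => ?_⟩
  obtain ⟨L, rfl⟩ : ∃ L, l = k + L := ⟨l - k, by omega⟩
  have hL : L₁ ≤ L := by omega
  set V : Fin 3 → Set ℂ := fun i => (g i)^[L] '' U i with hV
  set ψ : Fin 3 → Fin 3 → ℂ → ℂ := fun i j => (g i)^[L] ∘ φ i j with hψ
  have hsub2 : ∀ i j, ball (r j) (2 * η') ⊆ ball (r j) (η i) := fun i j =>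
    ball_subset_ball (hη'le i)
  have hVη : ∀ i, V i ⊆ ball (r i) η' := by
    rintro i _ ⟨u, hu, rfl⟩
    rw [mem_ball, dist_eq_norm]
    exact ((hg i).norm_iterate_le (hUb i hu) L).2.trans_lt (hL₁ L hL i).1
  have hbV : ∀ i, ∀ u ∈ U i, (pmap Q)^[k + L] ((g i)^[L] u) = F.eval u := by
    intro i u hu
    rw [Function.iterate_add_apply, (hg i).iterate_section (hUb i hu), hFx]
  have hmaps : ∀ i j, MapsTo (ψ i j) (ball (r j) (2 * η')) (V i) := fun i j z hz =>
    ⟨_, (hφ i j).2.1 (hsub2 i j hz), rfl⟩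
  have hsec : ∀ i j, ∀ z ∈ ball (r j) (2 * η'), (pmap Q)^[k + L] (ψ i j z) = z := by
    intro i j z hz
    rw [hψ]
    simp only [Function.comp]
    rw [hbV i _ ((hφ i j).2.1 (hsub2 i j hz)), (hφ i j).2.2.1 z (hsub2 i j hz)]
  have hderL : ∀ i, ∀ u ∈ U i, (θ i ^ L)⁻¹ ≤ ‖deriv (pmap Q)^[L] ((g i)^[L] u)‖ := by
    intro i u hu
    simpa using (hg i).le_deriv_iterate hQd (hUb i hu) L 0
  have hderb : ∀ i, ∀ u ∈ U i, c₀ i * ‖deriv (pmap Q)^[L] ((g i)^[L] u)‖ ≤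
      ‖deriv (pmap Q)^[k + L] ((g i)^[L] u)‖ := by
    intro i u hu
    rw [deriv_iterate_add hQd, norm_mul, (hg i).iterate_section (hUb i hu), ← hFd]
    gcongr
    exact hcd i u hu
  have hfour : ∀ i, ∀ w ∈ V i, 4 ≤ ‖deriv (pmap Q)^[k + L] w‖ := by
    rintro i _ ⟨u, hu, rfl⟩
    refine le_trans ?_ (hderb i u hu)
    have h1 := (hL₁ L hL i).2
    have h2 := pow_pos (hg i).theta_pos L
    calc (4 : ℝ) = (4 * θ i ^ L) * (θ i ^ L)⁻¹ := by field_simp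
      _ ≤ c₀ i * ‖deriv (pmap Q)^[L] ((g i)^[L] u)‖ := by
        have := hderL i u hu
        have := (hc₀ i).le
        gcongr
  have hsmall : ∀ j, ball (r j) η' ⊆ ball (r j) (2 * η') := fun j =>
    ball_subset_ball (by linarith)
  refine ⟨V, ψ, ⟨fun i => (hg i).isOpen_image hQd (hUo i) (hUb i) L, fun i =>
    (hUc i).image _ (((hg i).diff_iterate L).continuousOn.mono (hUb i)),
    fun i => ⟨r i, hcU i, Function.iterate_fixed (hg i).fixed L⟩,
    fun i w hw => by linarith [hfour i w hw], fun i => ?_, fun i j => ?_⟩, hVη,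
    fun i j => ?_, hmaps, hsec, hfour, ?_, ?_, ?_⟩
  -- The closed balls of radius η' lie in the domains of the sections ψ i j, whose values are in
  -- V_i.
  · have h1 : closure (⋃ j, V j) ⊆ ⋃ j, closedBall (r j) η' := by
      refine closure_minimal (iUnion_mono fun j => (hVη j).trans ball_subset_closedBall) ?_
      exact isClosed_iUnion_of_finite fun j => isClosed_closedBall
    refine h1.trans (iUnion_subset fun j z hz => ?_)
    have hz' : z ∈ ball (r j) (2 * η') := closedBall_subset_ball (by linarith) hz
    exact ⟨ψ i j z, hmaps i j hz', hsec i j z hz'⟩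
  · refine ⟨fun w hw => hw.2, ?_, fun z hz => ?_⟩
    · have h1 : ∀ w ∈ V i ∩ (pmap Q)^[k + L] ⁻¹' V j, ψ i j ((pmap Q)^[k + L] w) = w := by
        rintro _ ⟨⟨u, hu, rfl⟩, hb⟩
        rw [mem_preimage, hbV i u hu] at hb
        rw [hbV i u hu, hψ]
        simp only [Function.comp]
        rw [(hφ i j).2.2.2 u hu (hsub2 i j (hsmall j (hVη j hb)))]
      intro w hw w' hw' heq
      rw [← h1 w hw, ← h1 w' hw', heq]
    · have hz' := hsmall j (hVη j hz)
      exact ⟨ψ i j z, ⟨hmaps i j hz', by rw [mem_preimage, hsec i j z hz']; exact hz⟩, hsec i j z hz'⟩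
  · exact ((hg i).diff_iterate L).comp ((hφ i j).1.mono (hsub2 i j)) fun z hz =>
      hUb i ((hφ i j).2.1 (hsub2 i j hz))
  · rintro i _ ⟨u, hu, rfl⟩
    have hu' := hUb i hu
    rw [add_comm k L, Finset.sum_range_add]
    have h1 : ∑ t ∈ Finset.range L, ‖(pmap Q)^[t] ((g i)^[L] u) - r i‖ ≤
        (1 / (1 - θ i)) * ρ i := by
      refine le_trans (Finset.sum_le_sum fun t ht => ?_) (mul_le_mul_of_nonneg_right
        (geom_sum_reflect_le (hg i).theta_pos (hg i).theta_lt L) (hg i).rho_pos.le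
        |> (Finset.sum_mul _ _ _).ge.trans)
      have ht' := Finset.mem_range.1 ht
      have h2 := (hg i).iterate_right_inv hu' t (L - t)
      rw [Nat.sub_add_cancel ht'.le] at h2
      rw [h2]
      exact ((hg i).norm_iterate_le hu' _).2
    have h2 : ∑ s ∈ Finset.range k, ‖(pmap Q)^[L + s] ((g i)^[L] u) - r i‖ ≤ k * M i := by
      refine (Finset.sum_le_card_nsmul _ _ (M i) fun s hs => ?_).trans (by simp)
      rw [add_comm L s, Function.iterate_add_apply, (hg i).iterate_section hu']
      exact (hM i s (Finset.mem_range.1 hs) u hu').1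
    have h3 := hDC i
    have := hDparts i
    have := hC i
    simp only [hD] at h3
    linarith
  · rintro i _ ⟨u, hu, rfl⟩
    have hu' := hUb i hu
    set N := ‖deriv (pmap Q)^[L] ((g i)^[L] u)‖ with hN
    have hN0 : 0 ≤ N := norm_nonneg _
    have h4 := hderb i u hu
    rw [add_comm k L, Finset.sum_range_add]
    rw [add_comm k L] at h4
    have h1 : ∑ t ∈ Finset.range L, ‖deriv (pmap Q)^[t] ((g i)^[L] u)‖ ≤ (1 / (1 - θ i)) * N := by
      refine le_trans (Finset.sum_le_sum fun t ht => ?_) (mul_le_mul_of_nonneg_right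
        (geom_sum_reflect_le (hg i).theta_pos (hg i).theta_lt L) hN0
        |> (Finset.sum_mul _ _ _).ge.trans)
      have ht' := Finset.mem_range.1 ht
      have h2 := (hg i).norm_deriv_iterate_le hQd hu' t (L - t)
      rwa [Nat.add_sub_cancel' ht'.le] at h2
    have h2 : ∑ s ∈ Finset.range k, ‖deriv (pmap Q)^[L + s] ((g i)^[L] u)‖ ≤ k * M i * N := by
      refine (Finset.sum_le_card_nsmul _ _ (M i * N) fun s hs => ?_).trans
        (by simp [mul_assoc])
      rw [add_comm L s, deriv_iterate_add hQd, norm_mul, (hg i).iterate_section hu']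
      gcongr
      exact (hM i s (Finset.mem_range.1 hs) u hu').2
    have h3 := hDC i
    have hp := hDparts i
    have := hC i
    simp only [hD] at h3
    have h5 : (1 / (1 - θ i) + k * M i) / c₀ i ≤ C' := by linarith
    have h6 : (1 / (1 - θ i) + k * M i) * N ≤ (1 / (1 - θ i) + k * M i) / c₀ i *
        ‖deriv (pmap Q)^[L + k] ((g i)^[L] u)‖ := by
      rw [div_mul_eq_mul_div, le_div_iff₀ (hc₀ i), mul_assoc, mul_comm N]
      have := h1θ i; have := hM0 i
      gcongr
    have h7 : (1 / (1 - θ i) + k * M i) / c₀ i * ‖deriv (pmap Q)^[L + k] ((g i)^[L] u)‖ ≤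
        C' * ‖deriv (pmap Q)^[L + k] ((g i)^[L] u)‖ := by gcongr
    linarith
  · intro i f δ hδ hf hfd
    have hGd := (hg i).diff_iterate L
    have hVo : IsOpen (V i) := (hg i).isOpen_image hQd (hUo i) (hUb i) L
    have hcomp : DifferentiableOn ℂ (f ∘ (g i)^[L]) (U i) :=
      hf.comp (hGd.mono (hUb i)) fun u hu => ⟨u, hu, rfl⟩
    -- Transport by the contraction g_i^L reduces the oscillation on V_i, which shrinks with L, to
    -- that on the fixed set U_i.
    have hder : ∀ u ∈ U i, ‖deriv (f ∘ (g i)^[L]) u‖ ≤ δ := by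
      intro u hu
      have hm : (g i)^[L] u ∈ V i := ⟨u, hu, rfl⟩
      rw [deriv_comp u (hf.differentiableAt (hVo.mem_nhds hm))
        (hGd.differentiableAt (isOpen_ball.mem_nhds (hUb i hu))), norm_mul]
      have h1 := deriv_section (hQd.iterate L) isOpen_ball hGd
        (fun y hy => (hg i).iterate_section hy L) (hUb i hu)
      have h2 : ‖deriv (pmap Q)^[L] ((g i)^[L] u)‖ * ‖deriv (g i)^[L] u‖ = 1 := by
        rw [← norm_mul, h1, norm_one]
      have h3 := hderL i u hu
      have h4 : 1 ≤ (θ i ^ L)⁻¹ := by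
        rw [one_le_inv₀ (pow_pos (hg i).theta_pos L)]
        exact pow_le_one₀ (hg i).theta_pos.le (hg i).theta_lt.le
      have h5 : ‖deriv (g i)^[L] u‖ ≤ 1 := by
        nlinarith [norm_nonneg (deriv (g i)^[L] u)]
      calc _ ≤ δ * 1 := by gcongr; exact hfd _ hm
        _ = δ := mul_one δ
    have h8 : C i ≤ C' := by
      have h3 := hDC i
      have hp := hDparts i
      simp only [hD] at h3
      linarith
    rintro _ ⟨u, hu, rfl⟩ _ ⟨u', hu', rfl⟩
    refine (hosc i _ δ hδ hcomp hder u hu u' hu').trans ?_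
    gcongr

/-! ### Three translations -/

/-- If no real part were negative, all three would vanish since their sum does, and every c_i would
lie on the real line spanned by iu. Compactness of the circle makes the bound uniform. -/
theorem exists_pos_forall_exists_re_le {c : Fin 3 → ℂ} (hc : ¬ Collinear ℝ (range c))
    (hsum : ∑ j, c j = 0) :
    ∃ κ : ℝ, 0 < κ ∧ ∀ u : ℂ, ‖u‖ = 1 → ∃ i, (starRingEnd ℂ u * c i).re ≤ -κ := by
  set m : ℂ → ℝ := fun u => max (-(starRingEnd ℂ u * c 0).re)
    (max (-(starRingEnd ℂ u * c 1).re) (-(starRingEnd ℂ u * c 2).re)) with hm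
  have hcont : Continuous m := by
    have : ∀ i, Continuous fun u : ℂ => -(starRingEnd ℂ u * c i).re := fun i =>
      (Complex.continuous_re.comp (Complex.continuous_conj.mul continuous_const)).neg
    exact (this 0).max ((this 1).max (this 2))
  have hpos : ∀ u : ℂ, ‖u‖ = 1 → 0 < m u := by
    intro u hu
    by_contra! hle
    obtain ⟨h0, h12⟩ := max_le_iff.1 hle
    obtain ⟨h1, h2⟩ := max_le_iff.1 h12
    have hs : (starRingEnd ℂ u * c 0).re + (starRingEnd ℂ u * c 1).re +
        (starRingEnd ℂ u * c 2).re = 0 := by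
      rw [← Complex.add_re, ← Complex.add_re, ← mul_add, ← mul_add]
      rw [Fin.sum_univ_three] at hsum
      rw [hsum]; simp
    have hz : ∀ i, (starRingEnd ℂ u * c i).re = 0 := by
      intro i
      fin_cases i <;> simp only [Fin.zero_eta, Fin.mk_one, Fin.reduceFinMk] <;> linarith
    apply hc
    rw [collinear_iff_exists_forall_eq_smul_vadd]
    refine ⟨0, Complex.I * u, ?_⟩
    · rintro _ ⟨i, rfl⟩
      refine ⟨(starRingEnd ℂ u * c i).im, ?_⟩
      have h3 : starRingEnd ℂ u * c i = ((starRingEnd ℂ u * c i).im : ℂ) * Complex.I := by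
        apply Complex.ext <;> simp [hz i]
      have h4 : u * starRingEnd ℂ u = 1 := by
        rw [Complex.mul_conj, Complex.normSq_eq_norm_sq, hu]; simp
      rw [vadd_eq_add, add_zero, Complex.real_smul]
      calc c i = u * starRingEnd ℂ u * c i := by rw [h4, one_mul]
        _ = u * (starRingEnd ℂ u * c i) := by ring
        _ = _ := by rw [h3]; simp; ring
  obtain ⟨u₀, hu₀, hmin⟩ := (isCompact_sphere (0 : ℂ) 1).exists_isMinOn
    ⟨1, by simp⟩ hcont.continuousOn
  refine ⟨m u₀, hpos u₀ (by simpa using hu₀), fun u hu => ?_⟩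
  have h1 : m u₀ ≤ m u := hmin (by simpa using hu)
  rcases le_max_iff.1 h1 with h | h
  · exact ⟨0, by linarith⟩
  rcases le_max_iff.1 h with h | h
  · exact ⟨1, by linarith⟩
  · exact ⟨2, by linarith⟩

/-- Adding a c_i that points against z gives ‖z + c_i‖² ≤ ‖z‖² - 2κ‖z‖ + B²; on a large disc the
linear gain beats B². For ‖z‖ ≤ R/2 any translation will do. -/
theorem exists_covering_translations {c : Fin 3 → ℂ} (hc : ¬ Collinear ℝ (range c))
    (hsum : ∑ j, c j = 0) :
    ∃ R γ : ℝ, 0 < R ∧ 0 < γ ∧ γ ≤ 1 / 4 ∧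
      ∀ z : ℂ, ‖z‖ ≤ (1 + γ) * R → ∃ i, ‖z + c i‖ ≤ (1 - γ) * R := by
  obtain ⟨κ₀, hκ₀, hre⟩ := exists_pos_forall_exists_re_le hc hsum
  set B := ∑ i, ‖c i‖ + 1 with hB
  have hBc : ∀ i, ‖c i‖ ≤ B := fun i => by
    have := Finset.single_le_sum (fun i _ => norm_nonneg (c i)) (Finset.mem_univ i)
    linarith
  have hB0 : 0 < B := by positivity
  set κ := min κ₀ B with hκ
  have hκ0 : 0 < κ := lt_min hκ₀ hB0
  have hκB : κ ≤ B := min_le_right _ _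
  have hκκ : κ ≤ κ₀ := min_le_left _ _
  -- For ‖z‖ ≥ R/2 the gain 2κ‖z‖ is at least κR = 4B². The choice of γ makes ((1 + γ)² - (1 -
  -- γ)²)R² = 4γR² at most κR/2 = 2B².
  set R := 4 * B ^ 2 / κ with hR
  have hR0 : 0 < R := by positivity
  have hRκ : R * κ = 4 * B ^ 2 := by rw [hR]; field_simp
  have hRB : 4 * B ≤ R := by
    rw [hR, le_div_iff₀ hκ0]; nlinarith
  set γ := min (1 / 4) (κ / (8 * R)) with hγ
  have hγ0 : 0 < γ := by positivity
  have hγ4 : γ ≤ 1 / 4 := min_le_left _ _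
  have hγR : γ * (8 * R) ≤ κ := by
    have : γ ≤ κ / (8 * R) := min_le_right _ _
    rwa [le_div_iff₀ (by positivity)] at this
  refine ⟨R, γ, hR0, hγ0, hγ4, fun z hz => ?_⟩
  rcases le_or_gt ‖z‖ (R / 2) with h | h
  · refine ⟨0, (norm_add_le _ _).trans ?_⟩
    nlinarith [hBc 0]
  · have hz0 : 0 < ‖z‖ := by linarith
    obtain ⟨i, hi⟩ := hre (z / ‖z‖) (by rw [norm_div]; simp [hz0.ne'])
    refine ⟨i, ?_⟩
    have h1 : (starRingEnd ℂ z * c i).re ≤ -κ * ‖z‖ := by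
      have h2 : starRingEnd ℂ z * c i = (‖z‖ : ℂ) * (starRingEnd ℂ (z / ‖z‖) * c i) := by
        have : (‖z‖ : ℂ) ≠ 0 := by exact_mod_cast hz0.ne'
        rw [map_div₀, Complex.conj_ofReal]
        field_simp
      rw [h2, Complex.re_ofReal_mul]
      nlinarith
    have h2 : ‖z + c i‖ ^ 2 = ‖z‖ ^ 2 + 2 * (starRingEnd ℂ z * c i).re + ‖c i‖ ^ 2 := by
      rw [← Complex.normSq_eq_norm_sq, ← Complex.normSq_eq_norm_sq, ← Complex.normSq_eq_norm_sq,
        Complex.normSq_add]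
      simp; ring
    have h3 : ‖z‖ ^ 2 ≤ ((1 + γ) * R) ^ 2 := by gcongr
    have h4 : ‖c i‖ ^ 2 ≤ B ^ 2 := by gcongr; exact hBc i
    have h5 : ‖z + c i‖ ^ 2 ≤ ((1 - γ) * R) ^ 2 := by
      rw [h2]
      nlinarith [mul_le_mul_of_nonneg_left h.le hκ0.le]
    exact (pow_le_pow_iff_left₀ (norm_nonneg _) (by nlinarith) two_ne_zero).1 h5

/-! ### Perturbations of affine maps -/

theorem exists_affine_perturbation_eq {A c : ℂ} {e : ℂ → ℂ} {ρ ε : ℝ} (hA : A ≠ 0)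
    (he : DifferentiableOn ℂ e (ball c ρ)) (hε : ∀ z ∈ ball c ρ, ‖e z‖ ≤ ε) (hε0 : 0 ≤ ε)
    (he' : ∀ z ∈ ball c ρ, ‖deriv e z‖ ≤ ‖A‖ / 2) {y : ℂ} (hy : ‖y - A * c‖ + ε < ‖A‖ * ρ) :
    ∃ z ∈ ball c ρ, A * z + e z = y := by
  have hAp : 0 < ‖A‖ := norm_pos_iff.2 hA
  set R := (‖y - A * c‖ + ε) / ‖A‖ with hR
  have hR0 : 0 ≤ R := by positivity
  have hRρ : R < ρ := by rw [hR, div_lt_iff₀ hAp]; linarith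
  have hsub : closedBall c R ⊆ ball c ρ := closedBall_subset_ball hRρ
  -- The equation is the fixed point equation of T, a contraction of ratio 1/2 preserving the closed
  -- disc of radius R.
  set T : ℂ → ℂ := fun z => (y - e z) / A with hT
  have hmaps : MapsTo T (closedBall c R) (closedBall c R) := by
    intro z hz
    rw [mem_closedBall, dist_eq_norm]
    have : T z - c = ((y - A * c) - e z) / A := by simp only [hT]; field_simp; ring
    rw [this, norm_div, hR]
    gcongr
    refine (norm_sub_le _ _).trans ?_
    linarith [hε z (hsub hz)]
  have hlip : ContractingWith (1 / 2) (hmaps.restrict T (closedBall c R) (closedBall c R)) := by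
    refine ⟨by rw [← NNReal.coe_lt_coe]; norm_num, LipschitzWith.of_dist_le_mul fun x x' => ?_⟩
    rw [Subtype.dist_eq, Subtype.dist_eq, MapsTo.val_restrict_apply, MapsTo.val_restrict_apply,
      dist_eq_norm, dist_eq_norm]
    have h1 := (convex_ball c ρ).norm_image_sub_le_of_norm_deriv_le (f := e)
      (fun z hz => he.differentiableAt (isOpen_ball.mem_nhds hz)) he' (hsub x.2) (hsub x'.2)
    have h2 : T x - T x' = (e x' - e x) / A := by simp only [hT]; field_simp; ring
    rw [h2, norm_div, div_le_iff₀ hAp]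
    refine h1.trans (le_of_eq ?_)
    rw [norm_sub_rev]
    push_cast
    ring
  obtain ⟨z, hz, hfix, -⟩ := hlip.exists_fixedPoint' isClosed_closedBall.isComplete hmaps
    (mem_closedBall_self hR0) (edist_ne_top _ _)
  refine ⟨z, hsub hz, ?_⟩
  have : T z = z := hfix
  simp only [hT] at this
  rw [div_eq_iff hA] at this
  linear_combination -this

/-- A pointwise choice of solutions suffices: z ↦ z + e(z) is expanding up to the factor 2, which
forces continuity, and differentiability follows from the non-zero derivative. -/
theorem exists_section_of_perturbation {c : ℂ} {e : ℂ → ℂ} {ρ ε : ℝ}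
    (he : DifferentiableOn ℂ e (ball c ρ)) (hε0 : 0 ≤ ε) (hε : ∀ z ∈ ball c ρ, ‖e z‖ ≤ ε)
    (he' : ∀ z ∈ ball c ρ, ‖deriv e z‖ ≤ 1 / 2) :
    ∃ τ : ℂ → ℂ, DifferentiableOn ℂ τ (ball c (ρ - ε)) ∧ MapsTo τ (ball c (ρ - ε)) (ball c ρ) ∧
      ∀ y ∈ ball c (ρ - ε), τ y + e (τ y) = y ∧ ‖τ y - y‖ ≤ ε := by
  have hsol : ∀ y, ∃ z, y ∈ ball c (ρ - ε) → z ∈ ball c ρ ∧ z + e z = y := by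
    intro y
    by_cases hy : y ∈ ball c (ρ - ε)
    · rw [mem_ball, dist_eq_norm] at hy
      obtain ⟨z, hz, h⟩ := exists_affine_perturbation_eq (A := 1) (c := c) (y := y) one_ne_zero he hε
        hε0 (by simpa using he') (by simp only [one_mul, norm_one]; linarith)
      exact ⟨z, fun _ => ⟨hz, by simpa using h⟩⟩
    · exact ⟨0, fun h => absurd h hy⟩
  choose τ hτ using hsol
  have hlip : ∀ x ∈ ball c ρ, ∀ x' ∈ ball c ρ, ‖x - x'‖ ≤ 2 * ‖(x + e x) - (x' + e x')‖ := by
    intro x hx x' hx'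
    have h1 := (convex_ball c ρ).norm_image_sub_le_of_norm_deriv_le (f := e)
      (fun z hz => he.differentiableAt (isOpen_ball.mem_nhds hz)) he' hx' hx
    have h2 := norm_sub_le ((x + e x) - (x' + e x')) (e x - e x')
    rw [show (x + e x) - (x' + e x') - (e x - e x') = x - x' by ring] at h2
    linarith
  refine ⟨τ, fun y hy => ?_, fun y hy => (hτ y hy).1, fun y hy => ⟨(hτ y hy).2, ?_⟩⟩
  · have hcont : ContinuousAt τ y := by
      rw [Metric.continuousAt_iff]
      intro δ hδ
      obtain ⟨δ', hδ', hb⟩ := Metric.isOpen_iff.1 isOpen_ball y hy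
      refine ⟨min δ' (δ / 4), by positivity, fun {y'} hy' => ?_⟩
      have hy'm : y' ∈ ball c (ρ - ε) := hb (mem_ball.2 (hy'.trans_le (min_le_left _ _)))
      rw [dist_eq_norm]
      have h1 := hlip _ (hτ y' hy'm).1 _ (hτ y hy).1
      rw [(hτ y' hy'm).2, (hτ y hy).2, ← dist_eq_norm y'] at h1
      have h2 := hy'.trans_le (min_le_right δ' (δ / 4))
      linarith
    have hd : HasDerivAt (fun z => z + e z) (1 + deriv e (τ y)) (τ y) :=
      (hasDerivAt_id _).add (he.differentiableAt (isOpen_ball.mem_nhds (hτ y hy).1)).hasDerivAt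
    have hne : 1 + deriv e (τ y) ≠ 0 := by
      intro h0
      have h1 := he' _ (hτ y hy).1
      rw [show deriv e (τ y) = -1 by linear_combination h0] at h1
      norm_num at h1
    have hev : ∀ᶠ y' in 𝓝 y, τ y' + e (τ y') = y' :=
      Filter.eventually_of_mem (isOpen_ball.mem_nhds hy) fun y' hy' => (hτ y' hy').2
    exact (HasDerivAt.of_local_left_inverse hcont hd hne hev).differentiableAt.differentiableWithinAt
  · have h1 : τ y - y = -e (τ y) := by
      have := (hτ y hy).2
      linear_combination this
    rw [h1, norm_neg]
    exact hε _ (hτ y hy).1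

/-! ### Skew products and vertical graphs -/

theorem clm_apply_eq (D : ℂ × ℂ →L[ℂ] ℂ × ℂ) (v : ℂ × ℂ) :
    D v = v.1 • D (1, 0) + v.2 • D (0, 1) := by
  rw [← map_smul, ← map_smul, ← map_add]
  simp

theorem hasDerivAt_fst_comp {f : ℂ → ℂ × ℂ} {f' : ℂ × ℂ} {x : ℂ} (h : HasDerivAt f f' x) :
    HasDerivAt (fun y => (f y).1) f'.1 x :=
  (ContinuousLinearMap.fst ℂ ℂ ℂ).hasFDerivAt.comp_hasDerivAt x h

theorem hasDerivAt_snd_comp {f : ℂ → ℂ × ℂ} {f' : ℂ × ℂ} {x : ℂ} (h : HasDerivAt f f' x) :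
    HasDerivAt (fun y => (f y).2) f'.2 x :=
  (ContinuousLinearMap.snd ℂ ℂ ℂ).hasFDerivAt.comp_hasDerivAt x h

theorem fderiv_snd_of_skew {F : ℂ × ℂ → ℂ × ℂ} (hF : Differentiable ℂ F) {b : ℂ → ℂ}
    (hb : Differentiable ℂ b) (hFb : ∀ x, (F x).2 = b x.2) (x v : ℂ × ℂ) :
    (fderiv ℂ F x v).2 = deriv b x.2 * v.2 := by
  have h1 : HasFDerivAt (fun x => (F x).2) ((ContinuousLinearMap.snd ℂ ℂ ℂ).comp (fderiv ℂ F x)) x :=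
    (ContinuousLinearMap.snd ℂ ℂ ℂ).hasFDerivAt.comp x (hF x).hasFDerivAt
  have h2 : HasFDerivAt (fun x : ℂ × ℂ => b x.2)
      ((deriv b x.2) • ContinuousLinearMap.snd ℂ ℂ ℂ) x :=
    (hb x.2).hasDerivAt.comp_hasFDerivAt x hasFDerivAt_snd
  have h3 : (fun x => (F x).2) = fun x : ℂ × ℂ => b x.2 := funext hFb
  rw [h3] at h1
  have := congrArg (fun D => D v) (h1.unique h2)
  simpa using this

theorem fderiv_fst_eq (F : ℂ × ℂ → ℂ × ℂ) (x v : ℂ × ℂ) :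
    (fderiv ℂ F x v).1 = v.1 * (fderiv ℂ F x (1, 0)).1 + v.2 * (fderiv ℂ F x (0, 1)).1 := by
  rw [clm_apply_eq]; simp

theorem isOpen_boxUnion {H V : Fin 3 → Set ℂ} (hH : ∀ i, IsOpen (H i)) (hV : ∀ i, IsOpen (V i)) :
    IsOpen (boxUnion H V) :=
  isOpen_iUnion fun i => (hH i).prod (hV i)

theorem mem_boxUnion {H V : Fin 3 → Set ℂ} {i : Fin 3} {x : ℂ × ℂ} (h1 : x.1 ∈ H i)
    (h2 : x.2 ∈ V i) : x ∈ boxUnion H V :=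
  mem_iUnion.2 ⟨i, h1, h2⟩

/-- A holomorphic vertical graph in `H_i × V_i` of slope less than `δ`. -/
structure IsVerticalGraph (H V : Fin 3 → Set ℂ) (δ : ℝ) (i : Fin 3) (σ : ℂ → ℂ) : Prop where
  diff : DifferentiableOn ℂ σ (V i)
  maps : MapsTo σ (V i) (H i)
  slope : ∀ w ∈ V i, ‖deriv σ w‖ < δ

/-- The hypotheses of the graph transform for a skew product `F` over the base `b = Q^l`. -/
structure IsGraphTransformData (Q : ℂ → ℂ) (l : ℕ) (r : Fin 3 → ℂ) (V : Fin 3 → Set ℂ)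
    (ψ : Fin 3 → Fin 3 → ℂ → ℂ) (η C : ℝ) (F : ℂ × ℂ → ℂ × ℂ) (H : Fin 3 → Set ℂ) (K : Set ℂ)
    (δ κ : ℝ) : Prop where
  base : IsBaseSystem Q l r V ψ η C
  diff_base : Differentiable ℂ Q
  eta_pos : 0 < η
  diff : Differentiable ℂ F
  skew : ∀ x, (F x).2 = Q^[l] x.2
  isOpen : ∀ i, IsOpen (H i)
  delta_pos : 0 < δ
  kappa_pos : 0 < κ
  small : 2 * (C * δ) ≤ κ / 4
  maps : ∀ x ∈ boxUnion H V, (F x).1 ∈ K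
  lebesgue : ∀ z ∈ K, ∃ j, ball z κ ⊆ H j
  deriv_fst : ∀ x ∈ boxUnion H V, ‖(fderiv ℂ F x (1, 0)).1‖ ≤ 2
  deriv_snd : ∀ x ∈ boxUnion H V, ‖(fderiv ℂ F x (0, 1)).1‖ ≤ δ / 4 * ‖deriv Q^[l] x.2‖
  variation : ∀ i, ∀ x ∈ H i ×ˢ V i, ∀ x' ∈ H i ×ˢ V i,
    ‖(F x).1 - (F x').1‖ ≤ 2 * ‖x.1 - x'.1‖ + κ / 4

namespace IsGraphTransformData

variable {Q : ℂ → ℂ} {l : ℕ} {r : Fin 3 → ℂ} {V : Fin 3 → Set ℂ} {ψ : Fin 3 → Fin 3 → ℂ → ℂ}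
  {η C : ℝ} {F : ℂ × ℂ → ℂ × ℂ} {H : Fin 3 → Set ℂ} {K : Set ℂ} {δ κ : ℝ}

theorem four_le (h : IsGraphTransformData Q l r V ψ η C F H K δ κ) {x : ℂ × ℂ}
    (hx : x ∈ boxUnion H V) : 4 ≤ ‖deriv Q^[l] x.2‖ := by
  obtain ⟨i, -, h2⟩ := mem_iUnion.1 hx
  exact h.base.four_le i _ h2

/-- The horizontal entry contributes at most 2δ ≤ (δ/2)|b'|, as |b'| ≥ 4, and the vertical one
(δ/4)|b'|. The factor 3/4 leaves room for contracting the cone and for perturbations. -/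
theorem norm_fderiv_fst_le (h : IsGraphTransformData Q l r V ψ η C F H K δ κ) {x : ℂ × ℂ}
    (hx : x ∈ boxUnion H V) {v : ℂ × ℂ} (hv : ‖v.1‖ ≤ δ * ‖v.2‖) :
    ‖(fderiv ℂ F x v).1‖ ≤ 3 / 4 * δ * (‖deriv Q^[l] x.2‖ * ‖v.2‖) := by
  rw [fderiv_fst_eq]
  refine (norm_add_le _ _).trans ?_
  rw [norm_mul, norm_mul]
  have h1 := h.deriv_fst x hx
  have h2 := h.deriv_snd x hx
  have h4 := h.four_le hx
  have hδ := h.delta_pos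
  have h5 : ‖v.1‖ * ‖(fderiv ℂ F x (1, 0)).1‖ ≤ (δ * ‖v.2‖) * 2 := by gcongr
  have h6 : ‖v.2‖ * ‖(fderiv ℂ F x (0, 1)).1‖ ≤ ‖v.2‖ * (δ / 4 * ‖deriv Q^[l] x.2‖) := by gcongr
  have h7 : δ * ‖v.2‖ * 4 ≤ δ * ‖v.2‖ * ‖deriv Q^[l] x.2‖ := by gcongr
  nlinarith

theorem contractsCone (h : IsGraphTransformData Q l r V ψ η C F H K δ κ) :
    ContractsCone F δ (boxUnion H V) := by
  have hδ := h.delta_pos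
  refine ⟨7 / 8 * δ, by positivity, by linarith, fun x hx v hv => ?_⟩
  have hv' : ‖v.1‖ < δ * ‖v.2‖ := hv
  have h1 := h.norm_fderiv_fst_le hx hv'.le
  have h4 := h.four_le hx
  have hv2 : 0 < ‖v.2‖ := by
    by_contra! hle
    have : ‖v.2‖ = 0 := le_antisymm hle (norm_nonneg _)
    rw [this, mul_zero] at hv'
    linarith [norm_nonneg v.1]
  show ‖(fderiv ℂ F x v).1‖ < 7 / 8 * δ * ‖(fderiv ℂ F x v).2‖
  rw [fderiv_snd_of_skew h.diff (h.diff_base.iterate l) h.skew, norm_mul]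
  have : 0 < δ * (‖deriv Q^[l] x.2‖ * ‖v.2‖) := by positivity
  linarith

/-- The compact part of `V_i` covered by the inverse branches. -/
def core (r : Fin 3 → ℂ) (ψ : Fin 3 → Fin 3 → ℂ → ℂ) (η : ℝ) (i : Fin 3) : Set ℂ :=
  ⋃ j, ψ i j '' closedBall (r j) (3 / 2 * η)

theorem closedBall_subset (h : IsGraphTransformData Q l r V ψ η C F H K δ κ) (j : Fin 3) :
    closedBall (r j) (3 / 2 * η) ⊆ ball (r j) (2 * η) :=
  closedBall_subset_ball (by linarith [h.eta_pos])

theorem core_subset (h : IsGraphTransformData Q l r V ψ η C F H K δ κ) (i : Fin 3) :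
    core r ψ η i ⊆ V i :=
  iUnion_subset fun j => ((h.base.maps i j).mono_left (h.closedBall_subset j)).image_subset

theorem isCompact_core (h : IsGraphTransformData Q l r V ψ η C F H K δ κ) (i : Fin 3) :
    IsCompact (core r ψ η i) :=
  isCompact_iUnion fun j => (isCompact_closedBall _ _).image_of_continuousOn
    ((h.base.diff i j).continuousOn.mono (h.closedBall_subset j))

theorem core_nonempty (h : IsGraphTransformData Q l r V ψ η C F H K δ κ) (i : Fin 3) :
    (core r ψ η i).Nonempty :=
  ⟨ψ i i (r i), mem_iUnion.2 ⟨i, r i, mem_closedBall_self (by linarith [h.eta_pos]), rfl⟩⟩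

/-- The image of a vertical graph under a map close to `F` contains a vertical graph. -/
theorem exists_graph_transform (h : IsGraphTransformData Q l r V ψ η C F H K δ κ) {α : ℝ}
    (hα0 : 0 < α) (hα1 : α * (1 + δ) ≤ 1) (hα2 : α * (1 + δ) ^ 2 ≤ δ / 2) (hα3 : α ≤ η / 2)
    (hα4 : α ≤ κ / 8) {f : ℂ × ℂ → ℂ × ℂ} (hf : DifferentiableOn ℂ f (boxUnion H V))
    (hclose : C1Close f F (boxUnion H V) α) {i : Fin 3} {σ : ℂ → ℂ}
    (hσ : IsVerticalGraph H V δ i σ) :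
    ∃ (j : Fin 3) (σ' ξ : ℂ → ℂ), IsVerticalGraph H V δ j σ' ∧ ContinuousOn ξ (V j) ∧
      MapsTo ξ (V j) (core r ψ η i) ∧ ∀ y ∈ V j, f (σ (ξ y), ξ y) = (σ' y, y) := by
  have hδ := h.delta_pos
  have hη := h.eta_pos
  have hVo := h.base.vertical.isOpen
  have hZo : IsOpen (boxUnion H V) := isOpen_boxUnion h.isOpen hVo
  set b := Q^[l] with hb
  have hbd : Differentiable ℂ b := h.diff_base.iterate l
  set Γ : ℂ → ℂ × ℂ := fun w => (σ w, w) with hΓ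
  have hΓZ : ∀ w ∈ V i, Γ w ∈ boxUnion H V := fun w hw => mem_boxUnion (hσ.maps hw) hw
  have hΓd : ∀ w ∈ V i, HasDerivAt Γ (deriv σ w, 1) w := fun w hw =>
    (hσ.diff.differentiableAt ((hVo i).mem_nhds hw)).hasDerivAt.prodMk (hasDerivAt_id w)
  have hfd : ∀ x ∈ boxUnion H V, HasFDerivAt f (fderiv ℂ f x) x := fun x hx =>
    (hf.differentiableAt (hZo.mem_nhds hx)).hasFDerivAt
  -- the derivative along the graph
  set D : ℂ → ℂ × ℂ := fun w => fderiv ℂ f (Γ w) (deriv σ w, 1) with hD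
  have hfΓ : ∀ w ∈ V i, HasDerivAt (f ∘ Γ) (D w) w := fun w hw =>
    (hfd _ (hΓZ w hw)).comp_hasDerivAt w (hΓd w hw)
  have hDest : ∀ w ∈ V i, ‖(D w).1‖ ≤ 3 / 4 * δ * ‖deriv b w‖ + α * (1 + δ) ∧
      ‖(D w).2 - deriv b w‖ ≤ α * (1 + δ) := by
    intro w hw
    have h1 := (hclose _ (hΓZ w hw)).2
    have hv : ‖((deriv σ w, 1) : ℂ × ℂ)‖ ≤ 1 + δ := by
      rw [Prod.norm_def, norm_one]
      exact max_le (by linarith [hσ.slope w hw]) (by linarith)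
    have h2 : ‖D w - fderiv ℂ F (Γ w) (deriv σ w, 1)‖ ≤ α * (1 + δ) := by
      rw [hD]
      simp only
      rw [← sub_apply]
      refine (ContinuousLinearMap.le_opNorm _ _).trans ?_
      gcongr
    have h3 := h.norm_fderiv_fst_le (hΓZ w hw) (v := (deriv σ w, 1)) (by
      simpa using (hσ.slope w hw).le)
    have h4 := fderiv_snd_of_skew h.diff hbd h.skew (Γ w) (deriv σ w, 1)
    simp only [norm_one, mul_one] at h3 h4
    constructor
    · have h5 := (norm_fst_le (D w - fderiv ℂ F (Γ w) (deriv σ w, 1))).trans h2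
      rw [Prod.fst_sub] at h5
      have h6 := norm_add_le ((D w).1 - (fderiv ℂ F (Γ w) (deriv σ w, 1)).1)
        (fderiv ℂ F (Γ w) (deriv σ w, 1)).1
      rw [sub_add_cancel] at h6
      linarith
    · have h5 := (norm_snd_le (D w - fderiv ℂ F (Γ w) (deriv σ w, 1))).trans h2
      rw [Prod.snd_sub, h4] at h5
      exact h5
  have hslope : ∀ w ∈ V i, ‖(D w).1‖ < δ * ‖(D w).2‖ := by
    intro w hw
    obtain ⟨h1, h2⟩ := hDest w hw
    have h3 := h.base.four_le i w hw
    have h4 : ‖deriv b w‖ - α * (1 + δ) ≤ ‖(D w).2‖ := by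
      have := norm_sub_norm_le (deriv b w) (D w).2
      rw [norm_sub_rev] at this
      linarith
    nlinarith
  -- the new graphs
  have hnew : ∀ j, ∃ s ξ : ℂ → ℂ, DifferentiableOn ℂ s (V j) ∧ (∀ y ∈ V j, ‖deriv s y‖ < δ) ∧
      ContinuousOn ξ (V j) ∧ MapsTo ξ (V j) (core r ψ η i) ∧
      ∀ y ∈ V j, f (σ (ξ y), ξ y) = (s y, y) := by
    intro j
    set B := ball (r j) (2 * η) with hB
    have hψd : ∀ y ∈ B, HasDerivAt (ψ i j) (deriv (ψ i j) y) y := fun y hy =>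
      ((h.base.diff i j).differentiableAt (isOpen_ball.mem_nhds hy)).hasDerivAt
    -- Parametrised by ψ i j, the second coordinate of f along the graph is a perturbation of the
    -- identity. Inverting it by τ gives the reparametrisation ξ = ψ i j ∘ τ.
    set e : ℂ → ℂ := fun y => (f (Γ (ψ i j y))).2 - y with he
    have hed : ∀ y ∈ B, HasDerivAt e ((D (ψ i j y)).2 * deriv (ψ i j) y - 1) y := by
      intro y hy
      have h1 := (hfΓ _ (h.base.maps i j hy)).scomp y (hψd y hy)
      have h2 : HasDerivAt (fun y => (f (Γ (ψ i j y))).2) ((D (ψ i j y)).2 * deriv (ψ i j) y) y := by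
        have := hasDerivAt_snd_comp h1
        rw [mul_comm]
        exact this
      exact h2.sub (hasDerivAt_id y)
    have he1 : ∀ y ∈ B, ‖e y‖ ≤ α := by
      intro y hy
      have hm := h.base.maps i j hy
      have h1 := (norm_snd_le _).trans (hclose _ (hΓZ _ hm)).1
      rw [Prod.snd_sub, h.skew] at h1
      simp only [hΓ] at h1
      rwa [h.base.right_inv i j y hy] at h1
    have he2 : ∀ y ∈ B, ‖deriv e y‖ ≤ 1 / 2 := by
      intro y hy
      have hm := h.base.maps i j hy
      rw [(hed y hy).deriv]
      have h1 := deriv_section hbd isOpen_ball (h.base.diff i j) (h.base.right_inv i j) hy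
      have h2 : (D (ψ i j y)).2 * deriv (ψ i j) y - 1 =
          ((D (ψ i j y)).2 - deriv b (ψ i j y)) * deriv (ψ i j) y := by
        rw [sub_mul, h1]
      have h3 : ‖deriv b (ψ i j y)‖ * ‖deriv (ψ i j) y‖ = 1 := by
        rw [← norm_mul, h1, norm_one]
      have h4 : 4 ≤ ‖deriv b (ψ i j y)‖ := h.base.four_le i _ hm
      have h5 : ‖deriv (ψ i j) y‖ ≤ 1 / 4 := by
        nlinarith [norm_nonneg (deriv (ψ i j) y)]
      rw [h2, norm_mul]
      have h6 := (hDest _ hm).2.trans hα1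
      nlinarith [norm_nonneg (deriv (ψ i j) y), norm_nonneg ((D (ψ i j y)).2 - deriv b (ψ i j y))]
    obtain ⟨τ, hτd, hτm, hτ⟩ := exists_section_of_perturbation (c := r j) (ρ := 2 * η) (ε := α)
      (fun y hy => (hed y hy).differentiableAt.differentiableWithinAt) hα0.le he1 he2
    have hVsub : V j ⊆ ball (r j) (2 * η - α) :=
      (h.base.subset j).trans (ball_subset_ball (by linarith))
    set ξ : ℂ → ℂ := fun y => ψ i j (τ y) with hξ
    have hξd : ∀ y ∈ V j, HasDerivAt ξ (deriv ξ y) y := fun y hy =>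
      ((hψd _ (hτm (hVsub hy))).differentiableAt.comp y
        (hτd.differentiableAt (isOpen_ball.mem_nhds (hVsub hy)))).hasDerivAt
    have hξV : ∀ y ∈ V j, ξ y ∈ V i := fun y hy => h.base.maps i j (hτm (hVsub hy))
    have hfξ : ∀ y ∈ V j, (f (Γ (ξ y))).2 = y := by
      intro y hy
      have := (hτ y (hVsub hy)).1
      simp only [he] at this
      simpa using this
    have hcomp : ∀ y ∈ V j, HasDerivAt (fun y => f (Γ (ξ y))) (deriv ξ y • D (ξ y)) y :=
      fun y hy => (hfΓ _ (hξV y hy)).scomp y (hξd y hy)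
    have hsd : ∀ y ∈ V j, HasDerivAt (fun y => (f (Γ (ξ y))).1) (deriv ξ y * (D (ξ y)).1) y := by
      intro y hy
      exact hasDerivAt_fst_comp (hcomp y hy)
    have hone : ∀ y ∈ V j, deriv ξ y * (D (ξ y)).2 = 1 := by
      intro y hy
      have h2 : HasDerivAt (fun y => (f (Γ (ξ y))).2) (deriv ξ y * (D (ξ y)).2) y :=
        hasDerivAt_snd_comp (hcomp y hy)
      have h3 : HasDerivAt (fun y => (f (Γ (ξ y))).2) 1 y :=
        (hasDerivAt_id y).congr_of_eventuallyEq
          (Filter.eventually_of_mem ((hVo j).mem_nhds hy) fun z hz => hfξ z hz)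
      exact h2.unique h3
    refine ⟨fun y => (f (Γ (ξ y))).1, ξ, fun y hy =>
      (hsd y hy).differentiableAt.differentiableWithinAt, fun y hy => ?_, fun y hy =>
      (hξd y hy).continuousAt.continuousWithinAt, fun y hy => ?_, fun y hy =>
      Prod.ext rfl (hfξ y hy)⟩
    · rw [(hsd y hy).deriv, norm_mul]
      have h1 := hslope _ (hξV y hy)
      have h2 : ‖deriv ξ y‖ * ‖(D (ξ y)).2‖ = 1 := by rw [← norm_mul, hone y hy, norm_one]
      have h3 : 0 < ‖deriv ξ y‖ := by
        rw [norm_pos_iff]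
        exact left_ne_zero_of_mul (hone y hy ▸ one_ne_zero)
      calc ‖deriv ξ y‖ * ‖(D (ξ y)).1‖ < ‖deriv ξ y‖ * (δ * ‖(D (ξ y)).2‖) := by gcongr
        _ = δ * (‖deriv ξ y‖ * ‖(D (ξ y)).2‖) := by ring
        _ = δ := by rw [h2, mul_one]
    · refine mem_iUnion.2 ⟨j, τ y, ?_, rfl⟩
      rw [mem_closedBall, dist_eq_norm]
      have h1 := (hτ y (hVsub hy)).2
      have h2 := h.base.subset j hy
      rw [mem_ball, dist_eq_norm] at h2
      have h3 := norm_add_le (τ y - y) (y - r j)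
      rw [sub_add_sub_cancel] at h3
      linarith
  -- the choice of the new box
  have hri : r i ∈ V i := h.base.vertical.mem i
  obtain ⟨j, hj⟩ := h.lebesgue _ (h.maps _ (hΓZ _ hri))
  obtain ⟨s, ξ, hs1, hs2, hξ1, hξ2, hfξ⟩ := hnew j
  -- Over V_i the graph oscillates by at most Cδ, so the new graph stays within κ/8 + 2Cδ + κ/4 ≤
  -- 5κ/8 of the point to which the Lebesgue number κ was applied.
  refine ⟨j, s, ξ, ⟨hs1, fun y hy => hj ?_, hs2⟩, hξ1, hξ2, hfξ⟩
  have hξV : ξ y ∈ V i := h.core_subset i (hξ2 hy)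
  have h1 := (norm_fst_le _).trans (hclose _ (hΓZ _ hξV)).1
  rw [Prod.fst_sub] at h1
  have h2 := h.variation i (Γ (ξ y)) ⟨hσ.maps hξV, hξV⟩ (Γ (r i)) ⟨hσ.maps hri, hri⟩
  have h3 := h.base.oscillation i σ δ hδ.le hσ.diff (fun w hw => (hσ.slope w hw).le) _ hξV _ hri
  have h4 : s y = (f (Γ (ξ y))).1 := by rw [show Γ (ξ y) = (σ (ξ y), ξ y) from rfl, hfξ y hy]
  rw [mem_ball, dist_eq_norm, h4]
  have h5 := norm_add_le ((f (Γ (ξ y))).1 - (F (Γ (ξ y))).1) ((F (Γ (ξ y))).1 - (F (Γ (r i))).1)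
  rw [sub_add_sub_cancel] at h5
  have h6 : ‖(Γ (ξ y)).1 - (Γ (r i)).1‖ ≤ C * δ := h3
  have := h.kappa_pos
  have := h.small
  linarith

/-- The graph transform is iterated, and the composites of the reparametrisations ξ locate, in the
initial graph, the points that follow the successive graphs up to time n. -/
theorem exists_robustlyMeetsGraphs (h : IsGraphTransformData Q l r V ψ η C F H K δ κ) :
    ∃ α : ℝ, 0 < α ∧ RobustlyMeetsGraphs F H V δ α := by
  have hδ := h.delta_pos
  have hη := h.eta_pos
  have hκ := h.kappa_pos
  set α := min (min (1 / (1 + δ)) (δ / 2 / (1 + δ) ^ 2)) (min (η / 2) (κ / 8)) with hα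
  have hα0 : 0 < α := by positivity
  have h1 : α ≤ 1 / (1 + δ) := (min_le_left _ _).trans (min_le_left _ _)
  have h2 : α ≤ δ / 2 / (1 + δ) ^ 2 := (min_le_left _ _).trans (min_le_right _ _)
  have h3 : α ≤ η / 2 := (min_le_right _ _).trans (min_le_left _ _)
  have h4 : α ≤ κ / 8 := (min_le_right _ _).trans (min_le_right _ _)
  rw [le_div_iff₀ (by positivity)] at h1 h2
  refine ⟨α, hα0, fun f hf hclose i σ hσ1 hσ2 hσ3 => ?_⟩
  have hstep : ∀ s : {s : Fin 3 × (ℂ → ℂ) // IsVerticalGraph H V δ s.1 s.2},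
      ∃ (s' : {s : Fin 3 × (ℂ → ℂ) // IsVerticalGraph H V δ s.1 s.2}) (ξ : ℂ → ℂ),
        ContinuousOn ξ (V s'.1.1) ∧ MapsTo ξ (V s'.1.1) (core r ψ η s.1.1) ∧
        ∀ y ∈ V s'.1.1, f (s.1.2 (ξ y), ξ y) = (s'.1.2 y, y) := by
    rintro ⟨⟨i, σ⟩, hσ⟩
    obtain ⟨j, σ', ξ, g1, g2, g3, g4⟩ := h.exists_graph_transform hα0 h1 h2 h3 h4 hf hclose hσ
    exact ⟨⟨(j, σ'), g1⟩, ξ, g2, g3, g4⟩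
  choose next ξ hξc hξm hξ using hstep
  let S : ℕ → {s : Fin 3 × (ℂ → ℂ) // IsVerticalGraph H V δ s.1 s.2} := fun n =>
    Nat.rec ⟨(i, σ), hσ1, hσ2, hσ3⟩ (fun _ s => next s) n
  let Ω : ℕ → ℂ → ℂ := fun n => Nat.rec id (fun n Ω => Ω ∘ ξ (S n)) n
  have hΩs : ∀ n, Ω (n + 1) = Ω n ∘ ξ (S n) := fun n => rfl
  have hcoreV : ∀ n, core r ψ η (S n).1.1 ⊆ V (S n).1.1 := fun n => h.core_subset _
  have hΩc : ∀ n, ContinuousOn (Ω n) (V (S n).1.1) := by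
    intro n
    induction n with
    | zero => exact continuousOn_id
    | succ n ih =>
      rw [hΩs]
      exact ih.comp (hξc (S n)) fun y hy => hcoreV n (hξm (S n) hy)
  have horb : ∀ n, ∀ y ∈ V (S n).1.1, f^[n] (σ (Ω n y), Ω n y) = ((S n).1.2 y, y) := by
    intro n
    induction n with
    | zero => intro y _; rfl
    | succ n ih =>
      intro y hy
      have hy' := hcoreV n (hξm (S n) hy)
      rw [hΩs, Function.iterate_succ_apply']
      simp only [Function.comp]
      rw [ih _ hy']
      exact hξ (S n) y hy
  -- The V_i are open, so nested images of them could have empty intersection; the compact cores,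
  -- which contain the values of ξ, avoid this.
  set A : ℕ → Set ℂ := fun n => Ω n '' core r ψ η (S n).1.1 with hA
  have hAc : ∀ n, IsCompact (A n) := fun n =>
    (h.isCompact_core _).image_of_continuousOn ((hΩc n).mono (hcoreV n))
  have hAnest : ∀ n, A (n + 1) ⊆ A n := by
    rintro n _ ⟨y, hy, rfl⟩
    exact ⟨ξ (S n) y, hξm (S n) (hcoreV (n + 1) hy), rfl⟩
  obtain ⟨x, hx⟩ := IsCompact.nonempty_iInter_of_sequence_nonempty_isCompact_isClosed A hAnest
    (fun n => (h.core_nonempty _).image _) (hAc 0) (fun n => (hAc n).isClosed)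
  rw [mem_iInter] at hx
  obtain ⟨y₀, hy₀, hy₀x⟩ := hx 0
  refine ⟨x, hy₀x ▸ hcoreV 0 hy₀, fun n => ?_⟩
  obtain ⟨y, hy, rfl⟩ := hx n
  rw [horb n y (hcoreV n hy)]
  exact subset_closure (mem_boxUnion ((S n).2.maps (hcoreV n hy)) (hcoreV n hy))

end IsGraphTransformData

/-! ### Stay sets and repelling hyperbolic sets -/

/-- Continuity is available only on the closure of Z, so the sets of points staying up to time n are
shown to be closed one after the other. -/
theorem isCompact_staySet {g : ℂ × ℂ → ℂ × ℂ} {Z : Set (ℂ × ℂ)} (hZ : IsCompact (closure Z))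
    (hg : ContinuousOn g (closure Z)) : IsCompact (staySet g Z) := by
  set S : ℕ → Set (ℂ × ℂ) := fun n => {x | ∀ m ≤ n, g^[m] x ∈ closure Z} with hS
  have hSc : ∀ n, IsClosed (S n) := by
    intro n
    induction n with
    | zero =>
      have : S 0 = closure Z := by ext x; simp [hS]
      rw [this]; exact isClosed_closure
    | succ n ih =>
      have : S (n + 1) = closure Z ∩ g ⁻¹' S n := by
        ext x
        constructor
        · intro h
          exact ⟨h 0 (Nat.zero_le _), fun m hm => h (m + 1) (by omega)⟩
        · rintro ⟨h0, h1⟩ m hm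
          cases m with
          | zero => exact h0
          | succ m => exact h1 m (by omega)
      rw [this]
      exact hg.preimage_isClosed_of_isClosed isClosed_closure ih
  have hst : staySet g Z = ⋂ n, S n := by
    ext x
    simp only [mem_iInter]
    exact ⟨fun h n m _ => h m, fun h n => h n n le_rfl⟩
  refine hZ.of_isClosed_subset ?_ fun x hx => hx 0
  rw [hst]
  exact isClosed_iInter hSc

/-- The covering supplies a preimage in Z, which prolongs the staying orbit backwards by one step.
-/
theorem image_staySet {g : ℂ × ℂ → ℂ × ℂ} {Z : Set (ℂ × ℂ)} (h : closure Z ⊆ g '' Z) :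
    g '' staySet g Z = staySet g Z := by
  apply Subset.antisymm
  · rintro _ ⟨x, hx, rfl⟩ n
    exact hx (n + 1)
  · intro x hx
    obtain ⟨y, hy, rfl⟩ := h (hx 0)
    refine ⟨y, fun n => ?_, rfl⟩
    cases n with
    | zero => exact subset_closure hy
    | succ n => exact hx n

theorem exists_mem_naturalExtension_map {g : ℂ × ℂ → ℂ × ℂ} {Λ : Set (ℂ × ℂ)} (hΛ : MapsTo g Λ Λ)
    {x : ℕ → ℂ × ℂ} (hx : x ∈ naturalExtension g Λ) :
    (fun i => Nat.casesOn i (g (x 0)) x : ℕ → ℂ × ℂ) ∈ naturalExtension g Λ := by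
  constructor
  · intro i
    cases i with
    | zero => exact hΛ (hx.1 0)
    | succ i => exact hx.1 i
  · intro i
    cases i with
    | zero => rfl
    | succ i => exact hx.2 i

theorem hasFDerivAt_iterate {g : ℂ × ℂ → ℂ × ℂ} {Λ : Set (ℂ × ℂ)} (hΛ : MapsTo g Λ Λ)
    (hd : ∀ x ∈ Λ, DifferentiableAt ℂ g x) (n : ℕ) : ∀ x ∈ Λ, DifferentiableAt ℂ g^[n] x := by
  induction n with
  | zero => intro x _; exact differentiableAt_id
  | succ n ih =>
    intro x hx
    rw [Function.iterate_succ]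
    exact (ih _ (hΛ hx)).comp x (hd x hx)

theorem fderiv_iterate_succ_apply {g : ℂ × ℂ → ℂ × ℂ} {Λ : Set (ℂ × ℂ)} (hΛ : MapsTo g Λ Λ)
    (hd : ∀ x ∈ Λ, DifferentiableAt ℂ g x) (n : ℕ) {x : ℂ × ℂ} (hx : x ∈ Λ) (v : ℂ × ℂ) :
    fderiv ℂ g^[n + 1] x v = fderiv ℂ g^[n] (g x) (fderiv ℂ g x v) := by
  rw [Function.iterate_succ, fderiv_comp x (hasFDerivAt_iterate hΛ hd n _ (hΛ hx)) (hd x hx)]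
  rfl

/-- A norm on `ℂ²` with weight `L` on the second coordinate. -/
def wnorm (L : ℝ) (v : ℂ × ℂ) : ℝ := ‖v.1‖ + L * ‖v.2‖

theorem norm_le_wnorm {L : ℝ} (hL : 1 ≤ L) (v : ℂ × ℂ) : ‖v‖ ≤ wnorm L v := by
  rw [Prod.norm_def, wnorm]
  exact max_le (by nlinarith [norm_nonneg v.2]) (by nlinarith [norm_nonneg v.1, norm_nonneg v.2])

theorem wnorm_le_norm {L : ℝ} (hL : 0 ≤ L) (v : ℂ × ℂ) : wnorm L v ≤ (1 + L) * ‖v‖ := by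
  rw [wnorm]
  nlinarith [norm_fst_le v, norm_snd_le v]

/-- The stable bundle is zero, so the projection is 0; comparing the weighted norm with the usual
one costs the constant 1 + L. -/
theorem isHyperbolicSet_repelling {g : ℂ × ℂ → ℂ × ℂ} {Λ : Set (ℂ × ℂ)} (hΛc : IsCompact Λ)
    (hΛ : g '' Λ = Λ) (hd : ∀ x ∈ Λ, DifferentiableAt ℂ g x) {L k : ℝ} (hL : 1 ≤ L) (hk : 1 < k)
    (hexp : ∀ x ∈ Λ, ∀ v, k * wnorm L v ≤ wnorm L (fderiv ℂ g x v)) : IsHyperbolicSet g Λ 0 := by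
  have hmaps : MapsTo g Λ Λ := fun x hx => hΛ ▸ mem_image_of_mem g hx
  have hk0 : 0 < k := by linarith
  have hiter : ∀ n : ℕ, ∀ x ∈ Λ, ∀ v, k ^ n * wnorm L v ≤ wnorm L (fderiv ℂ g^[n] x v) := by
    intro n
    induction n with
    | zero => intro x _ v; simp
    | succ n ih =>
      intro x hx v
      rw [fderiv_iterate_succ_apply hmaps hd n hx]
      refine le_trans ?_ (ih _ (hmaps hx) _)
      rw [pow_succ, mul_assoc]
      have := hexp x hx v
      gcongr
  refine ⟨hΛc, hΛ, hd, fun _ => 0, continuousOn_const, fun x _ => by simp, fun x _ => ?_,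
    fun x _ => by simp, 1 + L, k⁻¹, by linarith, by positivity, inv_lt_one_of_one_lt₀ hk,
    fun x hx n v => ⟨fun hv => ?_, fun _ => ?_⟩⟩
  · simp
  · have : v = 0 := by simpa using hv.symm
    subst this; simp
  · have h1 := hiter n (x 0) (hx.1 0) v
    have h2 := norm_le_wnorm hL v
    have h3 := wnorm_le_norm (by linarith : 0 ≤ L) (fderiv ℂ g^[n] (x 0) v)
    have h4 : 0 < k ^ n := by positivity
    rw [inv_pow]
    have h5 : wnorm L v ≤ (k ^ n)⁻¹ * ((1 + L) * ‖fderiv ℂ g^[n] (x 0) v‖) := by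
      rw [← div_eq_inv_mul, le_div_iff₀ h4]
      linarith
    calc ‖v‖ ≤ wnorm L v := h2
      _ ≤ _ := h5
      _ = _ := by ring

/-! ### Skew products close to the model `(z, w) ↦ (Az + s c_i, b(w))` -/

/-- On `{|z| ≤ R|s|} × V_i`, the skew product `F` over `b = Q^l` is `ε`-close, relatively to the
scale `|s|`, to the model `(z, w) ↦ (Az + s c_i, b(w))`. -/
structure IsModelSystem (Q : ℂ → ℂ) (l : ℕ) (V : Fin 3 → Set ℂ) (c : Fin 3 → ℂ) (A s : ℂ) (R ε : ℝ)
    (F : ℂ × ℂ → ℂ × ℂ) : Prop where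
  contDiff : ContDiff ℂ 1 F
  skew : ∀ x, (F x).2 = Q^[l] x.2
  value : ∀ i, ∀ w ∈ V i, ∀ z, ‖z‖ ≤ R * ‖s‖ → ‖(F (z, w)).1 - (A * z + s * c i)‖ ≤ ε * ‖s‖
  deriv_fst : ∀ i, ∀ w ∈ V i, ∀ z, ‖z‖ ≤ R * ‖s‖ → ‖(fderiv ℂ F (z, w) (1, 0)).1 - A‖ ≤ ε
  deriv_snd : ∀ i, ∀ w ∈ V i, ∀ z, ‖z‖ ≤ R * ‖s‖ →
    ‖(fderiv ℂ F (z, w) (0, 1)).1‖ ≤ ε * ‖s‖ * ‖deriv Q^[l] w‖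

namespace IsModelSystem

variable {Q : ℂ → ℂ} {l : ℕ} {V : Fin 3 → Set ℂ} {c : Fin 3 → ℂ} {A s : ℂ} {R ε : ℝ}
  {F : ℂ × ℂ → ℂ × ℂ}

theorem differentiable (h : IsModelSystem Q l V c A s R ε F) : Differentiable ℂ F :=
  h.contDiff.differentiable one_ne_zero

theorem continuous_fderiv_apply (h : IsModelSystem Q l V c A s R ε F) (v : ℂ × ℂ) :
    Continuous fun x => (fderiv ℂ F x v).1 :=
  continuous_fst.comp ((h.contDiff.continuous_fderiv one_ne_zero).clm_apply continuous_const)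

/-- Stay sets live in closures, so the estimates, which are closed conditions, are needed there. -/
theorem closure (h : IsModelSystem Q l V c A s R ε F) (hQ : Differentiable ℂ Q) :
    IsModelSystem Q l (fun i => closure (V i)) c A s R ε F where
  contDiff := h.contDiff
  skew := h.skew
  value i := by
    refine fun w hw z hz => closure_minimal (t := {w | ‖(F (z, w)).1 - (A * z + s * c i)‖ ≤ ε * ‖s‖})
      (fun w hw => h.value i w hw z hz) (isClosed_le ?_ continuous_const) hw
    have := h.differentiable.continuous
    fun_prop
  deriv_fst i := by
    refine fun w hw z hz => closure_minimal (t := {w | ‖(fderiv ℂ F (z, w) (1, 0)).1 - A‖ ≤ ε})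
      (fun w hw => h.deriv_fst i w hw z hz) (isClosed_le ?_ continuous_const) hw
    exact (((h.continuous_fderiv_apply (1, 0)).comp (by fun_prop : Continuous fun w => (z, w))).sub
      continuous_const).norm
  deriv_snd i := by
    refine fun w hw z hz => closure_minimal
      (t := {w | ‖(fderiv ℂ F (z, w) (0, 1)).1‖ ≤ ε * ‖s‖ * ‖deriv Q^[l] w‖})
      (fun w hw => h.deriv_snd i w hw z hz) (isClosed_le ?_ ?_) hw
    · exact ((h.continuous_fderiv_apply (0, 1)).comp (by fun_prop : Continuous fun w => (z, w))).norm
    · exact continuous_const.mul (continuous_deriv_of_differentiable (hQ.iterate l)).norm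

theorem hasDerivAt_fst (h : IsModelSystem Q l V c A s R ε F) (z w : ℂ) :
    HasDerivAt (fun z => (F (z, w)).1) (fderiv ℂ F (z, w) (1, 0)).1 z := by
  have h1 : HasDerivAt (fun z : ℂ => ((z, w) : ℂ × ℂ)) (1, 0) z :=
    (hasDerivAt_id z).prodMk (hasDerivAt_const z w)
  exact hasDerivAt_fst_comp ((h.differentiable (z, w)).hasFDerivAt.comp_hasDerivAt z h1)

/-- The first coordinate of `F` covers a disc whose preimage under the model lies well inside the
domain. -/
theorem exists_fst_eq (h : IsModelSystem Q l V c A s R ε F) (hs : s ≠ 0) (hA : 1 / 2 ≤ ‖A‖)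
    (hε0 : 0 ≤ ε) (hε : ε ≤ 1 / 4) {i : Fin 3} {w : ℂ} (hw : w ∈ V i) {R' : ℝ} (hR' : R' ≤ R)
    {y : ℂ} (hy : ‖y - s * c i‖ + ε * ‖s‖ < ‖A‖ * (R' * ‖s‖)) :
    ∃ z, ‖z‖ < R' * ‖s‖ ∧ (F (z, w)).1 = y := by
  have hle : ∀ z : ℂ, z ∈ ball (0 : ℂ) (R' * ‖s‖) → ‖z‖ ≤ R * ‖s‖ := by
    intro z hz
    have : ‖z‖ < R' * ‖s‖ := by simpa using hz
    nlinarith [norm_nonneg s]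
  have hder : ∀ z, HasDerivAt (fun z => (F (z, w)).1 - (A * z + s * c i))
      ((fderiv ℂ F (z, w) (1, 0)).1 - A) z := by
    intro z
    exact ((h.hasDerivAt_fst z w).sub
      (((hasDerivAt_id z).const_mul A).add_const (s * c i))).congr_deriv (by simp)
  obtain ⟨z, hz, heq⟩ := exists_affine_perturbation_eq (A := A) (c := 0) (y := y - s * c i)
    (e := fun z => (F (z, w)).1 - (A * z + s * c i)) (ρ := R' * ‖s‖) (ε := ε * ‖s‖)
    (norm_pos_iff.1 (by linarith)) (fun z _ => (hder z).differentiableAt.differentiableWithinAt)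
    (fun z hz => h.value i w hw z (hle z hz)) (by positivity)
    (fun z hz => by
      rw [(hder z).deriv]
      linarith [h.deriv_fst i w hw z (hle z hz)]) (by simpa using hy)
  refine ⟨z, by simpa using hz, ?_⟩
  linear_combination heq

end IsModelSystem

theorem closure_prod_iUnion (D : Set ℂ) (V : Fin 3 → Set ℂ) :
    closure (D ×ˢ ⋃ i, V i) = closure D ×ˢ ⋃ i, closure (V i) := by
  rw [closure_prod_eq, closure_iUnion_of_finite]

namespace IsBaseSystem

variable {Q : ℂ → ℂ} {l : ℕ} {r : Fin 3 → ℂ} {V : Fin 3 → Set ℂ} {ψ : Fin 3 → Fin 3 → ℂ → ℂ}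
  {η C : ℝ}

theorem four_le_closure (h : IsBaseSystem Q l r V ψ η C) (hQ : Differentiable ℂ Q) {i : Fin 3}
    {w : ℂ} (hw : w ∈ closure (V i)) : 4 ≤ ‖deriv Q^[l] w‖ :=
  closure_minimal (t := {w | 4 ≤ ‖deriv Q^[l] w‖}) (fun w hw => h.four_le i w hw)
    (isClosed_le continuous_const (continuous_deriv_of_differentiable (hQ.iterate l)).norm) hw

theorem isCompact_closure (h : IsBaseSystem Q l r V ψ η C) (i : Fin 3) :
    IsCompact (closure (V i)) :=
  (isCompact_closedBall (r i) η).of_isClosed_subset isClosed_closure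
    (closure_minimal ((h.subset i).trans ball_subset_closedBall) isClosed_closedBall)

theorem exists_preimage (h : IsBaseSystem Q l r V ψ η C) (i : Fin 3) {j : Fin 3} {w : ℂ}
    (hw : w ∈ closure (V j)) : ∃ w₀ ∈ V i, Q^[l] w₀ = w :=
  h.vertical.covering i (closure_mono (subset_iUnion V j) hw)

end IsBaseSystem

set_option maxHeartbeats 1000000 in
/-- A skew product close to a weakly expanding model has a blender of repelling type. -/
theorem exists_isRepellingBlender {c : Fin 3 → ℂ} {R γ : ℝ} (hR : 0 < R) (hγ : 0 < γ)
    (hγ4 : γ ≤ 1 / 4) (hcov : ∀ z : ℂ, ‖z‖ ≤ (1 + γ) * R → ∃ i, ‖z + c i‖ ≤ (1 - γ) * R)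
    {η C ε₁ : ℝ} (hη : 0 < η) (hC : 0 < C) (hε₁ : 0 < ε₁) :
    ∃ R' ε : ℝ, 0 < R' ∧ 0 < ε ∧ ∀ {Q : ℂ → ℂ} {l : ℕ} {r : Fin 3 → ℂ} {V : Fin 3 → Set ℂ}
      {ψ : Fin 3 → Fin 3 → ℂ → ℂ} {A s : ℂ} {F : ℂ × ℂ → ℂ × ℂ}, Differentiable ℂ Q →
      IsBaseSystem Q l r V ψ η C → IsModelSystem Q l V c A s R' ε F → s ≠ 0 → 1 + ε₁ ≤ ‖A‖ →
      ‖A‖ ≤ 1 + γ → ∃ Λ, IsRepellingBlender Q^[l] r F Λ := by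
  set B := ∑ i, ‖c i‖ with hB
  have hBc : ∀ i, ‖c i‖ ≤ B := fun i =>
    Finset.single_le_sum (f := fun i => ‖c i‖) (fun i _ => norm_nonneg _) (Finset.mem_univ i)
  have hB0 : 0 ≤ B := Finset.sum_nonneg fun i _ => norm_nonneg _
  -- Two requirements: R' ≥ R + B makes the estimates valid on the H_i, and ε₁R' > B + 1 makes a
  -- single expanding fibre map cover the disc of radius R'|s|, which serves for the surrounding
  -- hyperbolic set.
  set R' := (B + 2) / ε₁ + R + B with hR'
  have hR'0 : 0 < R' := by positivity
  have hR'1 : B + 1 < ε₁ * R' := by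
    have h1 : ε₁ * ((B + 2) / ε₁) = B + 2 := by field_simp
    have h2 : ε₁ * R' = B + 2 + ε₁ * (R + B) := by rw [hR', add_assoc, mul_add, h1]
    have h3 : 0 ≤ ε₁ * (R + B) := by positivity
    linarith
  have hR'2 : R + B ≤ R' := by
    have : 0 ≤ (B + 2) / ε₁ := by positivity
    linarith
  -- Chosen so that 2Cδ₀ = γR/16, a quarter of the Lebesgue number γR/4 used below; all lengths are
  -- in units of |s|.
  set δ₀ := γ * R / (32 * C) with hδ₀
  have hδ₀0 : 0 < δ₀ := by positivity
  have hδ₀C : C * δ₀ = γ * R / 32 := by rw [hδ₀]; field_simp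
  set ε := min (min (1 / 4) (ε₁ / 2)) (min (γ * R / 32) (δ₀ / 4)) with hε
  have hε0 : 0 < ε := by positivity
  have hεa : ε ≤ 1 / 4 := (min_le_left _ _).trans (min_le_left _ _)
  have hεb : ε ≤ ε₁ / 2 := (min_le_left _ _).trans (min_le_right _ _)
  have hεc : ε ≤ γ * R / 32 := (min_le_right _ _).trans (min_le_left _ _)
  have hεd : ε ≤ δ₀ / 4 := (min_le_right _ _).trans (min_le_right _ _)
  refine ⟨R', ε, hR'0, hε0, fun {Q l r V ψ A s F} hQ hbase hmod hs hA1 hA2 => ?_⟩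
  have hx : 0 < ‖s‖ := norm_pos_iff.2 hs
  have hA0 : A ≠ 0 := norm_pos_iff.1 (by linarith)
  have hFd := hmod.differentiable
  have hγR : 0 < γ * R := by positivity
  -- H_i consists of the points that the i-th model map sends well inside the disc K.
  set H : Fin 3 → Set ℂ := fun i => {z | ‖A * z + s * c i‖ < (1 - γ / 2) * R * ‖s‖} with hH
  have hsc : ∀ i, ‖s * c i‖ ≤ B * ‖s‖ := fun i => by
    rw [norm_mul, mul_comm]; gcongr; exact hBc i
  have hHR : ∀ i, ∀ z ∈ H i, ‖z‖ ≤ R' * ‖s‖ := by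
    intro i z hz
    have h1 : ‖A * z + s * c i‖ < (1 - γ / 2) * R * ‖s‖ := hz
    have h2 := norm_sub_le (A * z + s * c i) (s * c i)
    rw [add_sub_cancel_right, norm_mul] at h2
    have h3 : ‖z‖ ≤ ‖A‖ * ‖z‖ := by nlinarith [norm_nonneg z]
    have h4 : (1 - γ / 2) * R * ‖s‖ ≤ R * ‖s‖ := by nlinarith [mul_pos hγR hx]
    have h5 : (R + B) * ‖s‖ ≤ R' * ‖s‖ := by gcongr
    linarith [hsc i]
  set K := closedBall (0 : ℂ) (R * ‖s‖) with hK
  -- The covering property is applied to Az/s, of modulus at most (1 + γ)R. The margin (γ/2)R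
  -- absorbs a displacement of γR/4 multiplied by ‖A‖ ≤ 5/4.
  have hleb : ∀ z ∈ K, ∃ j, ball z (γ * R / 4 * ‖s‖) ⊆ H j := by
    intro z hz
    have hz' : ‖z‖ ≤ R * ‖s‖ := by simpa [hK] using hz
    obtain ⟨i, hi⟩ := hcov (A * z / s) (by
      rw [norm_div, norm_mul, div_le_iff₀ hx, mul_assoc]
      gcongr)
    refine ⟨i, fun z' hz' => ?_⟩
    have h1 : ‖A * z + s * c i‖ ≤ (1 - γ) * R * ‖s‖ := by
      have : A * z + s * c i = s * (A * z / s + c i) := by field_simp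
      rw [this, norm_mul, mul_comm]
      gcongr
    have h2 : ‖z' - z‖ < γ * R / 4 * ‖s‖ := by rwa [mem_ball, dist_eq_norm] at hz'
    have h3 := norm_add_le (A * (z' - z)) (A * z + s * c i)
    rw [norm_mul, show A * (z' - z) + (A * z + s * c i) = A * z' + s * c i by ring] at h3
    have h4 : ‖A‖ * ‖z' - z‖ ≤ 5 / 4 * (γ * R / 4 * ‖s‖) := by
      have : ‖A‖ ≤ 5 / 4 := by linarith
      gcongr
    show ‖A * z' + s * c i‖ < (1 - γ / 2) * R * ‖s‖
    nlinarith [mul_pos hγR hx]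
  have hHo : ∀ i, IsOpen (H i) := fun i => isOpen_lt (by fun_prop) continuous_const
  have hdata : IsGraphTransformData Q l r V ψ η C F H K (δ₀ * ‖s‖) (γ * R / 4 * ‖s‖) := by
    refine ⟨hbase, hQ, hη, hFd, hmod.skew, hHo, by positivity, by positivity, ?_, fun x hx' => ?_,
      hleb, fun x hx' => ?_, fun x hx' => ?_, fun i x hx1 x' hx2 => ?_⟩
    · rw [← mul_assoc C, hδ₀C]
      linarith
    · obtain ⟨i, h1, h2⟩ := mem_iUnion.1 hx'
      have h3 := hmod.value i x.2 h2 x.1 (hHR i _ h1)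
      have h4 : ‖A * x.1 + s * c i‖ < (1 - γ / 2) * R * ‖s‖ := h1
      have h5 := norm_add_le ((F (x.1, x.2)).1 - (A * x.1 + s * c i)) (A * x.1 + s * c i)
      rw [sub_add_cancel] at h5
      rw [hK, mem_closedBall_zero_iff]
      have h6 : ε * ‖s‖ ≤ γ * R / 32 * ‖s‖ := by gcongr
      have h7 := mul_pos hγR hx
      show ‖(F (x.1, x.2)).1‖ ≤ _
      nlinarith
    · obtain ⟨i, h1, h2⟩ := mem_iUnion.1 hx'
      have h3 := hmod.deriv_fst i x.2 h2 x.1 (hHR i _ h1)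
      have h4 := norm_add_le ((fderiv ℂ F (x.1, x.2) (1, 0)).1 - A) A
      rw [sub_add_cancel] at h4
      show ‖(fderiv ℂ F (x.1, x.2) (1, 0)).1‖ ≤ _
      linarith
    · obtain ⟨i, h1, h2⟩ := mem_iUnion.1 hx'
      refine (hmod.deriv_snd i x.2 h2 x.1 (hHR i _ h1)).trans ?_
      have : ε * ‖s‖ ≤ δ₀ / 4 * ‖s‖ := by gcongr
      have h3 : ε * ‖s‖ ≤ δ₀ * ‖s‖ / 4 := by linarith
      gcongr
    · have h1 := hmod.value i x.2 hx1.2 x.1 (hHR i _ hx1.1)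
      have h2 := hmod.value i x'.2 hx2.2 x'.1 (hHR i _ hx2.1)
      have h3 : (F x).1 - (F x').1 = ((F (x.1, x.2)).1 - (A * x.1 + s * c i)) -
          ((F (x'.1, x'.2)).1 - (A * x'.1 + s * c i)) + A * (x.1 - x'.1) := by
        ring
      rw [h3]
      refine (norm_add_le _ _).trans ?_
      rw [norm_mul]
      have h4 := norm_sub_le ((F (x.1, x.2)).1 - (A * x.1 + s * c i))
          ((F (x'.1, x'.2)).1 - (A * x'.1 + s * c i))
      have h5 : ‖A‖ * ‖x.1 - x'.1‖ ≤ 2 * ‖x.1 - x'.1‖ := by gcongr; linarith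
      have h6 : ε * ‖s‖ ≤ γ * R / 32 * ‖s‖ := by gcongr
      linarith
  obtain ⟨α, hα, hrob⟩ := hdata.exists_robustlyMeetsGraphs
  have hclm := hmod.closure hQ
  -- the surrounding hyperbolic set
  set D := ball (0 : ℂ) (R' * ‖s‖) with hD
  set Z' := D ×ˢ ⋃ i, V i with hZ'
  have hclZ : closure Z' = closedBall 0 (R' * ‖s‖) ×ˢ ⋃ i, closure (V i) := by
    rw [hZ', closure_prod_iUnion, closure_ball _ (by positivity)]
  have hclZc : IsCompact (closure Z') := by
    rw [hclZ]
    exact (isCompact_closedBall _ _).prod (isCompact_iUnion hbase.isCompact_closure)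
  -- The branch over V_0 alone covers, because R' was chosen so that expansion by 1 + ε₁ outweighs
  -- the translation and the error.
  have hcover : closure Z' ⊆ F '' Z' := by
    rw [hclZ]
    rintro ⟨y, w⟩ ⟨hy, hw⟩
    obtain ⟨j, hj⟩ := mem_iUnion.1 hw
    obtain ⟨w₀, hw₀, hbw⟩ := hbase.exists_preimage 0 hj
    have hy' : ‖y‖ ≤ R' * ‖s‖ := by simpa using hy
    obtain ⟨z, hz, hFz⟩ := hmod.exists_fst_eq hs (by linarith) hε0.le hεa hw₀ le_rfl (y := y) (by
      have h1 := norm_sub_le y (s * c 0)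
      have h2 : (1 + ε₁) * (R' * ‖s‖) ≤ ‖A‖ * (R' * ‖s‖) := by gcongr
      have h3 : (B + 1) * ‖s‖ < ε₁ * R' * ‖s‖ := by gcongr
      have h4 : ε * ‖s‖ ≤ 1 * ‖s‖ := by gcongr; linarith
      linarith [hsc 0])
    refine ⟨(z, w₀), ⟨by simpa [hD] using hz, mem_iUnion.2 ⟨0, hw₀⟩⟩, Prod.ext hFz ?_⟩
    rw [hmod.skew]; exact hbw
  have hZZ : staySet F (boxUnion H V) ⊆ closure Z' := by
    intro x hx'
    have h1 : boxUnion H V ⊆ closedBall 0 (R' * ‖s‖) ×ˢ ⋃ i, closure (V i) := by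
      refine iUnion_subset fun i x hx'' => ⟨?_, mem_iUnion.2 ⟨i, subset_closure hx''.2⟩⟩
      simpa using hHR i _ hx''.1
    rw [← hclZ] at h1
    exact closure_minimal h1 isClosed_closure (hx' 0)
  have hΛΛ : staySet F (boxUnion H V) ⊆ staySet F Z' := by
    intro x hx' n
    apply hZZ
    intro m
    rw [← Function.iterate_add_apply]
    exact hx' (m + n)
  -- expansion
  obtain ⟨B', hB'⟩ := hclZc.exists_bound_of_continuousOn
    (hmod.continuous_fderiv_apply (0, 1)).continuousOn
  -- The weight dominates the off-diagonal entry: vertical expansion by 4 leaves 4L - L ≥ 2L after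
  -- its contribution is subtracted.
  set L := max B' 1 with hL
  have hLB : B' ≤ L := le_max_left _ _
  have hL1 : 1 ≤ L := le_max_right _ _
  set k := min (1 + ε₁ / 2) 2 with hk
  have hk1 : 1 < k := lt_min (by linarith) (by norm_num)
  have hyp : IsHyperbolicSet F (staySet F Z') 0 := by
    refine isHyperbolicSet_repelling (isCompact_staySet hclZc hFd.continuous.continuousOn)
      (image_staySet hcover) (fun x _ => hFd x) hL1 hk1 fun x hx' v => ?_
    have hxc : x ∈ closure Z' := hx' 0
    have hb1 := hB' x hxc
    rw [hclZ] at hxc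
    obtain ⟨hx1, hx2⟩ := hxc
    obtain ⟨i, hi⟩ := mem_iUnion.1 hx2
    have hx1' : ‖x.1‖ ≤ R' * ‖s‖ := by simpa using hx1
    have h1 := hclm.deriv_fst i x.2 hi x.1 hx1'
    have h4 := hbase.four_le_closure hQ hi
    rw [wnorm, wnorm, fderiv_snd_of_skew hFd (hQ.iterate l) hmod.skew, fderiv_fst_eq, norm_mul]
    set a := (fderiv ℂ F x (1, 0)).1 with ha
    set b := (fderiv ℂ F x (0, 1)).1 with hb
    have h5 : 1 + ε₁ / 2 ≤ ‖a‖ := by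
      have := norm_sub_norm_le A a
      rw [norm_sub_rev] at this
      have h1' : ‖a - A‖ ≤ ε := h1
      linarith
    have h6 := norm_sub_le (v.1 * a + v.2 * b) (v.2 * b)
    rw [add_sub_cancel_right, norm_mul, norm_mul] at h6
    have h7 : k ≤ ‖a‖ := (min_le_left _ _).trans h5
    have h8 : k ≤ 2 := min_le_right _ _
    have h9 : ‖v.1‖ * k ≤ ‖v.1‖ * ‖a‖ := by gcongr
    have h10 : ‖v.2‖ * ‖b‖ ≤ ‖v.2‖ * L := by gcongr; exact hb1.trans hLB
    have h11 : L * (4 * ‖v.2‖) ≤ L * (‖deriv Q^[l] x.2‖ * ‖v.2‖) := by gcongr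
    have h12 : k * (L * ‖v.2‖) ≤ 2 * (L * ‖v.2‖) := by gcongr
    have h13 : 0 ≤ L * ‖v.2‖ := by positivity
    linarith
  -- F is itself a skew product over b, so it serves as its own reference map g, with α' = 0.
  refine ⟨staySet F (boxUnion H V), H, V, K, δ₀ * ‖s‖, α, 0, F, fun i => ⟨hHo i, -(s * c i) / A, ?_⟩,
    hbase.vertical, isCompact_closedBall _ _, fun z hz => ?_, by positivity, le_rfl, hα,
    hFd.differentiableOn, fun x hx' => ⟨hdata.maps x hx', hmod.skew x⟩, hdata.contractsCone, hrob,
    hFd.differentiableOn, fun x _ => by simp, rfl, staySet F Z', hΛΛ, hyp⟩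
  · show ‖A * (-(s * c i) / A) + s * c i‖ < _
    rw [mul_div_cancel₀ _ hA0, neg_add_cancel, norm_zero]
    have : 0 < 1 - γ / 2 := by linarith
    positivity
  · obtain ⟨j, hj⟩ := hleb z hz
    exact mem_iUnion.2 ⟨j, hj (mem_ball_self (by positivity))⟩

/-! ### Saddle hyperbolic sets -/

/-- The continuous fixed section of a fibrewise contraction of a disc bundle. -/
theorem exists_continuous_fixed_section {X : Type*} [TopologicalSpace X] (S : X → X)
    (Φ : X → ℂ → ℂ) {R : ℝ} (hR : 0 ≤ R)
    (hcont : ∀ φ : X → ℂ, Continuous φ → (∀ x, ‖φ x‖ ≤ R) → Continuous fun x => Φ x (φ (S x)))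
    (hmaps : ∀ x z, ‖z‖ ≤ R → ‖Φ x z‖ ≤ R)
    (hlip : ∀ x z z', ‖z‖ ≤ R → ‖z'‖ ≤ R → ‖Φ x z - Φ x z'‖ ≤ 1 / 2 * ‖z - z'‖) :
    ∃ φ : X → ℂ, Continuous φ ∧ (∀ x, ‖φ x‖ ≤ R) ∧ ∀ x, φ x = Φ x (φ (S x)) := by
  let f : ℕ → X → ℂ := fun n => Nat.rec (fun _ => 0) (fun _ φ x => Φ x (φ (S x))) n
  have hfs : ∀ n x, f (n + 1) x = Φ x (f n (S x)) := fun n x => rfl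
  have hfR : ∀ n x, ‖f n x‖ ≤ R := by
    intro n
    induction n with
    | zero => intro x; simpa [f] using hR
    | succ n ih => intro x; exact hmaps x _ (ih _)
  have hfc : ∀ n, Continuous (f n) := by
    intro n
    induction n with
    | zero => exact continuous_const
    | succ n ih => exact hcont _ ih (hfR n)
  have hd : ∀ n x, dist (f n x) (f (n + 1) x) ≤ R * (1 / 2) ^ n := by
    intro n
    induction n with
    | zero =>
      intro x
      have h0 : f 0 x = 0 := rfl
      rw [h0, dist_zero_left]
      simpa using hfR 1 x
    | succ n ih =>
      intro x
      rw [hfs n x, hfs (n + 1) x, dist_eq_norm]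
      refine (hlip x (f n (S x)) (f (n + 1) (S x)) (hfR n _) (hfR (n + 1) _)).trans ?_
      have := ih (S x)
      rw [dist_eq_norm] at this
      rw [pow_succ]
      linarith
  have hlim : ∀ x, ∃ y, Tendsto (fun n => f n x) atTop (𝓝 y) := fun x =>
    cauchySeq_tendsto_of_complete (cauchySeq_of_le_geometric (1 / 2) R (by norm_num) fun n => hd n x)
  choose φ hφ using hlim
  have hφR : ∀ x, ‖φ x‖ ≤ R := fun x =>
    le_of_tendsto (hφ x).norm (Eventually.of_forall fun n => hfR n x)
  have hest : ∀ n x, dist (f n x) (φ x) ≤ R * (1 / 2) ^ n / (1 - 1 / 2) := fun n x =>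
    dist_le_of_le_geometric_of_tendsto (1 / 2) R (by norm_num) (fun n => hd n x) (hφ x) n
  have hto : Tendsto (fun n : ℕ => R * (1 / 2 : ℝ) ^ n / (1 - 1 / 2)) atTop (𝓝 0) := by
    have := ((tendsto_pow_atTop_nhds_zero_of_lt_one (r := (1 / 2 : ℝ)) (by norm_num)
      (by norm_num)).const_mul R).div_const (1 - 1 / 2)
    simpa using this
  have hunif : TendstoUniformly f φ atTop := by
    rw [Metric.tendstoUniformly_iff]
    intro ε hε
    filter_upwards [hto.eventually_lt_const hε] with n hn x
    rw [dist_comm]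
    exact (hest n x).trans_lt hn
  refine ⟨φ, hunif.continuous (Eventually.of_forall hfc).frequently, hφR, fun x => ?_⟩
  refine tendsto_nhds_unique ((tendsto_add_atTop_iff_nat 1).2 (hφ x)) ?_
  simp only [hfs]
  rw [tendsto_iff_norm_sub_tendsto_zero]
  refine squeeze_zero (fun _ => norm_nonneg _)
    (fun n => hlip x _ _ (hfR n (S x)) (hφR (S x))) ?_
  have := (tendsto_iff_norm_sub_tendsto_zero.1 (hφ (S x))).const_mul (1 / 2)
  simpa using this

/-- The projection onto the line spanned by `(1, ψ)` along the line spanned by `(φ, 1)`. -/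
def lineProj (φ ψ : ℂ) : ℂ × ℂ →L[ℂ] ℂ × ℂ :=
  (1 - φ * ψ)⁻¹ • ((ContinuousLinearMap.inl ℂ ℂ ℂ).comp (ContinuousLinearMap.fst ℂ ℂ ℂ) +
    ψ • (ContinuousLinearMap.inr ℂ ℂ ℂ).comp (ContinuousLinearMap.fst ℂ ℂ ℂ) -
    φ • (ContinuousLinearMap.inl ℂ ℂ ℂ).comp (ContinuousLinearMap.snd ℂ ℂ ℂ) -
    (φ * ψ) • (ContinuousLinearMap.inr ℂ ℂ ℂ).comp (ContinuousLinearMap.snd ℂ ℂ ℂ))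

theorem lineProj_apply (φ ψ : ℂ) (v : ℂ × ℂ) :
    lineProj φ ψ v = ((1 - φ * ψ)⁻¹ * (v.1 - φ * v.2)) • ((1, ψ) : ℂ × ℂ) := by
  ext
  · simp [lineProj]
  · simp [lineProj]; ring

theorem lineProj_stable {φ ψ : ℂ} (h : 1 - φ * ψ ≠ 0) : lineProj φ ψ (1, ψ) = (1, ψ) := by
  rw [lineProj_apply]
  simp [h]

theorem lineProj_unstable (φ ψ : ℂ) : lineProj φ ψ (φ, 1) = 0 := by
  rw [lineProj_apply]; simp

theorem eq_add_of_line {φ ψ : ℂ} (h : 1 - φ * ψ ≠ 0) (v : ℂ × ℂ) :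
    v = ((1 - φ * ψ)⁻¹ * (v.1 - φ * v.2)) • ((1, ψ) : ℂ × ℂ) +
      ((1 - φ * ψ)⁻¹ * (v.2 - ψ * v.1)) • ((φ, 1) : ℂ × ℂ) := by
  ext
  · simp; field_simp; ring
  · simp; field_simp; ring

theorem lineProj_idem {φ ψ : ℂ} (h : 1 - φ * ψ ≠ 0) :
    (lineProj φ ψ).comp (lineProj φ ψ) = lineProj φ ψ := by
  refine ContinuousLinearMap.ext fun v => ?_
  rw [ContinuousLinearMap.comp_apply, lineProj_apply φ ψ v, map_smul, lineProj_stable h]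

theorem finrank_range_lineProj {φ ψ : ℂ} (h : 1 - φ * ψ ≠ 0) :
    Module.finrank ℂ (lineProj φ ψ).range = 1 := by
  have h1 : (lineProj φ ψ).range = Submodule.span ℂ {((1, ψ) : ℂ × ℂ)} := by
    apply le_antisymm
    · rintro _ ⟨v, rfl⟩
      refine Submodule.mem_span_singleton.2 ⟨_, (lineProj_apply φ ψ v).symm⟩
    · rw [Submodule.span_singleton_le_iff_mem]
      exact ⟨_, lineProj_stable h⟩
  rw [h1]
  exact finrank_span_singleton (by simp)

theorem continuous_lineProj {X : Type*} [TopologicalSpace X] {φ ψ : X → ℂ} (hφ : Continuous φ)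
    (hψ : Continuous ψ) (h : ∀ x, 1 - φ x * ψ x ≠ 0) :
    Continuous fun x => lineProj (φ x) (ψ x) := by
  unfold lineProj
  refine Continuous.smul (Continuous.inv₀ (by fun_prop) h) ?_
  exact ((continuous_const.add (hψ.smul continuous_const)).sub (hφ.smul continuous_const)).sub
    ((hφ.mul hψ).smul continuous_const)

theorem norm_mobius_le {a b c d z : ℂ} {N M : ℝ} (h1 : ‖a * z + b‖ ≤ N) (h2 : 0 < M)
    (h3 : M ≤ ‖c * z + d‖) : ‖(a * z + b) / (c * z + d)‖ ≤ N / M := by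
  rw [norm_div]
  have := norm_nonneg (a * z + b)
  gcongr
  linarith

/-- Slopes of lines are transformed by Möbius maps. The difference quotient is (ad - bc)/((cz +
d)(cz' + d)), with numerator at most ‖d‖ + 1/4 and denominator at least (13‖d‖/14)². -/
theorem norm_mobius_sub_le {a b c d z z' : ℂ} (hd : 7 / 2 ≤ ‖d‖) (ha : ‖a‖ ≤ 1)
    (hbc : ‖b‖ * ‖c‖ ≤ 1 / 4) (h : ‖c * z‖ ≤ 1 / 4) (h' : ‖c * z'‖ ≤ 1 / 4) :
    ‖(a * z + b) / (c * z + d) - (a * z' + b) / (c * z' + d)‖ ≤ 1 / 2 * ‖z - z'‖ := by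
  have key : ∀ z, ‖c * z‖ ≤ 1 / 4 → 13 / 14 * ‖d‖ ≤ ‖c * z + d‖ := by
    intro z hz
    have := norm_sub_le (c * z + d) (c * z)
    rw [add_sub_cancel_left] at this
    linarith
  have k1 := key z h
  have k2 := key z' h'
  have n1 : c * z + d ≠ 0 := norm_pos_iff.1 (by linarith)
  have n2 : c * z' + d ≠ 0 := norm_pos_iff.1 (by linarith)
  have e : (a * z + b) / (c * z + d) - (a * z' + b) / (c * z' + d) =
      (a * d - b * c) * (z - z') / ((c * z + d) * (c * z' + d)) := by
    rw [div_sub_div _ _ n1 n2]; congr 1; ring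
  rw [e, norm_div, norm_mul, norm_mul, div_le_iff₀ (by positivity)]
  have h5 : ‖a * d - b * c‖ ≤ ‖d‖ + 1 / 4 := by
    refine (norm_sub_le _ _).trans ?_
    rw [norm_mul, norm_mul]
    nlinarith [norm_nonneg d]
  have h6 : (13 / 14 * ‖d‖) * (13 / 14 * ‖d‖) ≤ ‖c * z + d‖ * ‖c * z' + d‖ := by gcongr
  have h7 : ‖a * d - b * c‖ ≤ 1 / 2 * (‖c * z + d‖ * ‖c * z' + d‖) := by nlinarith
  nlinarith [norm_nonneg (z - z')]

section Saddle

variable {g : ℂ × ℂ → ℂ × ℂ} {Λ : Set (ℂ × ℂ)} {a₀ B : ℝ}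

/-- The derivative of `g` on `Λ` is dominated by its diagonal entries, which are contracting,
respectively expanding. -/
structure IsDominated (g : ℂ × ℂ → ℂ × ℂ) (Λ : Set (ℂ × ℂ)) (a₀ B : ℝ) : Prop where
  nonneg : 0 ≤ a₀
  lt_one : a₀ < 1
  one_le : 1 ≤ B
  le_a : ∀ x ∈ Λ, ‖(fderiv ℂ g x (1, 0)).1‖ ≤ a₀
  le_b : ∀ x ∈ Λ, ‖(fderiv ℂ g x (0, 1)).1‖ ≤ B
  le_c : ∀ x ∈ Λ, ‖(fderiv ℂ g x (1, 0)).2‖ ≤ (1 - a₀) / (4 * B)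
  le_d : ∀ x ∈ Λ, 7 / 2 ≤ ‖(fderiv ℂ g x (0, 1)).2‖

theorem IsDominated.small (h : IsDominated g Λ a₀ B) : (1 - a₀) / (4 * B) * B ≤ 1 / 4 ∧
    0 < (1 - a₀) / (4 * B) ∧ (1 - a₀) / (4 * B) ≤ 1 ∧ (1 - a₀) / (4 * B) * B = (1 - a₀) / 4 := by
  have h1 := h.nonneg
  have h2 := h.lt_one
  have h3 := h.one_le
  have h5 : 0 < 1 - a₀ := by linarith
  have h4 : (1 - a₀) / (4 * B) * B = (1 - a₀) / 4 := by field_simp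
  have h6 : 0 < (1 - a₀) / (4 * B) := by positivity
  refine ⟨by rw [h4]; linarith, h6, ?_, h4⟩
  rw [div_le_one (by positivity)]
  linarith

theorem fderiv_apply_eq (g : ℂ × ℂ → ℂ × ℂ) (x : ℂ × ℂ) (u v : ℂ) :
    fderiv ℂ g x (u, v) =
      ((fderiv ℂ g x (1, 0)).1 * u + (fderiv ℂ g x (0, 1)).1 * v,
        (fderiv ℂ g x (1, 0)).2 * u + (fderiv ℂ g x (0, 1)).2 * v) := by
  rw [clm_apply_eq]
  ext <;> simp [mul_comm]

/-- The shift on the natural extension. -/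
def backShift (g : ℂ × ℂ → ℂ × ℂ) (Λ : Set (ℂ × ℂ)) (x : naturalExtension g Λ) :
    naturalExtension g Λ :=
  ⟨fun i => x.1 (i + 1), fun i => x.2.1 (i + 1), fun i => x.2.2 (i + 1)⟩

theorem continuous_backShift : Continuous (backShift g Λ) :=
  Continuous.subtype_mk (f := fun x : naturalExtension g Λ => fun i => x.1 (i + 1))
    (continuous_pi fun i => (continuous_apply (i + 1)).comp continuous_subtype_val)
    fun x => (backShift g Λ x).2

/-- The inverse of the shift on the natural extension. -/
def forthShift (hΛ : MapsTo g Λ Λ) (x : naturalExtension g Λ) : naturalExtension g Λ :=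
  ⟨_, exists_mem_naturalExtension_map hΛ x.2⟩

theorem continuous_forthShift (hΛ : MapsTo g Λ Λ) (hg : ContinuousOn g Λ) :
    Continuous (forthShift hΛ) := by
  refine Continuous.subtype_mk (continuous_pi fun i => ?_) _
  cases i with
  | zero =>
    exact hg.comp_continuous ((continuous_apply 0).comp continuous_subtype_val) fun x => x.2.1 0
  | succ i => exact (continuous_apply i).comp continuous_subtype_val

theorem backShift_forthShift (hΛ : MapsTo g Λ Λ) (x : naturalExtension g Λ) :
    backShift g Λ (forthShift hΛ x) = x := rfl

theorem forthShift_backShift (hΛ : MapsTo g Λ Λ) (x : naturalExtension g Λ) :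
    forthShift hΛ (backShift g Λ x) = x := by
  apply Subtype.ext
  funext i
  cases i with
  | zero => exact x.2.2 0
  | succ i => rfl

theorem continuous_fderiv_entry (hgc : ContinuousOn (fderiv ℂ g) Λ) (i : ℕ) (v : ℂ × ℂ) :
    Continuous fun x : naturalExtension g Λ => fderiv ℂ g (x.1 i) v := by
  have h1 : Continuous fun x : naturalExtension g Λ => fderiv ℂ g (x.1 i) :=
    hgc.comp_continuous ((continuous_apply i).comp continuous_subtype_val) fun x => x.2.1 i
  exact h1.clm_apply continuous_const

/-- The unstable slopes. -/
theorem IsDominated.exists_unstable (h : IsDominated g Λ a₀ B) (hΛ : MapsTo g Λ Λ)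
    (hgc : ContinuousOn (fderiv ℂ g) Λ) :
    ∃ φ : naturalExtension g Λ → ℂ, Continuous φ ∧ (∀ x, ‖φ x‖ ≤ B) ∧
      ∀ x, ∃ t : ℂ, 2 ≤ ‖t‖ ∧
        fderiv ℂ g (x.1 0) (φ x, 1) = t • ((φ (forthShift hΛ x), 1) : ℂ × ℂ) := by
  obtain ⟨s1, s2, s3, s4⟩ := h.small
  have hB := h.one_le
  have hcz : ∀ x ∈ Λ, ∀ z : ℂ, ‖z‖ ≤ B → ‖(fderiv ℂ g x (1, 0)).2 * z‖ ≤ 1 / 4 := by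
    intro x hx z hz
    rw [norm_mul]
    refine le_trans ?_ s1
    have := h.le_c x hx
    gcongr
  have hden : ∀ x ∈ Λ, ∀ z : ℂ, ‖z‖ ≤ B →
      3 ≤ ‖(fderiv ℂ g x (1, 0)).2 * z + (fderiv ℂ g x (0, 1)).2‖ := by
    intro x hx z hz
    have h1 := hcz x hx z hz
    have h2 := norm_sub_le ((fderiv ℂ g x (1, 0)).2 * z + (fderiv ℂ g x (0, 1)).2)
      ((fderiv ℂ g x (1, 0)).2 * z)
    rw [add_sub_cancel_left] at h2
    linarith [h.le_d x hx]
  -- The line through (φ, 1) at x_{-1} is pushed forward by the derivative there, so the slope at a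
  -- backward orbit is a contraction of the slope at its shift.
  obtain ⟨φ, hφc, hφR, hφ⟩ := exists_continuous_fixed_section (backShift g Λ)
    (fun x z => ((fderiv ℂ g (x.1 1) (1, 0)).1 * z + (fderiv ℂ g (x.1 1) (0, 1)).1) /
      ((fderiv ℂ g (x.1 1) (1, 0)).2 * z + (fderiv ℂ g (x.1 1) (0, 1)).2)) (R := B) (by linarith)
    (fun φ hφ hR => by
      have h10 := continuous_fderiv_entry hgc 1 (1, 0)
      have h01 := continuous_fderiv_entry hgc 1 (0, 1)
      have hφS := hφ.comp (continuous_backShift (g := g) (Λ := Λ))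
      refine Continuous.div ?_ ?_ fun x => ?_
      · exact (h10.fst.mul hφS).add h01.fst
      · exact (h10.snd.mul hφS).add h01.snd
      · exact norm_pos_iff.1 (by linarith [hden _ (x.2.1 1) _ (hR (backShift g Λ x))]))
    (fun x z hz => by
      refine (norm_mobius_le (N := 2 * B) ?_ (by norm_num) (hden _ (x.2.1 1) z hz)).trans
        (by linarith)
      refine (norm_add_le _ _).trans ?_
      rw [norm_mul]
      have h1 := h.le_a _ (x.2.1 1)
      have h2 := h.le_b _ (x.2.1 1)
      have h3 := h.lt_one
      nlinarith [norm_nonneg z])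
    (fun x z z' hz hz' => by
      refine norm_mobius_sub_le (h.le_d _ (x.2.1 1)) ((h.le_a _ (x.2.1 1)).trans h.lt_one.le) ?_
        (hcz _ (x.2.1 1) z hz) (hcz _ (x.2.1 1) z' hz')
      rw [mul_comm]
      refine le_trans ?_ s1
      have h1 := h.le_b _ (x.2.1 1)
      have h2 := h.le_c _ (x.2.1 1)
      gcongr)
  refine ⟨φ, hφc, hφR, fun x => ?_⟩
  have hx := x.2.1 0
  have hd := hden _ hx (φ x) (hφR x)
  refine ⟨(fderiv ℂ g (x.1 0) (1, 0)).2 * φ x + (fderiv ℂ g (x.1 0) (0, 1)).2, by linarith, ?_⟩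
  have heq := hφ (forthShift hΛ x)
  rw [backShift_forthShift] at heq
  have hne : (fderiv ℂ g (x.1 0) (1, 0)).2 * φ x + (fderiv ℂ g (x.1 0) (0, 1)).2 ≠ 0 :=
    norm_pos_iff.1 (by linarith)
  rw [fderiv_apply_eq]
  change φ (forthShift hΛ x) = ((fderiv ℂ g (x.1 0) (1, 0)).1 * φ x +
    (fderiv ℂ g (x.1 0) (0, 1)).1) / _ at heq
  rw [heq]
  ext
  · simp only [Prod.smul_mk, smul_eq_mul, mul_one]
    exact (mul_div_cancel₀ _ hne).symm
  · simp

/-- The stable slopes. -/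
theorem IsDominated.exists_stable (h : IsDominated g Λ a₀ B) (hΛ : MapsTo g Λ Λ)
    (hg : ContinuousOn g Λ) (hgc : ContinuousOn (fderiv ℂ g) Λ) :
    ∃ ψ : naturalExtension g Λ → ℂ, Continuous ψ ∧ (∀ x, ‖ψ x‖ ≤ (1 - a₀) / (4 * B)) ∧
      ∀ x, ∃ t : ℂ, ‖t‖ ≤ a₀ + (1 - a₀) / 4 ∧
        fderiv ℂ g (x.1 0) (1, ψ x) = t • ((1, ψ (forthShift hΛ x)) : ℂ × ℂ) := by
  obtain ⟨s1, s2, s3, s4⟩ := h.small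
  have hB := h.one_le
  set ρ := (1 - a₀) / (4 * B) with hρ
  have hbz : ∀ x ∈ Λ, ∀ z : ℂ, ‖z‖ ≤ ρ → ‖(fderiv ℂ g x (0, 1)).1 * z‖ ≤ (1 - a₀) / 4 := by
    intro x hx z hz
    rw [norm_mul, ← s4, mul_comm]
    have := h.le_b x hx
    gcongr
  have hbz' : ∀ x ∈ Λ, ∀ z : ℂ, ‖z‖ ≤ ρ → ‖-(fderiv ℂ g x (0, 1)).1 * z‖ ≤ 1 / 4 := by
    intro x hx z hz
    rw [neg_mul, norm_neg]
    linarith [hbz x hx z hz, h.nonneg]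
  have hden : ∀ x ∈ Λ, ∀ z : ℂ, ‖z‖ ≤ ρ →
      3 ≤ ‖-(fderiv ℂ g x (0, 1)).1 * z + (fderiv ℂ g x (0, 1)).2‖ := by
    intro x hx z hz
    have h1 := hbz' x hx z hz
    have h2 := norm_sub_le (-(fderiv ℂ g x (0, 1)).1 * z + (fderiv ℂ g x (0, 1)).2)
      (-(fderiv ℂ g x (0, 1)).1 * z)
    rw [add_sub_cancel_left] at h2
    linarith [h.le_d x hx]
  -- For the stable line the derivative at x_0 is inverted: the slope at x is obtained by pulling
  -- back the one at the image orbit, which again contracts.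
  obtain ⟨ψ, hψc, hψR, hψ⟩ := exists_continuous_fixed_section (forthShift hΛ)
    (fun x z => ((fderiv ℂ g (x.1 0) (1, 0)).1 * z + -(fderiv ℂ g (x.1 0) (1, 0)).2) /
      (-(fderiv ℂ g (x.1 0) (0, 1)).1 * z + (fderiv ℂ g (x.1 0) (0, 1)).2)) (R := ρ) s2.le
    (fun φ hφ hR => by
      have h10 := continuous_fderiv_entry hgc 0 (1, 0)
      have h01 := continuous_fderiv_entry hgc 0 (0, 1)
      have hφS := hφ.comp (continuous_forthShift hΛ hg)
      refine Continuous.div ?_ ?_ fun x => ?_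
      · exact (h10.fst.mul hφS).add h10.snd.neg
      · exact (h01.fst.neg.mul hφS).add h01.snd
      · exact norm_pos_iff.1 (by linarith [hden _ (x.2.1 0) _ (hR (forthShift hΛ x))]))
    (fun x z hz => by
      refine (norm_mobius_le (N := 2 * ρ) ?_ (by norm_num) (hden _ (x.2.1 0) z hz)).trans
        (by linarith)
      refine (norm_add_le _ _).trans ?_
      rw [norm_mul, norm_neg]
      have h1 := h.le_a _ (x.2.1 0)
      have h2 := h.le_c _ (x.2.1 0)
      have h3 := h.lt_one
      nlinarith [norm_nonneg z])
    (fun x z z' hz hz' => by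
      refine norm_mobius_sub_le (h.le_d _ (x.2.1 0)) ((h.le_a _ (x.2.1 0)).trans h.lt_one.le) ?_
        (hbz' _ (x.2.1 0) z hz) (hbz' _ (x.2.1 0) z' hz')
      rw [norm_neg, norm_neg]
      refine le_trans ?_ s1
      have h1 := h.le_b _ (x.2.1 0)
      have h2 := h.le_c _ (x.2.1 0)
      gcongr)
  refine ⟨ψ, hψc, hψR, fun x => ?_⟩
  have hx := x.2.1 0
  set ψ' := ψ (forthShift hΛ x) with hψ'
  have hd := hden _ hx ψ' (hψR _)
  have heq : ψ x = ((fderiv ℂ g (x.1 0) (1, 0)).1 * ψ' + -(fderiv ℂ g (x.1 0) (1, 0)).2) /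
      (-(fderiv ℂ g (x.1 0) (0, 1)).1 * ψ' + (fderiv ℂ g (x.1 0) (0, 1)).2) := hψ x
  have hne : -(fderiv ℂ g (x.1 0) (0, 1)).1 * ψ' + (fderiv ℂ g (x.1 0) (0, 1)).2 ≠ 0 :=
    norm_pos_iff.1 (by linarith)
  refine ⟨(fderiv ℂ g (x.1 0) (1, 0)).1 + (fderiv ℂ g (x.1 0) (0, 1)).1 * ψ x, ?_, ?_⟩
  · refine (norm_add_le _ _).trans ?_
    linarith [h.le_a _ hx, hbz _ hx _ (hψR x)]
  · rw [eq_div_iff hne] at heq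
    rw [fderiv_apply_eq]
    ext
    · simp
    · simp only [Prod.smul_mk, smul_eq_mul, mul_one]
      linear_combination heq

/-- The invariant lines through (1, ψ) and (φ, 1) are transverse because |φψ| ≤ 1/4. At each step
the first vector is contracted by a₀ + (1 - a₀)/4 < 1 and the second expanded by at least 2. -/
theorem IsDominated.isHyperbolicSet (h : IsDominated g Λ a₀ B) (hΛc : IsCompact Λ)
    (hΛ : g '' Λ = Λ) (hd : ∀ x ∈ Λ, DifferentiableAt ℂ g x)
    (hgc : ContinuousOn (fderiv ℂ g) Λ) : IsHyperbolicSet g Λ 1 := by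
  have hmaps : MapsTo g Λ Λ := fun x hx => hΛ ▸ mem_image_of_mem g hx
  have hg : ContinuousOn g Λ := fun x hx => (hd x hx).continuousAt.continuousWithinAt
  obtain ⟨s1, s2, s3, s4⟩ := h.small
  have hB := h.one_le
  obtain ⟨φ, hφc, hφR, hφ⟩ := h.exists_unstable hmaps hgc
  obtain ⟨ψ, hψc, hψR, hψ⟩ := h.exists_stable hmaps hg hgc
  have hne : ∀ x, 1 - φ x * ψ x ≠ 0 := by
    intro x h0
    have h1 : ‖φ x * ψ x‖ ≤ 1 / 4 := by
      rw [norm_mul, mul_comm]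
      refine le_trans ?_ s1
      have := hφR x
      have := hψR x
      gcongr
    rw [show φ x * ψ x = 1 by linear_combination -h0] at h1
    norm_num at h1
  set κs := a₀ + (1 - a₀) / 4 with hκs
  have hκs1 : κs < 1 := by have := h.lt_one; rw [hκs]; linarith
  have hκs0 : 0 ≤ κs := by have := h.lt_one; have := h.nonneg; rw [hκs]; linarith
  have hsn : ∀ n : ℕ, ∀ x : naturalExtension g Λ,
      ‖fderiv ℂ g^[n] (x.1 0) (1, ψ x)‖ ≤ κs ^ n := by
    intro n
    induction n with
    | zero =>
      intro x
      simp only [Function.iterate_zero, fderiv_id, ContinuousLinearMap.id_apply, pow_zero]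
      rw [Prod.norm_def]
      exact max_le (by simp) ((hψR x).trans s3)
    | succ n ih =>
      intro x
      obtain ⟨t, ht, hDt⟩ := hψ x
      rw [fderiv_iterate_succ_apply hmaps hd n (x.2.1 0), hDt, map_smul, norm_smul, pow_succ']
      have := ih (forthShift hmaps x)
      gcongr
      exact this
  have hun : ∀ n : ℕ, ∀ x : naturalExtension g Λ,
      2 ^ n ≤ ‖fderiv ℂ g^[n] (x.1 0) (φ x, 1)‖ := by
    intro n
    induction n with
    | zero =>
      intro x
      simp only [Function.iterate_zero, fderiv_id, ContinuousLinearMap.id_apply, pow_zero]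
      rw [Prod.norm_def]
      exact le_max_of_le_right (by simp)
    | succ n ih =>
      intro x
      obtain ⟨t, ht, hDt⟩ := hφ x
      rw [fderiv_iterate_succ_apply hmaps hd n (x.2.1 0), hDt, map_smul, norm_smul, pow_succ']
      have := ih (forthShift hmaps x)
      gcongr
      exact this
  classical
  set P : (ℕ → ℂ × ℂ) → (ℂ × ℂ →L[ℂ] ℂ × ℂ) := fun x =>
    if hx : x ∈ naturalExtension g Λ then lineProj (φ ⟨x, hx⟩) (ψ ⟨x, hx⟩) else 0 with hP
  have hPx : ∀ x (hx : x ∈ naturalExtension g Λ), P x = lineProj (φ ⟨x, hx⟩) (ψ ⟨x, hx⟩) :=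
    fun x hx => dif_pos hx
  refine ⟨hΛc, hΛ, hd, P, ?_, fun x hx => ?_, fun x hx => ?_, fun x hx => ?_, B, max κs (1 / 2),
    by linarith, by positivity, max_lt hκs1 (by norm_num), fun x hx n v => ⟨fun hv => ?_,
    fun hv => ?_⟩⟩
  · rw [continuousOn_iff_continuous_domRestrict]
    refine (continuous_lineProj hφc hψc hne).congr fun x => ?_
    exact (hPx x.1 x.2).symm
  · rw [hPx x hx]; exact lineProj_idem (hne _)
  · rw [hPx x hx]; exact finrank_range_lineProj (hne _)
  · set y := backShift g Λ ⟨x, hx⟩ with hy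
    have hyx : forthShift hmaps y = ⟨x, hx⟩ := forthShift_backShift hmaps _
    have hPy : P (fun i => x (i + 1)) = lineProj (φ y) (ψ y) := hPx _ y.2
    rw [hPx x hx, hPy]
    change (fderiv ℂ g (y.1 0)).comp (lineProj (φ y) (ψ y)) =
      (lineProj (φ ⟨x, hx⟩) (ψ ⟨x, hx⟩)).comp (fderiv ℂ g (y.1 0))
    obtain ⟨t, -, ht⟩ := hψ y
    obtain ⟨t', -, ht'⟩ := hφ y
    rw [hyx] at ht ht'
    refine ContinuousLinearMap.ext fun v => ?_
    rw [ContinuousLinearMap.comp_apply, ContinuousLinearMap.comp_apply, eq_add_of_line (hne y) v]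
    simp only [map_add, map_smul, lineProj_stable (hne y), lineProj_unstable, ht, ht', smul_zero, map_zero,
      lineProj_stable (hne ⟨x, hx⟩)]
  · rw [hPx x hx, lineProj_apply] at hv
    set t := (1 - φ ⟨x, hx⟩ * ψ ⟨x, hx⟩)⁻¹ * (v.1 - φ ⟨x, hx⟩ * v.2)
    have h1 := hsn n ⟨x, hx⟩
    have h2 : ‖t‖ ≤ ‖v‖ := by
      have h3 : v.1 = t := by rw [← hv]; simp
      rw [← h3]; exact norm_fst_le v
    have h3 : κs ^ n ≤ max κs (1 / 2) ^ n := by gcongr; exact le_max_left _ _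
    have h4 : 0 ≤ max κs (1 / 2) ^ n := by positivity
    calc ‖fderiv ℂ g^[n] (x 0) v‖ = ‖t‖ * ‖fderiv ℂ g^[n] (x 0) (1, ψ ⟨x, hx⟩)‖ := by
          rw [← hv, map_smul, norm_smul]
      _ ≤ ‖v‖ * max κs (1 / 2) ^ n := by gcongr; exact h1.trans h3
      _ ≤ B * max κs (1 / 2) ^ n * ‖v‖ := by
          have : 0 ≤ max κs (1 / 2) ^ n * ‖v‖ := by positivity
          nlinarith
  · rw [hPx x hx] at hv
    have hv' := eq_add_of_line (hne ⟨x, hx⟩) v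
    rw [← lineProj_apply, hv, zero_add] at hv'
    set t := (1 - φ ⟨x, hx⟩ * ψ ⟨x, hx⟩)⁻¹ * (v.2 - ψ ⟨x, hx⟩ * v.1)
    have h1 := hun n ⟨x, hx⟩
    have h2 : ‖v‖ ≤ B * ‖t‖ := by
      rw [hv', norm_smul, Prod.norm_def, mul_comm]
      gcongr
      exact max_le (hφR _) (by simpa using hB)
    have h3 : (1 / 2 : ℝ) ^ n ≤ max κs (1 / 2) ^ n := by gcongr; exact le_max_right _ _
    have h4 : ‖fderiv ℂ g^[n] (x 0) v‖ = ‖t‖ * ‖fderiv ℂ g^[n] (x 0) (φ ⟨x, hx⟩, 1)‖ := by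
      conv_lhs => rw [hv']
      rw [map_smul, norm_smul]
    have h5 : 1 ≤ max κs (1 / 2) ^ n * ‖fderiv ℂ g^[n] (x 0) (φ ⟨x, hx⟩, 1)‖ := by
      calc (1 : ℝ) = (1 / 2) ^ n * 2 ^ n := by rw [← mul_pow]; norm_num
        _ ≤ _ := by gcongr
    rw [h4]
    calc ‖v‖ ≤ B * ‖t‖ * 1 := by rw [mul_one]; exact h2
      _ ≤ B * ‖t‖ * (max κs (1 / 2) ^ n * ‖fderiv ℂ g^[n] (x 0) (φ ⟨x, hx⟩, 1)‖) := by gcongr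
      _ = _ := by ring

end Saddle

/-! ### Robustness of coverings and saddle blenders -/

section Covering

variable {E E' : Type*} [NormedAddCommGroup E] [NormedSpace ℂ E] [CompleteSpace E]
  [NormedAddCommGroup E'] [NormedSpace ℂ E'] [CompleteSpace E']

/-- A map with surjective derivative covers, together with all `C^1`-close maps, a neighbourhood of
each value. -/
theorem exists_nhds_subset_image_of_close {F : E → E'} {Z : Set E} (hZ : IsOpen Z)
    (hF : ContDiff ℂ 1 F) {x : E} (hx : x ∈ Z) (hsurj : (fderiv ℂ F x).range = ⊤) :
    ∃ U ∈ 𝓝 (F x), ∃ ε : ℝ, 0 < ε ∧ ∀ g : E → E',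
      (∀ y ∈ Z, DifferentiableAt ℂ g y ∧ ‖g y - F y‖ ≤ ε ∧ ‖fderiv ℂ g y - fderiv ℂ F y‖ ≤ ε) →
      U ⊆ g '' Z := by
  set φ := fderiv ℂ F x with hφ
  set S := φ.nonlinearRightInverseOfSurjective hsurj with hS
  have hN : 0 < S.nnnorm := φ.nonlinearRightInverseOfSurjective_nnnorm_pos hsurj
  set κ : ℝ := (S.nnnorm : ℝ)⁻¹ with hκ
  have hκ0 : 0 < κ := inv_pos.2 (NNReal.coe_pos.2 hN)
  have hcont : ∀ᶠ y in 𝓝 x, ‖fderiv ℂ F y - φ‖ ≤ κ / 4 := by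
    have h1 : Tendsto (fun y => ‖fderiv ℂ F y - φ‖) (𝓝 x) (𝓝 ‖φ - φ‖) :=
      (((hF.continuous_fderiv one_ne_zero).tendsto x).sub_const φ).norm
    rw [sub_self, norm_zero] at h1
    exact (h1.eventually_lt_const (by positivity : (0 : ℝ) < κ / 4)).mono fun _ => le_of_lt
  obtain ⟨ρ, hρ, hball⟩ := nhds_basis_closedBall.mem_iff.1
    (inter_mem (hZ.mem_nhds hx) hcont)
  refine ⟨ball (F x) (κ * ρ / 8), ball_mem_nhds _ (by positivity), min (κ / 4) (κ * ρ / 8),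
    by positivity, fun g hg y hy => ?_⟩
  have hκ2 : 0 ≤ κ / 2 := by positivity
  -- κ is the inverse of the norm of a right inverse of φ. Being κ/2-close to φ, the map g covers
  -- the ball of radius κρ/2 about g x, which absorbs the two displacements κρ/8.
  have happ : ApproximatesLinearOn g φ (closedBall x ρ) ⟨κ / 2, hκ2⟩ := by
    intro a ha b hb
    refine (convex_closedBall x ρ).norm_image_sub_le_of_norm_fderiv_le' (𝕜 := ℂ) (f := g) (φ := φ)
      (fun z hz => (hg z (hball hz).1).1) (fun z hz => ?_) hb ha
    have h1 := (hg z (hball hz).1).2.2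
    have h2 : ‖fderiv ℂ F z - φ‖ ≤ κ / 4 := (hball hz).2
    have h3 := norm_add_le (fderiv ℂ g z - fderiv ℂ F z) (fderiv ℂ F z - φ)
    rw [sub_add_sub_cancel] at h3
    have h4 := min_le_left (κ / 4) (κ * ρ / 8)
    show _ ≤ κ / 2
    linarith
  have hs := happ.surjOn_closedBall_of_nonlinearRightInverse S hρ.le Subset.rfl
  have hy' : y ∈ closedBall (g x) (((S.nnnorm : ℝ)⁻¹ - (⟨κ / 2, hκ2⟩ : NNReal)) * ρ) := by
    have h1 := (hg x hx).2.1
    have h2 := dist_triangle y (F x) (g x)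
    rw [dist_comm (F x), dist_eq_norm (g x)] at h2
    have h3 : dist y (F x) < κ * ρ / 8 := hy
    have h4 := min_le_right (κ / 4) (κ * ρ / 8)
    rw [mem_closedBall]
    show dist y (g x) ≤ (κ - κ / 2) * ρ
    nlinarith
  obtain ⟨z, hz, hgz⟩ := hs hy'
  exact ⟨z, (hball hz).1, hgz⟩

/-- Compactness reduces the robust covering to its local form at finitely many points. -/
theorem exists_robust_covering {F : E → E'} {Z : Set E} (hZ : IsOpen Z)
    (hF : ContDiff ℂ 1 F) (hsurj : ∀ x ∈ Z, (fderiv ℂ F x).range = ⊤) {K : Set E'}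
    (hK : IsCompact K) (hKF : K ⊆ F '' Z) :
    ∃ ε : ℝ, 0 < ε ∧ ∀ g : E → E',
      (∀ y ∈ Z, DifferentiableAt ℂ g y ∧ ‖g y - F y‖ ≤ ε ∧ ‖fderiv ℂ g y - fderiv ℂ F y‖ ≤ ε) →
      K ⊆ g '' Z := by
  refine hK.induction_on (p := fun s => ∃ ε : ℝ, 0 < ε ∧ ∀ g : E → E',
      (∀ y ∈ Z, DifferentiableAt ℂ g y ∧ ‖g y - F y‖ ≤ ε ∧ ‖fderiv ℂ g y - fderiv ℂ F y‖ ≤ ε) →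
      s ⊆ g '' Z) ⟨1, one_pos, fun _ _ => empty_subset _⟩ ?_ ?_ ?_
  · rintro s t hst ⟨ε, hε, h⟩
    exact ⟨ε, hε, fun g hg => hst.trans (h g hg)⟩
  · rintro s t ⟨ε, hε, h⟩ ⟨ε', hε', h'⟩
    refine ⟨min ε ε', lt_min hε hε', fun g hg => union_subset (h g fun y hy => ?_)
      (h' g fun y hy => ?_)⟩
    · obtain ⟨h1, h2, h3⟩ := hg y hy
      exact ⟨h1, h2.trans (min_le_left _ _), h3.trans (min_le_left _ _)⟩
    · obtain ⟨h1, h2, h3⟩ := hg y hy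
      exact ⟨h1, h2.trans (min_le_right _ _), h3.trans (min_le_right _ _)⟩
  · intro y hy
    obtain ⟨x, hx, rfl⟩ := hKF hy
    obtain ⟨U, hU, ε, hε, h⟩ := exists_nhds_subset_image_of_close hZ hF hx (hsurj x hx)
    exact ⟨U, mem_nhdsWithin_of_mem_nhds hU, ε, hε, h⟩

end Covering

theorem norm_clm_sub_apply_le {f g : ℂ × ℂ →L[ℂ] ℂ × ℂ} {ε : ℝ} (h : ‖f - g‖ ≤ ε) {v : ℂ × ℂ}
    (hv : ‖v‖ ≤ 1) : ‖(f v).1 - (g v).1‖ ≤ ε ∧ ‖(f v).2 - (g v).2‖ ≤ ε := by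
  have h1 : ‖f v - g v‖ ≤ ε := by
    rw [← sub_apply]
    have h2 := (f - g).le_opNorm v
    have h3 : ‖f - g‖ * ‖v‖ ≤ ‖f - g‖ * 1 := by gcongr
    linarith
  exact ⟨(norm_fst_le (f v - g v)).trans h1, (norm_snd_le (f v - g v)).trans h1⟩

set_option maxHeartbeats 1000000 in
/-- A model system with contracting fibres has a robust saddle hyperbolic set. -/
theorem exists_robust_saddle {c : Fin 3 → ℂ} {R γ : ℝ} (hR : 0 < R) (hγ : 0 < γ)
    (hγ4 : γ ≤ 1 / 4) (hcov : ∀ z : ℂ, ‖z‖ ≤ (1 + γ) * R → ∃ i, ‖z + c i‖ ≤ (1 - γ) * R)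
    {ε₁ : ℝ} (hε₁ : 0 < ε₁) :
    ∃ ε : ℝ, 0 < ε ∧ ∀ {Q : ℂ → ℂ} {l : ℕ} {r : Fin 3 → ℂ} {V : Fin 3 → Set ℂ}
      {ψ : Fin 3 → Fin 3 → ℂ → ℂ} {η C : ℝ} {A s : ℂ} {F : ℂ × ℂ → ℂ × ℂ}, Differentiable ℂ Q →
      IsBaseSystem Q l r V ψ η C → IsModelSystem Q l V c A s R ε F → s ≠ 0 →
      1 - γ / 2 ≤ ‖A‖ → ‖A‖ ≤ 1 - ε₁ → ∃ Z : Set (ℂ × ℂ), IsOpen Z ∧ Z.Nonempty ∧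
        IsCompact (closure Z) ∧ closure Z ⊆ F '' Z ∧ ∃ ε' : ℝ, 0 < ε' ∧ ∀ g : ℂ × ℂ → ℂ × ℂ,
          (∀ x ∈ closure Z, DifferentiableAt ℂ g x ∧ ‖g x - F x‖ ≤ ε' ∧
            ‖fderiv ℂ g x - fderiv ℂ F x‖ ≤ ε') →
          ContinuousOn (fderiv ℂ g) (closure Z) → IsHyperbolicSet g (staySet g Z) 1 := by
  set ε := min (γ * R / 4) (min (1 / 4) (ε₁ / 2)) with hε
  have hεγ : ε ≤ γ * R / 4 := min_le_left _ _
  have hεa : ε ≤ 1 / 4 := (min_le_right _ _).trans (min_le_left _ _)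
  have hεe : ε ≤ ε₁ / 2 := (min_le_right _ _).trans (min_le_right _ _)
  have hε0 : 0 < ε := by positivity
  refine ⟨ε, hε0, ?_⟩
  intro Q l r V ψ η C A s F hQ hbase hmod hs hA1 hA2
  have hs' : 0 < ‖s‖ := norm_pos_iff.2 hs
  have hFd := hmod.differentiable
  have hclm := hmod.closure hQ
  have hε₁1 : ε₁ ≤ 1 := by linarith
  set D := ball (0 : ℂ) (R * ‖s‖) with hD
  set Z := D ×ˢ ⋃ i, V i with hZ
  have hZo : IsOpen Z := isOpen_ball.prod (isOpen_iUnion hbase.vertical.isOpen)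
  have hclZ : closure Z = closedBall 0 (R * ‖s‖) ×ˢ ⋃ i, closure (V i) := by
    rw [hZ, closure_prod_iUnion, closure_ball _ (by positivity)]
  have hclZc : IsCompact (closure Z) := by
    rw [hclZ]
    exact (isCompact_closedBall _ _).prod (isCompact_iUnion hbase.isCompact_closure)
  have hcover : closure Z ⊆ F '' Z := by
    rw [hclZ]
    rintro ⟨y, w⟩ ⟨hy, hw⟩
    obtain ⟨j, hj⟩ := mem_iUnion.1 hw
    have hy' : ‖y‖ ≤ R * ‖s‖ := by simpa using hy
    -- The covering property at -y/s gives |y - s c_i| ≤ (1 - γ)R|s|. Since |A| ≥ 1 - γ/2 and ε ≤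
    -- γR/4, the preimage by the i-th fibre map falls inside the disc.
    obtain ⟨i, hi⟩ := hcov (-(y / s)) (by
      rw [norm_neg, norm_div, div_le_iff₀ hs']
      have : 0 ≤ γ * R * ‖s‖ := by positivity
      linarith)
    have hi' : ‖y - s * c i‖ ≤ (1 - γ) * R * ‖s‖ := by
      have h1 : y - s * c i = -(-(y / s) + c i) * s := by field_simp; ring
      rw [h1, norm_mul, norm_neg]
      gcongr
    obtain ⟨w₀, hw₀, hbw⟩ := hbase.exists_preimage i hj
    obtain ⟨z, hz, hFz⟩ := hmod.exists_fst_eq hs (by linarith) hε0.le hεa hw₀ le_rfl (y := y) (by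
      have h1 : (1 - γ / 2) * (R * ‖s‖) ≤ ‖A‖ * (R * ‖s‖) := by gcongr
      have h2 : ε * ‖s‖ ≤ γ * R / 4 * ‖s‖ := by gcongr
      have h3 : 0 < γ * R * ‖s‖ := by positivity
      linarith)
    refine ⟨(z, w₀), ⟨by simpa [hD] using hz, mem_iUnion.2 ⟨i, hw₀⟩⟩, Prod.ext hFz ?_⟩
    rw [hmod.skew]; exact hbw
  have hentries : ∀ x ∈ closure Z, ‖(fderiv ℂ F x (1, 0)).1‖ ≤ 1 - ε₁ / 2 ∧
      (fderiv ℂ F x (1, 0)).1 ≠ 0 ∧ (fderiv ℂ F x (1, 0)).2 = 0 ∧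
      4 ≤ ‖(fderiv ℂ F x (0, 1)).2‖ := by
    intro x hx
    rw [hclZ] at hx
    obtain ⟨hx1, hx2⟩ := hx
    obtain ⟨i, hi⟩ := mem_iUnion.1 hx2
    have hx1' : ‖x.1‖ ≤ R * ‖s‖ := by simpa using hx1
    have h1 : ‖(fderiv ℂ F x (1, 0)).1 - A‖ ≤ ε := hclm.deriv_fst i x.2 hi x.1 hx1'
    have h4 := hbase.four_le_closure hQ hi
    rw [fderiv_snd_of_skew hFd (hQ.iterate l) hmod.skew,
      fderiv_snd_of_skew hFd (hQ.iterate l) hmod.skew]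
    refine ⟨?_, fun h0 => ?_, by simp, by simpa using h4⟩
    · have := norm_sub_norm_le (fderiv ℂ F x (1, 0)).1 A
      linarith
    · rw [h0, zero_sub, norm_neg] at h1
      linarith
  obtain ⟨ε₂, hε₂, hrob⟩ := exists_robust_covering hZo hmod.contDiff (fun x hx => by
    obtain ⟨-, h1, h2, h3⟩ := hentries x (subset_closure hx)
    have h3' : (fderiv ℂ F x (0, 1)).2 ≠ 0 := norm_pos_iff.1 (by linarith)
    rw [LinearMap.range_eq_top]
    rintro ⟨y₁, y₂⟩
    refine ⟨((y₁ - (fderiv ℂ F x (0, 1)).1 * (y₂ / (fderiv ℂ F x (0, 1)).2)) /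
      (fderiv ℂ F x (1, 0)).1, y₂ / (fderiv ℂ F x (0, 1)).2), ?_⟩
    rw [ContinuousLinearMap.coe_coe, fderiv_apply_eq, h2]
    ext
    · simp only []; field_simp; ring
    · simp only []; field_simp; ring) hclZc hcover
  obtain ⟨B', hB'⟩ := hclZc.exists_bound_of_continuousOn
    (hmod.continuous_fderiv_apply (0, 1)).continuousOn
  set B := max B' 0 + 1 with hB
  have hBB : B' + 1 ≤ B := by rw [hB]; gcongr; exact le_max_left _ _
  have hB1 : 1 ≤ B := by rw [hB]; linarith [le_max_right B' 0]
  -- In turn: robustness of the covering, vertical expansion 4 - 1/2 = 7/2, contraction 1 - ε₁/2 +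
  -- ε₁/4, and the bound on the lower left entry, which is zero for the skew product.
  set ε' := min ε₂ (min (1 / 2) (min (ε₁ / 4) (ε₁ / 4 / (4 * B)))) with hε'
  have e1 : ε' ≤ ε₂ := min_le_left _ _
  have e2 : ε' ≤ 1 / 2 := (min_le_right _ _).trans (min_le_left _ _)
  have e3 : ε' ≤ ε₁ / 4 := (min_le_right _ _).trans ((min_le_right _ _).trans (min_le_left _ _))
  have e4 : ε' ≤ ε₁ / 4 / (4 * B) :=
    (min_le_right _ _).trans ((min_le_right _ _).trans (min_le_right _ _))
  refine ⟨Z, hZo, ⟨(0, r 0), by simpa [hD] using by positivity,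
    mem_iUnion.2 ⟨0, hbase.vertical.mem 0⟩⟩, hclZc, hcover, ε', by positivity,
    fun g hg hgc => ?_⟩
  have hgZ : closure Z ⊆ g '' Z := hrob g fun y hy => by
    obtain ⟨h1, h2, h3⟩ := hg y (subset_closure hy)
    exact ⟨h1, h2.trans e1, h3.trans e1⟩
  have hst : staySet g Z ⊆ closure Z := fun x hx => hx 0
  have hdom : IsDominated g (staySet g Z) (1 - ε₁ / 4) B := by
    have hbd : ∀ x ∈ staySet g Z, ‖(fderiv ℂ g x (1, 0)).1‖ ≤ 1 - ε₁ / 4 ∧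
        ‖(fderiv ℂ g x (0, 1)).1‖ ≤ B ∧ ‖(fderiv ℂ g x (1, 0)).2‖ ≤ ε' ∧
        7 / 2 ≤ ‖(fderiv ℂ g x (0, 1)).2‖ := by
      intro x hx
      obtain ⟨h1, -, h2, h3⟩ := hentries x (hst hx)
      obtain ⟨-, -, h4⟩ := hg x (hst hx)
      obtain ⟨h5, h6⟩ := norm_clm_sub_apply_le h4 (v := (1, 0)) (by simp [Prod.norm_def])
      obtain ⟨h7, h8⟩ := norm_clm_sub_apply_le h4 (v := (0, 1)) (by simp [Prod.norm_def])
      have h9 := hB' x (hst hx)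
      refine ⟨?_, ?_, ?_, ?_⟩
      · linarith [norm_sub_norm_le (fderiv ℂ g x (1, 0)).1 (fderiv ℂ F x (1, 0)).1]
      · linarith [norm_sub_norm_le (fderiv ℂ g x (0, 1)).1 (fderiv ℂ F x (0, 1)).1]
      · rwa [h2, sub_zero] at h6
      · have := norm_sub_norm_le (fderiv ℂ F x (0, 1)).2 (fderiv ℂ g x (0, 1)).2
        rw [norm_sub_rev] at this
        linarith
    exact
      { nonneg := by linarith
        lt_one := by linarith
        one_le := hB1
        le_a := fun x hx => (hbd x hx).1
        le_b := fun x hx => (hbd x hx).2.1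
        le_c := fun x hx => ((hbd x hx).2.2.1.trans e4).trans (by rw [sub_sub_cancel])
        le_d := fun x hx => (hbd x hx).2.2.2 }
  refine hdom.isHyperbolicSet (isCompact_staySet hclZc fun x hx => ?_) (image_staySet ?_)
    (fun x hx => (hg x (hst hx)).1) (hgc.mono hst)
  · exact (hg x hx).1.continuousAt.continuousWithinAt
  · exact hgZ

/-! ### Endomorphisms of the projective plane that are polynomial in the affine chart -/

/-- `G` is a lift of an endomorphism of degree `D` of `ℙ²` which in the affine chart is the
self-map `F`. -/
structure IsAffineLift (D : ℕ) (G : Fin 3 → MvPolynomial (Fin 3) ℂ) (F : ℂ × ℂ → ℂ × ℂ) :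
    Prop where
  isEndoLift : IsEndoLift D G
  coord_eq : ∀ x i, coord G i x = ![1, (F x).1, (F x).2] i

theorem IsAffineLift.coord_zero {D : ℕ} {G F} (h : IsAffineLift D G F) (x : ℂ × ℂ) :
    coord G 0 x = 1 := h.coord_eq x 0

theorem IsAffineLift.affineMap_eq {D : ℕ} {G F} (h : IsAffineLift D G F) :
    affineMap G = F := by
  funext x
  rw [affineMap, h.coord_eq x 0, h.coord_eq x 1, h.coord_eq x 2]
  simp

theorem isAffineLift_id : IsAffineLift 1 MvPolynomial.X id where
  isEndoLift :=
    { homogeneous := fun i => MvPolynomial.isHomogeneous_X _ i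
      nondegenerate := fun v hv => funext fun i => by simpa using hv i }
  coord_eq x i := by simp [coord]

theorem IsAffineLift.comp {D D' : ℕ} {G G' : Fin 3 → MvPolynomial (Fin 3) ℂ}
    {F F' : ℂ × ℂ → ℂ × ℂ} (h : IsAffineLift D G F) (h' : IsAffineLift D' G' F') :
    IsAffineLift (D' * D) (fun i => MvPolynomial.bind₁ G' (G i)) (F ∘ F') := by
  have heval : ∀ (v : Fin 3 → ℂ) (i : Fin 3), MvPolynomial.eval v (MvPolynomial.bind₁ G' (G i)) =
      MvPolynomial.eval (fun j => MvPolynomial.eval v (G' j)) (G i) := by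
    intro v i
    have := MvPolynomial.aeval_bind₁ (R := ℂ) v G' (G i)
    simpa [MvPolynomial.coe_aeval_eq_eval] using this
  refine ⟨⟨fun i => (h.isEndoLift.homogeneous i).aeval G' h'.isEndoLift.homogeneous,
    fun v hv => ?_⟩, fun x i => ?_⟩
  · apply h'.isEndoLift.nondegenerate
    have h1 := h.isEndoLift.nondegenerate (fun j => MvPolynomial.eval v (G' j))
      fun i => by rw [← heval]; exact hv i
    exact fun i => congrFun h1 i
  · rw [coord, heval]
    have h1 : (fun j => MvPolynomial.eval ![1, x.1, x.2] (G' j)) =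
        ![1, (F' x).1, (F' x).2] := funext fun j => h'.coord_eq x j
    rw [h1]
    exact h.coord_eq (F' x) i

theorem IsAffineLift.exists_iterate {D : ℕ} {G : Fin 3 → MvPolynomial (Fin 3) ℂ}
    {F : ℂ × ℂ → ℂ × ℂ} (h : IsAffineLift D G F) (n : ℕ) :
    ∃ G', IsAffineLift (D ^ n) G' F^[n] := by
  induction n with
  | zero => exact ⟨_, by simpa using isAffineLift_id⟩
  | succ n ih =>
    obtain ⟨G', hG'⟩ := ih
    refine ⟨fun i => MvPolynomial.bind₁ G' (G i), ?_⟩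
    rw [Function.iterate_succ', pow_succ]
    exact h.comp hG'

/-- The homogenisation of `p` to degree `d` in the variables `X 0` and `X j`. -/
def homogenise (p : Polynomial ℂ) (d : ℕ) (j : Fin 3) : MvPolynomial (Fin 3) ℂ :=
  ∑ k ∈ Finset.range (d + 1),
    MvPolynomial.C (p.coeff k) * (MvPolynomial.X j ^ k * MvPolynomial.X 0 ^ (d - k))

theorem isHomogeneous_homogenise (p : Polynomial ℂ) (d : ℕ) (j : Fin 3) :
    (homogenise p d j).IsHomogeneous d := by
  refine MvPolynomial.IsHomogeneous.sum _ _ _ fun k hk => ?_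
  have h1 := (MvPolynomial.isHomogeneous_X_pow (R := ℂ) j k).mul
    (MvPolynomial.isHomogeneous_X_pow (R := ℂ) (0 : Fin 3) (d - k))
  rw [show k + (d - k) = d by have := Finset.mem_range.1 hk; omega] at h1
  exact h1.C_mul _

theorem eval_homogenise (p : Polynomial ℂ) (d : ℕ) (j : Fin 3) (v : Fin 3 → ℂ) :
    MvPolynomial.eval v (homogenise p d j) =
      ∑ k ∈ Finset.range (d + 1), p.coeff k * (v j ^ k * v 0 ^ (d - k)) := by
  simp [homogenise, map_sum]

theorem eval_homogenise_one {p : Polynomial ℂ} {d : ℕ} (hp : p.natDegree = d) {j : Fin 3}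
    {v : Fin 3 → ℂ} (hv : v 0 = 1) :
    MvPolynomial.eval v (homogenise p d j) = p.eval (v j) := by
  rw [eval_homogenise, Polynomial.eval_eq_sum_range, hp]
  simp [hv]

theorem eval_homogenise_zero {p : Polynomial ℂ} {d : ℕ} {j : Fin 3}
    {v : Fin 3 → ℂ} (hv : v 0 = 0) :
    MvPolynomial.eval v (homogenise p d j) = p.coeff d * v j ^ d := by
  rw [eval_homogenise, Finset.sum_range_succ, Finset.sum_eq_zero, zero_add]
  · simp
  · intro k hk
    have := Finset.mem_range.1 hk
    rw [hv, zero_pow (by omega), mul_zero, mul_zero]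

/-- On the line at infinity only the leading terms of p and q survive, the coupling term carrying
the factor X₀^(d-1) with d ≥ 2. Hence the lift has no non-trivial zero. -/
theorem exists_isAffineLift_skew {d : ℕ} (hd : 2 ≤ d) {p q : Polynomial ℂ}
    (hp : p.natDegree = d) (hq : q.natDegree = d) (s : ℂ) :
    ∃ G, IsAffineLift d G (skew p q s) := by
  have hlead : ∀ {p : Polynomial ℂ}, p.natDegree = d → p.coeff d ≠ 0 := by
    intro p hp
    rw [← hp]
    refine Polynomial.leadingCoeff_ne_zero.2 fun h0 => ?_
    rw [h0, Polynomial.natDegree_zero] at hp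
    omega
  have hlin : (MvPolynomial.C s * (MvPolynomial.X 2 * MvPolynomial.X 0 ^ (d - 1)) :
      MvPolynomial (Fin 3) ℂ).IsHomogeneous d := by
    have h1 := (MvPolynomial.isHomogeneous_X ℂ (2 : Fin 3)).mul
      (MvPolynomial.isHomogeneous_X_pow (R := ℂ) (0 : Fin 3) (d - 1))
    rw [show 1 + (d - 1) = d by omega] at h1
    exact h1.C_mul _
  refine ⟨![MvPolynomial.X 0 ^ d, homogenise p d 1 +
    MvPolynomial.C s * (MvPolynomial.X 2 * MvPolynomial.X 0 ^ (d - 1)), homogenise q d 2],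
    ⟨fun i => ?_, fun v hv => ?_⟩, fun x i => ?_⟩
  · fin_cases i
    · exact MvPolynomial.isHomogeneous_X_pow _ _
    · exact (isHomogeneous_homogenise p d 1).add hlin
    · exact isHomogeneous_homogenise q d 2
  · have h0 : v 0 = 0 := by
      have := hv 0
      simpa [show d ≠ 0 by omega] using this
    have h1 : v 1 = 0 := by
      have := hv 1
      simpa [eval_homogenise_zero h0, h0, show d ≠ 0 by omega, show d - 1 ≠ 0 by omega,
        hlead hp] using this
    have h2 : v 2 = 0 := by
      have := hv 2
      simpa [eval_homogenise_zero h0, show d ≠ 0 by omega, hlead hq] using this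
    funext i
    fin_cases i
    · exact h0
    · exact h1
    · exact h2
  · fin_cases i
    · simp [coord]
    · simpa [coord, skew, pmap] using eval_homogenise_one hp (j := 1) (v := ![1, x.1, x.2]) rfl
    · simpa [coord, skew, pmap] using eval_homogenise_one hq (j := 2) (v := ![1, x.1, x.2]) rfl

/-! ### Perturbation of the coefficients -/

theorem contDiff_coord (G : Fin 3 → MvPolynomial (Fin 3) ℂ) (i : Fin 3) :
    ContDiff ℂ 1 (coord G i) := by
  have : coord G i = fun x => ∑ m ∈ (G i).support,
      (G i).coeff m * (x.1 ^ m 1 * x.2 ^ m 2) := by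
    funext x
    rw [coord, MvPolynomial.eval_eq']
    simp [Fin.prod_univ_three]
  rw [this]
  fun_prop

theorem contDiffAt_affineMap {G : Fin 3 → MvPolynomial (Fin 3) ℂ} {x : ℂ × ℂ}
    (h : coord G 0 x ≠ 0) : ContDiffAt ℂ 1 (affineMap G) x :=
  ((contDiff_coord G 1).contDiffAt.div (contDiff_coord G 0).contDiffAt h).prodMk
    ((contDiff_coord G 2).contDiffAt.div (contDiff_coord G 0).contDiffAt h)

/-- A homogeneous polynomial with small coefficients is small on bounded sets. -/
theorem exists_norm_eval_le_of_coeff_le (D : ℕ) {W : ℝ} (hW : 1 ≤ W) :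
    ∃ N : ℝ, 0 < N ∧ ∀ (P : MvPolynomial (Fin 3) ℂ) (ε : ℝ), 0 ≤ ε → P.IsHomogeneous D →
      (∀ m, ‖P.coeff m‖ ≤ ε) → ∀ v : Fin 3 → ℂ, (∀ i, ‖v i‖ ≤ W) →
      ‖MvPolynomial.eval v P‖ ≤ N * ε := by
  classical
  set S := Finset.finsuppAntidiag (Finset.univ : Finset (Fin 3)) D with hS
  refine ⟨(S.card + 1) * W ^ D, by positivity, fun P ε hε hP hc v hv => ?_⟩
  have hsub : P.support ⊆ S := by
    intro m hm
    rw [hS, Finset.mem_finsuppAntidiag]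
    refine ⟨?_, Finset.subset_univ _⟩
    by_contra hne
    refine MvPolynomial.mem_support_iff.1 hm (hP.coeff_eq_zero ?_)
    rwa [Finsupp.degree_eq_sum]
  have hdeg : ∀ m ∈ P.support, ∑ i, m i = D := fun m hm =>
    (Finset.mem_finsuppAntidiag.1 (hsub hm)).1
  rw [MvPolynomial.eval_eq']
  have hW0 : 0 ≤ W := by linarith
  calc ‖∑ m ∈ P.support, P.coeff m * ∏ i, v i ^ m i‖
      ≤ ∑ m ∈ P.support, ε * W ^ D := by
        refine norm_sum_le_of_le _ fun m hm => ?_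
        rw [norm_mul, norm_prod, ← hdeg m hm, ← Finset.prod_pow_eq_pow_sum]
        refine mul_le_mul (hc m) (Finset.prod_le_prod (fun _ _ => norm_nonneg _) fun i _ => ?_)
          (Finset.prod_nonneg fun _ _ => norm_nonneg _) hε
        rw [norm_pow]
        exact pow_le_pow_left₀ (norm_nonneg _) (hv i) _
    _ = P.support.card * (ε * W ^ D) := by rw [Finset.sum_const, nsmul_eq_mul]
    _ ≤ (S.card + 1) * (ε * W ^ D) := by
        gcongr
        have : (P.support.card : ℝ) ≤ S.card := by exact_mod_cast Finset.card_le_card hsub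
        linarith
    _ = _ := by ring

/-- Cauchy's estimate for the derivative. -/
theorem norm_fderiv_le_of_forall_ball {E E' : Type*} [NormedAddCommGroup E] [NormedSpace ℂ E]
    [NormedAddCommGroup E'] [NormedSpace ℂ E'] {f : E → E'} {x : E} {ρ C : ℝ} (hρ : 0 < ρ)
    (hf : ∀ y ∈ ball x ρ, DifferentiableAt ℂ f y) (hC : ∀ y ∈ ball x ρ, ‖f y‖ ≤ C) :
    ‖fderiv ℂ f x‖ ≤ C / (ρ / 2) := by
  have hC0 : 0 ≤ C := (norm_nonneg _).trans (hC x (mem_ball_self hρ))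
  refine ContinuousLinearMap.opNorm_le_of_unit_norm (𝕜 := ℂ) (by positivity) fun v hv => ?_
  have hmem : ∀ t ∈ closedBall (0 : ℂ) (ρ / 2), x + t • v ∈ ball x ρ := by
    intro t ht
    have : ‖t‖ ≤ ρ / 2 := by simpa using ht
    rw [mem_ball, dist_self_add_left, norm_smul, hv, mul_one]
    linarith
  have hline : ∀ t : ℂ, HasDerivAt (fun t : ℂ => x + t • v) v t := fun t => by
    simpa using ((hasDerivAt_id t).smul_const v).const_add x
  have hda : ∀ t ∈ closedBall (0 : ℂ) (ρ / 2),
      HasDerivAt (fun t : ℂ => f (x + t • v)) (fderiv ℂ f (x + t • v) v) t := fun t ht =>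
    (hf _ (hmem t ht)).hasFDerivAt.comp_hasDerivAt t (hline t)
  have h0 := hda 0 (mem_closedBall_self (by positivity))
  rw [zero_smul, add_zero] at h0
  rw [← h0.deriv]
  refine Complex.norm_deriv_le_of_forall_mem_sphere_norm_le (by positivity) ?_ fun t ht =>
    hC _ (hmem t (sphere_subset_closedBall ht))
  refine DifferentiableOn.diffContOnCl fun t ht => ?_
  rw [closure_ball _ (by positivity : ρ / 2 ≠ 0)] at ht
  exact (hda t ht).differentiableAt.differentiableWithinAt

/-- Nearby coefficients give nearby coordinates on a ball containing the unit neighbourhood of K.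
There the zeroth coordinate stays near 1, so the quotients are close, and Cauchy's estimate controls
their derivatives. -/
theorem IsAffineLift.exists_close {D : ℕ} {G : Fin 3 → MvPolynomial (Fin 3) ℂ}
    {F : ℂ × ℂ → ℂ × ℂ} (h : IsAffineLift D G F) {K : Set (ℂ × ℂ)}
    (hK : Bornology.IsBounded K) {ε' : ℝ} (hε' : 0 < ε') :
    ∃ ε : ℝ, 0 < ε ∧ ∀ G' : Fin 3 → MvPolynomial (Fin 3) ℂ, IsEndoLift D G' →
      (∀ i m, ‖(G' i).coeff m - (G i).coeff m‖ < ε) → ∀ x ∈ K, coord G' 0 x ≠ 0 ∧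
        ‖affineMap G' x - F x‖ ≤ ε' ∧ ‖fderiv ℂ (affineMap G') x - fderiv ℂ F x‖ ≤ ε' := by
  have hFdiff : ∀ x, DifferentiableAt ℂ F x := fun x => by
    have h1 : coord G 0 x ≠ 0 := by rw [h.coord_zero]; exact one_ne_zero
    have h2 := (contDiffAt_affineMap h1).differentiableAt one_ne_zero
    rwa [h.affineMap_eq] at h2
  obtain ⟨W₀, hW₀⟩ := hK.subset_closedBall 0
  set W := max W₀ 0 + 1 with hW
  have hW1 : 1 ≤ W := by rw [hW]; linarith [le_max_right W₀ 0]
  have hball : ∀ x ∈ K, ∀ y ∈ ball x 1, y ∈ closedBall (0 : ℂ × ℂ) W := by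
    intro x hx y hy
    have h1 : dist x 0 ≤ W₀ := hW₀ hx
    have h2 : dist y x < 1 := hy
    have h3 := dist_triangle y x 0
    rw [mem_closedBall, hW]
    linarith [le_max_left W₀ 0]
  obtain ⟨B, hB⟩ := (isCompact_closedBall (0 : ℂ × ℂ) W).exists_bound_of_continuousOn
    (continuous_iff_continuousAt.2 fun x => (hFdiff x).continuousAt).continuousOn
  have hB0 : 0 ≤ B := (norm_nonneg _).trans (hB 0 (mem_closedBall_self (by linarith)))
  obtain ⟨N, hN, hNb⟩ := exists_norm_eval_le_of_coeff_le D hW1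
  set θ := min (1 / 2) (ε' / (4 * (1 + B))) with hθ
  have hθ0 : 0 < θ := by positivity
  have hθ1 : θ ≤ 1 / 2 := min_le_left _ _
  have hθ2 : θ * (4 * (1 + B)) ≤ ε' := by
    rw [← le_div_iff₀ (by positivity)]; exact min_le_right _ _
  refine ⟨θ / N, by positivity, fun G' hG' hc => ?_⟩
  have hcoord : ∀ y ∈ closedBall (0 : ℂ × ℂ) W, ∀ i, ‖coord G' i y - coord G i y‖ ≤ θ := by
    intro y hy i
    have hy' : ‖y‖ ≤ W := by simpa using hy
    have h1 := hNb (G' i - G i) (θ / N) (by positivity)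
      ((hG'.homogeneous i).sub (h.isEndoLift.homogeneous i))
      (fun m => by rw [MvPolynomial.coeff_sub]; exact (hc i m).le) ![1, y.1, y.2] (fun j => by
        fin_cases j
        · simpa using hW1
        · exact (norm_fst_le y).trans hy'
        · exact (norm_snd_le y).trans hy')
    rw [map_sub, mul_div_cancel₀ _ hN.ne'] at h1
    exact h1
  have hden : ∀ y ∈ closedBall (0 : ℂ × ℂ) W, 1 / 2 ≤ ‖coord G' 0 y‖ := by
    intro y hy
    have h1 := hcoord y hy 0
    rw [h.coord_zero] at h1
    have h2 := norm_sub_norm_le (1 : ℂ) (coord G' 0 y)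
    rw [norm_one, norm_sub_rev] at h2
    linarith
  have hne : ∀ y ∈ closedBall (0 : ℂ × ℂ) W, coord G' 0 y ≠ 0 := fun y hy =>
    norm_pos_iff.1 (by linarith [hden y hy])
  have hclose : ∀ y ∈ closedBall (0 : ℂ × ℂ) W, ‖affineMap G' y - F y‖ ≤ ε' / 2 := by
    intro y hy
    have hcomp : ∀ (i : Fin 3) (f : ℂ), coord G i y = f → ‖f‖ ≤ B →
        ‖coord G' i y / coord G' 0 y - f‖ ≤ ε' / 2 := by
      intro i f hf hfB
      have h1 := hcoord y hy i
      have h2 := hcoord y hy 0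
      rw [h.coord_zero] at h2
      rw [hf] at h1
      have e : coord G' i y / coord G' 0 y - f =
          ((coord G' i y - f) - f * (coord G' 0 y - 1)) / coord G' 0 y := by
        have := hne y hy
        field_simp; ring
      have h3 : ‖(coord G' i y - f) - f * (coord G' 0 y - 1)‖ ≤ θ * (1 + B) := by
        refine (norm_sub_le _ _).trans ?_
        rw [norm_mul]
        have : ‖f‖ * ‖coord G' 0 y - 1‖ ≤ B * θ := by gcongr
        linarith
      rw [e, norm_div, div_le_iff₀ (by linarith [hden y hy])]
      nlinarith [hden y hy]
    have hFy := hB y hy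
    exact max_le (hcomp 1 _ (h.coord_eq y 1) ((norm_fst_le _).trans hFy))
      (hcomp 2 _ (h.coord_eq y 2) ((norm_snd_le _).trans hFy))
  intro x hx
  have hxW := hball x hx x (mem_ball_self one_pos)
  have hd' : ∀ y ∈ closedBall (0 : ℂ × ℂ) W, DifferentiableAt ℂ (affineMap G') y := fun y hy =>
    (contDiffAt_affineMap (hne y hy)).differentiableAt one_ne_zero
  refine ⟨hne x hxW, (hclose x hxW).trans (by linarith), ?_⟩
  rw [← fderiv_sub (hd' x hxW) (hFdiff x)]
  have h1 := norm_fderiv_le_of_forall_ball (f := affineMap G' - F) (x := x) (C := ε' / 2) one_pos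
    (fun y hy => (hd' y (hball x hx y hy)).sub (hFdiff y))
    (fun y hy => hclose y (hball x hx y hy))
  exact h1.trans (by linarith)

theorem IsAffineLift.isSaddleBlender {D : ℕ} {G : Fin 3 → MvPolynomial (Fin 3) ℂ}
    {F : ℂ × ℂ → ℂ × ℂ} (h : IsAffineLift D G F) {Z : Set (ℂ × ℂ)} (hZ : IsOpen Z)
    (hZn : Z.Nonempty) (hZc : IsCompact (closure Z)) (hcov : closure Z ⊆ F '' Z)
    {ε' : ℝ} (hε' : 0 < ε') (hsad : ∀ g : ℂ × ℂ → ℂ × ℂ,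
      (∀ x ∈ closure Z, DifferentiableAt ℂ g x ∧ ‖g x - F x‖ ≤ ε' ∧
        ‖fderiv ℂ g x - fderiv ℂ F x‖ ≤ ε') →
      ContinuousOn (fderiv ℂ g) (closure Z) → IsHyperbolicSet g (staySet g Z) 1) :
    IsSaddleBlender D F (staySet F Z) := by
  obtain ⟨ε, hε, hclose⟩ := h.exists_close hZc.isBounded hε'
  refine ⟨G, Z, h.isEndoLift, fun x => ⟨by rw [h.coord_zero]; exact one_ne_zero,
    by rw [h.affineMap_eq]⟩, hZ, hZn, hZc.isBounded.subset subset_closure, hcov, rfl, ε, hε,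
    fun G' hG' hc => ?_⟩
  have hx := hclose G' hG' hc
  -- For G' close to G the zeroth coordinate has no zero on the closure of Z, so the condition of
  -- remaining in the chart is automatic.
  have heq : projStaySet G' Z = staySet (affineMap G') Z := by
    ext x
    exact ⟨fun hx n => (hx n).1, fun hs n => ⟨hs n, (hx _ (hs n)).1⟩⟩
  rw [heq]
  refine hsad _ (fun x hxZ => ?_) fun x hxZ => ?_
  · obtain ⟨h1, h2, h3⟩ := hx x hxZ
    exact ⟨(contDiffAt_affineMap h1).differentiableAt one_ne_zero, h2, h3⟩
  · have h1 := contDiffAt_affineMap (hx x hxZ).1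
    exact (h1.fderiv_right (m := 0) (by norm_num)).continuousAt.continuousWithinAt

/-! ### Linearisation of the iterates of a skew product -/

theorem multiplier_add (p : Polynomial ℂ) (a b : ℕ) (x : ℂ) :
    multiplier p (a + b) x = multiplier p a ((pmap p)^[b] x) * multiplier p b x :=
  deriv_iterate_add p.differentiable a b x

theorem multiplier_zero (p : Polynomial ℂ) (x : ℂ) : multiplier p 0 x = 1 := by
  simp [multiplier]

theorem multiplier_one (p : Polynomial ℂ) (x : ℂ) : multiplier p 1 x = p.derivative.eval x := by
  simp only [multiplier, Function.iterate_one]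
  exact Polynomial.deriv p

theorem multiplier_succ (p : Polynomial ℂ) (k : ℕ) (x : ℂ) :
    multiplier p (k + 1) x = p.derivative.eval ((pmap p)^[k] x) * multiplier p k x := by
  rw [add_comm, multiplier_add, multiplier_one]

theorem multiplier_mul (p : Polynomial ℂ) {m : ℕ} {x : ℂ} (h : (pmap p)^[m] x = x) (l : ℕ) :
    multiplier p (m * l) x = multiplier p m x ^ l := by
  induction l with
  | zero => simp [multiplier_zero]
  | succ l ih => rw [Nat.mul_succ, multiplier_add, h, ih, pow_succ]

theorem cValue_zero (p q : Polynomial ℂ) (w : ℂ) : cValue p q 0 w = 0 := by simp [cValue]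

/-- This is the chain rule: `cValue p q k w` is the coefficient of s at z = s = 0 in the first
coordinate of the k-th iterate of the skew product. -/
theorem cValue_succ (p q : Polynomial ℂ) (k : ℕ) (w : ℂ) :
    cValue p q (k + 1) w =
      p.derivative.eval ((pmap p)^[k] 0) * cValue p q k w + (pmap q)^[k] w := by
  rw [cValue, cValue, Finset.sum_range_succ, Finset.mul_sum]
  congr 1
  · refine Finset.sum_congr rfl fun i hi => ?_
    have hi' := Finset.mem_range.1 hi
    rw [← mul_assoc]
    congr 1
    rw [bCoeff, bCoeff, show k + 1 - (i + 1) = (k - (i + 1)) + 1 by omega, multiplier_succ,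
      ← Function.iterate_add_apply, show k - (i + 1) + (i + 1) = k by omega]
  · rw [bCoeff, Nat.sub_self, multiplier_zero, one_mul]

theorem cValue_add {p : Polynomial ℂ} (q : Polynomial ℂ) {m : ℕ} (h : (pmap p)^[m] 0 = 0) (k : ℕ)
    (w : ℂ) : cValue p q (m + k) w =
      multiplier p k 0 * cValue p q m w + cValue p q k ((pmap q)^[m] w) := by
  induction k with
  | zero => simp [multiplier_zero, cValue_zero]
  | succ k ih =>
    rw [← add_assoc, cValue_succ, ih, cValue_succ, multiplier_succ, ← Function.iterate_add_apply,
      add_comm m k, Function.iterate_add_apply _ k m, h]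
    ring

/-- Each turn around the cycle of 0 multiplies the earlier contributions by the multiplier; the
geometric sum τ of the model originates here. -/
theorem cValue_mul {p : Polynomial ℂ} (q : Polynomial ℂ) {m : ℕ} (h : (pmap p)^[m] 0 = 0) (l : ℕ)
    (w : ℂ) : cValue p q (m * l) w = ∑ t ∈ Finset.range l,
      multiplier p m 0 ^ (l - 1 - t) * cValue p q m (((pmap q)^[m])^[t] w) := by
  induction l generalizing w with
  | zero => simp [cValue_zero]
  | succ l ih =>
    rw [Nat.mul_succ, add_comm (m * l) m, cValue_add q h, multiplier_mul p h, ih,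
      Finset.sum_range_succ', add_comm]
    congr 1
    refine Finset.sum_congr rfl fun t ht => ?_
    rw [Function.iterate_succ_apply, show l + 1 - 1 - (t + 1) = l - 1 - t by omega]

theorem differentiable_cValue (p q : Polynomial ℂ) (m : ℕ) :
    Differentiable ℂ (cValue p q m) := by
  unfold cValue
  exact Differentiable.fun_sum fun i _ => (differentiable_pmap_iterate q i).const_mul _

theorem deriv_cValue (p q : Polynomial ℂ) (m : ℕ) (w : ℂ) :
    deriv (cValue p q m) w = ∑ i ∈ Finset.range m, bCoeff p m i * deriv (pmap q)^[i] w := by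
  unfold cValue
  rw [deriv_fun_sum fun i _ => ((differentiable_pmap_iterate q i).const_mul _) w]
  exact Finset.sum_congr rfl fun i _ => deriv_const_mul _ (differentiable_pmap_iterate q i w)

theorem contDiff_skew (p q : Polynomial ℂ) (s : ℂ) : ContDiff ℂ 1 (skew p q s) := by
  have hp : ContDiff ℂ 1 (pmap p) := p.differentiable.contDiff
  have hq : ContDiff ℂ 1 (pmap q) := q.differentiable.contDiff
  exact ((hp.comp contDiff_fst).add (contDiff_const.mul contDiff_snd)).prodMk
    (hq.comp contDiff_snd)

theorem contDiff_skew_iterate (p q : Polynomial ℂ) (s : ℂ) (k : ℕ) :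
    ContDiff ℂ 1 (skew p q s)^[k] := by
  induction k with
  | zero => exact contDiff_id
  | succ k ih =>
    rw [Function.iterate_succ']
    exact (contDiff_skew p q s).comp ih

theorem skew_iterate_snd (p q : Polynomial ℂ) (s : ℂ) (k : ℕ) (x : ℂ × ℂ) :
    ((skew p q s)^[k] x).2 = (pmap q)^[k] x.2 := by
  induction k with
  | zero => rfl
  | succ k ih => rw [Function.iterate_succ_apply', Function.iterate_succ_apply', ← ih]; rfl

/-- First-order Taylor expansion in (z, s) at the origin, uniform for bounded w, by induction: the
new error is the quadratic remainder of p plus the old error times a derivative. -/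
theorem exists_norm_skew_iterate_sub_le (p q : Polynomial ℂ) (W : ℝ) (k : ℕ) :
    ∃ C : ℝ, 0 < C ∧ ∀ s z w : ℂ, ‖s‖ ≤ 1 → ‖z‖ ≤ 1 → ‖w‖ ≤ W →
      ‖((skew p q s)^[k] (z, w)).1 -
        ((pmap p)^[k] 0 + multiplier p k 0 * z + s * cValue p q k w)‖ ≤
          C * (‖z‖ + ‖s‖) ^ 2 := by
  induction k with
  | zero =>
    refine ⟨1, one_pos, fun s z w _ _ _ => ?_⟩
    simp only [Function.iterate_zero, id_eq, multiplier_zero, cValue_zero, one_mul, zero_add,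
      mul_zero, add_zero, sub_self, norm_zero]
    positivity
  | succ k ih =>
    obtain ⟨C, hC, ih⟩ := ih
    obtain ⟨B, hB⟩ := (isCompact_closedBall (0 : ℂ) W).exists_bound_of_continuousOn
      (differentiable_cValue p q k).continuous.continuousOn
    set N := ‖multiplier p k 0‖ + max B 0 + 2 * C with hN
    have hN0 : 0 ≤ N := by positivity
    obtain ⟨C', hC', hrem⟩ := exists_quadratic_remainder p ((pmap p)^[k] 0) (2 * N)
    refine ⟨C' * N ^ 2 + ‖p.derivative.eval ((pmap p)^[k] 0)‖ * C, by positivity,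
      fun s z w hs hz hw => ?_⟩
    have h1 := ih s z w hs hz hw
    set x := (pmap p)^[k] 0 with hx
    set h := ((skew p q s)^[k] (z, w)).1 with hh
    set E := h - (x + multiplier p k 0 * z + s * cValue p q k w) with hE
    set t := ‖z‖ + ‖s‖ with ht
    have ht0 : 0 ≤ t := by positivity
    have ht2 : t ≤ 2 := by linarith
    have hBw : ‖cValue p q k w‖ ≤ max B 0 := (hB w (by simpa using hw)).trans (le_max_left _ _)
    have hy : ‖h - x‖ ≤ N * t := by
      have e : h - x = E + multiplier p k 0 * z + s * cValue p q k w := by rw [hE]; ring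
      rw [e]
      refine (norm_add₃_le).trans ?_
      rw [norm_mul, norm_mul]
      have h2 : ‖multiplier p k 0‖ * ‖z‖ ≤ ‖multiplier p k 0‖ * t := by
        gcongr; rw [ht]; linarith [norm_nonneg s]
      have h3 : ‖s‖ * ‖cValue p q k w‖ ≤ t * max B 0 := by
        gcongr; rw [ht]; linarith [norm_nonneg z]
      have h4 : C * t ^ 2 ≤ 2 * C * t := by nlinarith [mul_nonneg hC.le ht0]
      rw [hN]; linarith
    have hy2 : ‖h - x‖ ≤ 2 * N := hy.trans (by nlinarith)
    have h5 := hrem (h - x) hy2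
    rw [add_sub_cancel] at h5
    have e : ((skew p q s)^[k + 1] (z, w)).1 - ((pmap p)^[k + 1] 0 + multiplier p (k + 1) 0 * z +
        s * cValue p q (k + 1) w) = (p.eval h - p.eval x - p.derivative.eval x * (h - x)) +
          p.derivative.eval x * E := by
      have e1 : ((skew p q s)^[k + 1] (z, w)).1 = p.eval h + s * (pmap q)^[k] w := by
        rw [Function.iterate_succ_apply', skew, skew_iterate_snd]; rfl
      rw [e1, multiplier_succ, cValue_succ, pmap_iterate_succ', hE]
      ring
    rw [e]
    refine (norm_add_le _ _).trans ?_
    rw [norm_mul]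
    have h6 : C' * ‖h - x‖ ^ 2 ≤ C' * (N * t) ^ 2 := by gcongr
    have h7 : ‖p.derivative.eval x‖ * ‖E‖ ≤ ‖p.derivative.eval x‖ * (C * t ^ 2) := by gcongr
    calc _ ≤ C' * (N * t) ^ 2 + ‖p.derivative.eval x‖ * (C * t ^ 2) := by linarith
      _ = _ := by ring

theorem norm_deriv_le_of_forall_closedBall {f : ℂ → ℂ} (hf : Differentiable ℂ f) {x : ℂ} {ρ C : ℝ}
    (hρ : 0 < ρ) (hC : ∀ y, ‖y - x‖ ≤ ρ → ‖f y‖ ≤ C) : ‖deriv f x‖ ≤ C / ρ :=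
  Complex.norm_deriv_le_of_forall_mem_sphere_norm_le hρ hf.diffContOnCl fun y hy =>
    hC y (mem_sphere_iff_norm.1 hy).le

/-- A uniform bound for the derivative of `cValue` in terms of its coefficients. -/
theorem exists_norm_deriv_cValue_le (q : Polynomial ℂ) (m : ℕ) (W : ℝ) :
    ∃ K : ℝ, 0 < K ∧ ∀ (p : Polynomial ℂ) (M : ℝ), (∀ i < m, ‖bCoeff p m i‖ ≤ M) →
      0 ≤ M → ∀ w ∈ closedBall (0 : ℂ) W, ‖deriv (cValue p q m) w‖ ≤ M * K := by
  obtain ⟨B, hB⟩ := (isCompact_closedBall (0 : ℂ) W).exists_bound_of_continuousOn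
    (f := fun w => ∑ i ∈ Finset.range m, ‖deriv (pmap q)^[i] w‖)
    (continuous_finsetSum _ fun i _ => (continuous_deriv_of_differentiable
      (differentiable_pmap_iterate q i)).norm).continuousOn
  refine ⟨max B 1, by positivity, fun p M hM hM0 w hw => ?_⟩
  rw [deriv_cValue]
  have h1 := (le_abs_self _).trans (hB w hw)
  calc ‖∑ i ∈ Finset.range m, bCoeff p m i * deriv (pmap q)^[i] w‖
      ≤ ∑ i ∈ Finset.range m, M * ‖deriv (pmap q)^[i] w‖ := by
        refine norm_sum_le_of_le _ fun i hi => ?_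
        rw [norm_mul]
        gcongr
        exact hM i (Finset.mem_range.1 hi)
    _ = M * ∑ i ∈ Finset.range m, ‖deriv (pmap q)^[i] w‖ := by rw [Finset.mul_sum]
    _ ≤ M * max B 1 := by gcongr; exact h1.trans (le_max_left _ _)

set_option maxHeartbeats 1000000 in
/-- The iterates of a skew product with weak coupling are close to a model system. -/
theorem exists_isModelSystem (q : Polynomial ℂ) (m : ℕ) (r c : Fin 3 → ℂ) {C M R ε : ℝ}
    (hC : 0 < C) (hM : 0 < M) (hR : 0 < R) (hε : 0 < ε) :
    ∃ T ν : ℝ, 0 < T ∧ 0 < ν ∧ ∀ {p : Polynomial ℂ} {l : ℕ} {V : Fin 3 → Set ℂ}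
      {ψ : Fin 3 → Fin 3 → ℂ → ℂ} {η : ℝ}, IsBaseSystem (pmap q)^[m] l r V ψ η C →
      (pmap p)^[m] 0 = 0 → (∀ i < m, ‖bCoeff p m i‖ ≤ M) →
      (∀ i, ‖cValue p q m (r i) - c i‖ ≤ ν) → (∀ j < l, ‖multiplier p m 0 ^ j‖ ≤ 2) →
      T ≤ ‖∑ t ∈ Finset.range l, multiplier p m 0 ^ t‖ →
      ∃ s₀ : ℝ, 0 < s₀ ∧ ∀ s : ℂ, ‖s‖ < s₀ → s ≠ 0 →
        IsModelSystem (pmap q)^[m] l V c (multiplier p m 0 ^ l)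
          (s * ∑ t ∈ Finset.range l, multiplier p m 0 ^ t) R ε (skew p q s)^[m * l] := by
  set W := C + ∑ i, ‖r i‖ with hW
  have hrW : ∀ i, ‖r i‖ + C ≤ W := fun i => by
    rw [hW]
    linarith [Finset.single_le_sum (f := fun i => ‖r i‖) (fun _ _ => norm_nonneg _)
      (Finset.mem_univ i)]
  obtain ⟨K, hK, hKb⟩ := exists_norm_deriv_cValue_le q m W
  -- With this T, the total error 2MKC caused by the distances between Q^t w and r_i is at most
  -- (ε/4)‖τ‖.
  refine ⟨8 * M * K * C / ε + 1, ε / 4, by positivity, by positivity, ?_⟩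
  intro p l V ψ η hbase hper hMb hcν hpow hT
  set μ := multiplier p m 0 with hμ
  set τ := ∑ t ∈ Finset.range l, μ ^ t with hτ
  have hτ0 : 0 < ‖τ‖ := lt_of_lt_of_le (by positivity) hT
  have hMKC : 2 * (M * K) * C ≤ ε / 4 * ‖τ‖ := by
    have h1 : 8 * M * K * C / ε ≤ ‖τ‖ := by linarith
    rw [div_le_iff₀ hε] at h1
    linarith
  set Q := (pmap q)^[m] with hQ
  have hQd : Differentiable ℂ Q := differentiable_pmap_iterate q m
  set B := cValue p q (m * l) with hB
  have hBd : Differentiable ℂ B := differentiable_cValue p q (m * l)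
  have hl : 0 < l := by
    rcases Nat.eq_zero_or_pos l with h | h
    · rw [hτ, h] at hτ0; simp at hτ0
    · exact h
  have hdist : ∀ i, ∀ w ∈ V i, ∀ t < l, ‖Q^[t] w - r i‖ ≤ C := fun i w hw t ht =>
    (Finset.single_le_sum (f := fun t => ‖Q^[t] w - r i‖) (fun _ _ => norm_nonneg _)
      (Finset.mem_range.2 ht)).trans (hbase.sum_dist i w hw)
  have hinW : ∀ i, ∀ y : ℂ, ‖y - r i‖ ≤ C → y ∈ closedBall (0 : ℂ) W := by
    intro i y hy
    rw [mem_closedBall_zero_iff]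
    have := norm_sub_norm_le y (r i)
    linarith [hrW i]
  have hpow' : ∀ t, ‖μ ^ (l - 1 - t)‖ ≤ 2 := fun t => hpow _ (by omega)
  have hlip : ∀ i, ∀ y : ℂ, ‖y - r i‖ ≤ C →
      ‖cValue p q m y - cValue p q m (r i)‖ ≤ M * K * ‖y - r i‖ := fun i y hy =>
    (convex_closedBall (0 : ℂ) W).norm_image_sub_le_of_norm_deriv_le
      (fun x _ => differentiable_cValue p q m x) (fun x hx => hKb p M hMb hM.le x hx)
      (hinW i (r i) (by simpa using hC.le)) (hinW i y hy)
  -- In the weighted sum Q^t w is replaced by r_i, at the cost of a Lipschitz constant times the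
  -- summed distances, and then the value at r_i by c_i.
  have hBval : ∀ i, ∀ w ∈ V i, ‖B w - τ * c i‖ ≤ ε / 2 * ‖τ‖ := by
    intro i w hw
    have e : B w - τ * c i = (∑ t ∈ Finset.range l, μ ^ (l - 1 - t) *
        (cValue p q m (Q^[t] w) - cValue p q m (r i))) + τ * (cValue p q m (r i) - c i) := by
      have e1 : τ = ∑ t ∈ Finset.range l, μ ^ (l - 1 - t) :=
        (Finset.sum_range_reflect (fun t => μ ^ t) l).symm
      rw [hB, cValue_mul q hper, mul_sub τ, e1]
      simp only [mul_sub, Finset.sum_sub_distrib, Finset.sum_mul]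
      ring
    rw [e]
    refine (norm_add_le _ _).trans ?_
    have h1 : ‖∑ t ∈ Finset.range l, μ ^ (l - 1 - t) *
        (cValue p q m (Q^[t] w) - cValue p q m (r i))‖ ≤
        ∑ t ∈ Finset.range l, 2 * (M * K) * ‖Q^[t] w - r i‖ := by
      refine norm_sum_le_of_le _ fun t ht => ?_
      rw [norm_mul, mul_assoc]
      exact mul_le_mul (hpow' t) (hlip i _ (hdist i w hw t (Finset.mem_range.1 ht)))
        (norm_nonneg _) zero_le_two
    rw [← Finset.mul_sum] at h1
    have h2 : 2 * (M * K) * ∑ t ∈ Finset.range l, ‖Q^[t] w - r i‖ ≤ 2 * (M * K) * C := by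
      gcongr; exact hbase.sum_dist i w hw
    have h3 : ‖τ * (cValue p q m (r i) - c i)‖ ≤ ‖τ‖ * (ε / 4) := by
      rw [norm_mul]; gcongr; exact hcν i
    linarith
  have hBder : ∀ i, ∀ w ∈ V i, ‖deriv B w‖ ≤ ε / 4 * ‖τ‖ * ‖deriv Q^[l] w‖ := by
    intro i w hw
    have hd : ∀ t, HasDerivAt (fun w => μ ^ (l - 1 - t) * cValue p q m (Q^[t] w))
        (μ ^ (l - 1 - t) * (deriv (cValue p q m) (Q^[t] w) * deriv Q^[t] w)) w := fun t =>
      (((differentiable_cValue p q m) _).hasDerivAt.comp w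
        (hQd.iterate t w).hasDerivAt).const_mul _
    have e : deriv B w = ∑ t ∈ Finset.range l,
        μ ^ (l - 1 - t) * (deriv (cValue p q m) (Q^[t] w) * deriv Q^[t] w) := by
      have e1 : B = fun w => ∑ t ∈ Finset.range l, μ ^ (l - 1 - t) * cValue p q m (Q^[t] w) :=
        funext fun w => cValue_mul q hper l w
      rw [e1]
      exact (HasDerivAt.fun_sum fun t _ => hd t).deriv
    have h1 : ‖deriv B w‖ ≤ ∑ t ∈ Finset.range l, 2 * (M * K) * ‖deriv Q^[t] w‖ := by
      rw [e]
      refine norm_sum_le_of_le _ fun t ht => ?_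
      rw [norm_mul, norm_mul, mul_assoc 2]
      have := hKb p M hMb hM.le _ (hinW i _ (hdist i w hw t (Finset.mem_range.1 ht)))
      exact mul_le_mul (hpow' t) (by gcongr) (by positivity) zero_le_two
    rw [← Finset.mul_sum] at h1
    have h2 : 2 * (M * K) * ∑ t ∈ Finset.range l, ‖deriv Q^[t] w‖ ≤
        2 * (M * K) * (C * ‖deriv Q^[l] w‖) := by
      gcongr; exact hbase.sum_deriv i w hw
    have h3 : 2 * (M * K) * C * ‖deriv Q^[l] w‖ ≤ ε / 4 * ‖τ‖ * ‖deriv Q^[l] w‖ := by gcongr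
    linarith
  obtain ⟨C₀, hC₀, herr⟩ := exists_norm_skew_iterate_sub_le p q (W + 1) (m * l)
  have hper' : (pmap p)^[m * l] 0 = 0 := by
    rw [Function.iterate_mul]; exact Function.iterate_fixed hper l
  rw [hper', multiplier_mul p hper] at herr
  set A := μ ^ l with hA
  set N := 2 * R * ‖τ‖ + 1 with hN
  have hN0 : 0 < N := by positivity
  -- The threshold depends on p and l through τ and C₀: it makes the quadratic error C₀(N‖s‖)² small
  -- against ‖sτ‖, for the values and for both derivatives.
  set s₀ := min (min 1 (1 / (2 * R * ‖τ‖)))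
    (min (ε / 2 * ‖τ‖ / (C₀ * N ^ 2)) (ε * R * ‖τ‖ / (C₀ * N ^ 2))) with hs₀
  refine ⟨s₀, by positivity, fun s hs hs0 => ?_⟩
  have hsp : 0 < ‖s‖ := norm_pos_iff.2 hs0
  have b1 : ‖s‖ ≤ 1 := hs.le.trans ((min_le_left _ _).trans (min_le_left _ _))
  have b2 : ‖s‖ * (2 * R * ‖τ‖) ≤ 1 := by
    rw [← le_div_iff₀ (by positivity)]
    exact hs.le.trans ((min_le_left _ _).trans (min_le_right _ _))
  have b3 : ‖s‖ * (C₀ * N ^ 2) ≤ ε / 2 * ‖τ‖ := by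
    rw [← le_div_iff₀ (by positivity)]
    exact hs.le.trans ((min_le_right _ _).trans (min_le_left _ _))
  have b4 : ‖s‖ * (C₀ * N ^ 2) ≤ ε * R * ‖τ‖ := by
    rw [← le_div_iff₀ (by positivity)]
    exact hs.le.trans ((min_le_right _ _).trans (min_le_right _ _))
  set F := (skew p q s)^[m * l] with hF
  have hFc : ContDiff ℂ 1 F := contDiff_skew_iterate p q s (m * l)
  have hFd : Differentiable ℂ F := hFc.differentiable one_ne_zero
  set e := C₀ * (N * ‖s‖) ^ 2 with he
  -- The estimate is taken on twice the disc in z and on radius W + 1 in w, so that Cauchy's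
  -- inequality bounds the derivatives on the actual domain.
  have hE : ∀ z w : ℂ, ‖z‖ ≤ 2 * (R * ‖s * τ‖) → ‖w‖ ≤ W + 1 →
      ‖(F (z, w)).1 - (A * z + s * B w)‖ ≤ e := by
    intro z w hz hw
    rw [norm_mul] at hz
    have h1 := herr s z w b1 (by linarith) hw
    rw [zero_add] at h1
    refine h1.trans ?_
    rw [he]
    gcongr
    rw [hN]; linarith
  have hder1 : ∀ z w : ℂ, HasDerivAt (fun z => (F (z, w)).1) (fderiv ℂ F (z, w) (1, 0)).1 z := by
    intro z w
    have h1 : HasDerivAt (fun z : ℂ => ((z, w) : ℂ × ℂ)) (1, 0) z :=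
      (hasDerivAt_id z).prodMk (hasDerivAt_const z w)
    exact hasDerivAt_fst_comp ((hFd (z, w)).hasFDerivAt.comp_hasDerivAt z h1)
  have hder2 : ∀ z w : ℂ, HasDerivAt (fun w => (F (z, w)).1) (fderiv ℂ F (z, w) (0, 1)).1 w := by
    intro z w
    have h1 : HasDerivAt (fun w : ℂ => ((z, w) : ℂ × ℂ)) (0, 1) w :=
      (hasDerivAt_const w z).prodMk (hasDerivAt_id w)
    exact hasDerivAt_fst_comp ((hFd (z, w)).hasFDerivAt.comp_hasDerivAt w h1)
  have hsτ : 0 < R * ‖s * τ‖ := by rw [norm_mul]; positivity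
  have hwW : ∀ i, ∀ w ∈ V i, ‖w‖ ≤ W := fun i w hw => by
    simpa using hinW i w (hdist i w hw 0 hl)
  refine
    { contDiff := hFc
      skew := fun x => ?_
      value := fun i w hw z hz => ?_
      deriv_fst := fun i w hw z hz => ?_
      deriv_snd := fun i w hw z hz => ?_ }
  · rw [hF, skew_iterate_snd, hQ, Function.iterate_mul]
  · have h1 := hE z w (by linarith) ((hwW i w hw).trans (by linarith))
    have e1 : (F (z, w)).1 - (A * z + s * τ * c i) =
        ((F (z, w)).1 - (A * z + s * B w)) + s * (B w - τ * c i) := by ring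
    rw [e1]
    refine (norm_add_le _ _).trans ?_
    rw [norm_mul, norm_mul]
    have h2 : ‖s‖ * ‖B w - τ * c i‖ ≤ ‖s‖ * (ε / 2 * ‖τ‖) := by gcongr; exact hBval i w hw
    have h3 : e ≤ ε / 2 * ‖τ‖ * ‖s‖ := by
      calc e = ‖s‖ * (C₀ * N ^ 2) * ‖s‖ := by rw [he]; ring
        _ ≤ _ := by gcongr
    linarith
  · have hd1 : ∀ z, HasDerivAt (fun z => (F (z, w)).1 - (A * z + s * B w))
        ((fderiv ℂ F (z, w) (1, 0)).1 - A) z := fun z => by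
      have h1 := (hder1 z w).sub (((hasDerivAt_id z).const_mul A).add_const (s * B w))
      rw [mul_one] at h1
      exact h1
    rw [← (hd1 z).deriv]
    refine (norm_deriv_le_of_forall_closedBall (fun z => (hd1 z).differentiableAt) hsτ
      (C := e) fun y hy => hE y w ?_ ((hwW i w hw).trans (by linarith))).trans ?_
    · have := norm_sub_norm_le y z
      linarith
    · rw [div_le_iff₀ hsτ, norm_mul]
      calc e = ‖s‖ * (C₀ * N ^ 2) * ‖s‖ := by rw [he]; ring
        _ ≤ ε * R * ‖τ‖ * ‖s‖ := by gcongr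
        _ = _ := by ring
  · have hd2 : ∀ w, HasDerivAt (fun w => (F (z, w)).1 - (A * z + s * B w))
        ((fderiv ℂ F (z, w) (0, 1)).1 - s * deriv B w) w := fun w =>
      (hder2 z w).sub (((hBd w).hasDerivAt.const_mul s).const_add (A * z))
    have h1 := norm_deriv_le_of_forall_closedBall (x := w) (fun w => (hd2 w).differentiableAt)
      one_pos (C := e) fun y hy => hE z y (by linarith) (by
        have := norm_sub_norm_le y w
        linarith [hwW i w hw])
    rw [(hd2 w).deriv, div_one] at h1
    have h2 := norm_sub_norm_le (fderiv ℂ F (z, w) (0, 1)).1 (s * deriv B w)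
    rw [norm_mul] at h2
    have h3 : ‖s‖ * ‖deriv B w‖ ≤ ‖s‖ * (ε / 4 * ‖τ‖ * ‖deriv Q^[l] w‖) := by
      gcongr; exact hBder i w hw
    have h4 : e ≤ ε / 2 * ‖τ‖ * ‖s‖ := by
      calc e = ‖s‖ * (C₀ * N ^ 2) * ‖s‖ := by rw [he]; ring
        _ ≤ _ := by gcongr
    have h5 : ε / 2 * ‖τ‖ * ‖s‖ * 4 ≤ ε / 2 * ‖τ‖ * ‖s‖ * ‖deriv Q^[l] w‖ := by
      gcongr; exact hbase.four_le i w hw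
    have h6 : 0 ≤ ε * ‖τ‖ * ‖s‖ * ‖deriv Q^[l] w‖ := by positivity
    rw [norm_mul]
    have h7 : 0 ≤ ε / 2 * ‖τ‖ * ‖s‖ := by positivity
    linarith

/-! ### Convergence of polynomials and of their orbits -/

section Convergence

variable {d : ℕ} {p : ℕ → Polynomial ℂ} {p₀ : Polynomial ℂ}

theorem tendsto_eval_of_coeff (hdeg : ∀ n, (p n).natDegree ≤ d) (hdeg₀ : p₀.natDegree ≤ d)
    (hcoeff : ∀ k, Tendsto (fun n => (p n).coeff k) atTop (𝓝 (p₀.coeff k)))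
    {x : ℕ → ℂ} {x₀ : ℂ} (hx : Tendsto x atTop (𝓝 x₀)) :
    Tendsto (fun n => (p n).eval (x n)) atTop (𝓝 (p₀.eval x₀)) := by
  rw [Polynomial.eval_eq_sum_range' (Nat.lt_succ_of_le hdeg₀)]
  simp_rw [fun n => Polynomial.eval_eq_sum_range' (Nat.lt_succ_of_le (hdeg n)) (x n)]
  exact tendsto_finsetSum _ fun k _ => (hcoeff k).mul (hx.pow k)

theorem tendsto_eval_derivative_of_coeff (hdeg : ∀ n, (p n).natDegree ≤ d)
    (hdeg₀ : p₀.natDegree ≤ d)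
    (hcoeff : ∀ k, Tendsto (fun n => (p n).coeff k) atTop (𝓝 (p₀.coeff k)))
    {x : ℕ → ℂ} {x₀ : ℂ} (hx : Tendsto x atTop (𝓝 x₀)) :
    Tendsto (fun n => (p n).derivative.eval (x n)) atTop (𝓝 (p₀.derivative.eval x₀)) := by
  refine tendsto_eval_of_coeff (d := d)
    (fun n => (Polynomial.natDegree_derivative_le _).trans ((Nat.sub_le _ _).trans (hdeg n)))
    ((Polynomial.natDegree_derivative_le _).trans ((Nat.sub_le _ _).trans hdeg₀)) (fun k => ?_) hx
  simp_rw [Polynomial.coeff_derivative]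
  exact (hcoeff (k + 1)).mul_const _

theorem tendsto_iterate_of_coeff (hdeg : ∀ n, (p n).natDegree ≤ d) (hdeg₀ : p₀.natDegree ≤ d)
    (hcoeff : ∀ k, Tendsto (fun n => (p n).coeff k) atTop (𝓝 (p₀.coeff k)))
    {x : ℕ → ℂ} {x₀ : ℂ} (hx : Tendsto x atTop (𝓝 x₀)) (k : ℕ) :
    Tendsto (fun n => (pmap (p n))^[k] (x n)) atTop (𝓝 ((pmap p₀)^[k] x₀)) := by
  induction k with
  | zero => exact hx
  | succ k ih =>
    simp_rw [pmap_iterate_succ']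
    exact tendsto_eval_of_coeff hdeg hdeg₀ hcoeff ih

theorem tendsto_multiplier_of_coeff (hdeg : ∀ n, (p n).natDegree ≤ d) (hdeg₀ : p₀.natDegree ≤ d)
    (hcoeff : ∀ k, Tendsto (fun n => (p n).coeff k) atTop (𝓝 (p₀.coeff k)))
    {x : ℕ → ℂ} {x₀ : ℂ} (hx : Tendsto x atTop (𝓝 x₀)) (k : ℕ) :
    Tendsto (fun n => multiplier (p n) k (x n)) atTop (𝓝 (multiplier p₀ k x₀)) := by
  induction k with
  | zero => simp_rw [multiplier_zero]; exact tendsto_const_nhds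
  | succ k ih =>
    simp_rw [multiplier_succ]
    exact (tendsto_eval_derivative_of_coeff hdeg hdeg₀ hcoeff
      (tendsto_iterate_of_coeff hdeg hdeg₀ hcoeff hx k)).mul ih

theorem tendsto_bCoeff_of_coeff (hdeg : ∀ n, (p n).natDegree ≤ d) (hdeg₀ : p₀.natDegree ≤ d)
    (hcoeff : ∀ k, Tendsto (fun n => (p n).coeff k) atTop (𝓝 (p₀.coeff k))) (m i : ℕ) :
    Tendsto (fun n => bCoeff (p n) m i) atTop (𝓝 (bCoeff p₀ m i)) :=
  tendsto_multiplier_of_coeff hdeg hdeg₀ hcoeff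
    (tendsto_iterate_of_coeff hdeg hdeg₀ hcoeff tendsto_const_nhds (i + 1)) _

theorem tendsto_cValue_of_coeff (hdeg : ∀ n, (p n).natDegree ≤ d) (hdeg₀ : p₀.natDegree ≤ d)
    (hcoeff : ∀ k, Tendsto (fun n => (p n).coeff k) atTop (𝓝 (p₀.coeff k))) (q : Polynomial ℂ)
    (m : ℕ) (w : ℂ) :
    Tendsto (fun n => cValue (p n) q m w) atTop (𝓝 (cValue p₀ q m w)) := by
  unfold cValue
  exact tendsto_finsetSum _ fun i _ =>
    (tendsto_bCoeff_of_coeff hdeg hdeg₀ hcoeff m i).mul_const _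

/-- The order of choice matters: T is uniform in n because the coefficients b_i and the values c_i
converge; then come n and l, and the bound on s last. -/
theorem eventually_isModelSystem (hdeg : ∀ n, (p n).natDegree ≤ d) (hdeg₀ : p₀.natDegree ≤ d)
    (hcoeff : ∀ k, Tendsto (fun n => (p n).coeff k) atTop (𝓝 (p₀.coeff k)))
    (q : Polynomial ℂ) (m : ℕ) (hper : ∀ n, (pmap (p n))^[m] 0 = 0) (r : Fin 3 → ℂ) {C R ε : ℝ}
    (hC : 0 < C) (hR : 0 < R) (hε : 0 < ε) :
    ∃ T : ℝ, 0 < T ∧ ∀ᶠ n in atTop, ∀ {l : ℕ} {V : Fin 3 → Set ℂ} {ψ : Fin 3 → Fin 3 → ℂ → ℂ}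
      {η : ℝ}, IsBaseSystem (pmap q)^[m] l r V ψ η C →
      (∀ j < l, ‖multiplier (p n) m 0 ^ j‖ ≤ 2) →
      T ≤ ‖∑ t ∈ Finset.range l, multiplier (p n) m 0 ^ t‖ →
      ∃ s₀ : ℝ, 0 < s₀ ∧ ∀ s : ℂ, ‖s‖ < s₀ → s ≠ 0 →
        IsModelSystem (pmap q)^[m] l V (fun i => cValue p₀ q m (r i)) (multiplier (p n) m 0 ^ l)
          (s * ∑ t ∈ Finset.range l, multiplier (p n) m 0 ^ t) R ε (skew (p n) q s)^[m * l] := by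
  set M := ∑ i ∈ Finset.range m, ‖bCoeff p₀ m i‖ + 1 with hM
  have hM0 : 0 < M := by positivity
  obtain ⟨T, ν, hT, hν, h⟩ := exists_isModelSystem q m r (fun i => cValue p₀ q m (r i))
    hC hM0 hR hε
  refine ⟨T, hT, ?_⟩
  have h1 : ∀ᶠ n in atTop, ∀ i ∈ Finset.range m, ‖bCoeff (p n) m i‖ < M := by
    rw [Filter.eventually_all_finset]
    intro i hi
    refine (tendsto_bCoeff_of_coeff hdeg hdeg₀ hcoeff m i).norm.eventually_lt_const ?_
    rw [hM]
    linarith [Finset.single_le_sum (f := fun i => ‖bCoeff p₀ m i‖) (fun _ _ => norm_nonneg _) hi]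
  have h2 : ∀ᶠ n in atTop, ∀ i, ‖cValue (p n) q m (r i) - cValue p₀ q m (r i)‖ < ν := by
    rw [Filter.eventually_all]
    intro i
    have h3 := ((tendsto_cValue_of_coeff hdeg hdeg₀ hcoeff q m (r i)).sub_const
      (cValue p₀ q m (r i))).norm
    rw [sub_self, norm_zero] at h3
    exact h3.eventually_lt_const hν
  filter_upwards [h1, h2] with n hn1 hn2 l V ψ η hbase hpow hTn
  exact h hbase (hper n) (fun i hi => (hn1 i (Finset.mem_range.2 hi)).le) (fun i => (hn2 i).le)
    hpow hTn

end Convergence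

/-! ### The choice of the times -/

/-- The sum times μ - 1 is μ^l - 1: a definite numerator over a small denominator. -/
theorem le_norm_geom_sum {μ : ℂ} {l : ℕ} {T κ : ℝ} (hμ : μ ≠ 1) (hT : T * ‖μ - 1‖ ≤ κ)
    (h : κ ≤ ‖μ ^ l - 1‖) : T ≤ ‖∑ t ∈ Finset.range l, μ ^ t‖ := by
  have h1 : 0 < ‖μ - 1‖ := norm_pos_iff.2 (sub_ne_zero.2 hμ)
  rw [← geom_sum_mul, norm_mul] at h
  exact le_of_mul_le_mul_right (hT.trans h) h1

theorem eventually_mul_norm_sub_one_lt {μ : ℕ → ℂ} (hμ : Tendsto μ atTop (𝓝 1)) (T : ℝ) {κ : ℝ} (hκ : 0 < κ) :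
    ∀ᶠ n in atTop, T * ‖μ n - 1‖ < κ := by
  have h := ((hμ.sub_const 1).norm).const_mul T
  rw [sub_self, norm_zero, mul_zero] at h
  exact h.eventually_lt_const hκ

/-- l is the last exponent with ‖μ‖^l ≤ 1 + γ. As ‖μ‖ is close to 1, this power cannot lie below 1 +
γ/2, and l exceeds any prescribed L. -/
theorem eventually_exists_repelling_time {μ : ℕ → ℂ} (hμ : Tendsto μ atTop (𝓝 1))
    (h : ∀ n, 1 < ‖μ n‖) {γ : ℝ} (hγ : 0 < γ) (hγ1 : γ ≤ 1) (L : ℕ) (T : ℝ) :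
    ∀ᶠ n in atTop, ∃ l ≥ L, 1 + γ / 2 ≤ ‖μ n ^ l‖ ∧ ‖μ n ^ l‖ ≤ 1 + γ ∧
      (∀ j < l, ‖μ n ^ j‖ ≤ 2) ∧ T ≤ ‖∑ t ∈ Finset.range l, μ n ^ t‖ := by
  have hn : Tendsto (fun n => ‖μ n‖) atTop (𝓝 1) := by simpa using hμ.norm
  have hnL := hn.pow L
  rw [one_pow] at hnL
  have hnγ := hn.mul_const (1 + γ / 2)
  filter_upwards [eventually_mul_norm_sub_one_lt hμ T (half_pos hγ),
    hnL.eventually_lt_const (by linarith : (1 : ℝ) < 1 + γ),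
    hnγ.eventually_lt_const (by linarith : 1 * (1 + γ / 2) < 1 + γ)] with n h1 h2 h3
  obtain ⟨l, hl1, hl2⟩ := exists_nat_pow_near (by linarith : 1 ≤ 1 + γ) (h n)
  have hlow : 1 + γ / 2 ≤ ‖μ n ^ l‖ := by
    rw [norm_pow]
    rw [pow_succ] at hl2
    by_contra hcon
    have : ‖μ n‖ ^ l * ‖μ n‖ ≤ (1 + γ / 2) * ‖μ n‖ := by gcongr; linarith
    linarith
  refine ⟨l, ?_, hlow, by rwa [norm_pow], fun j hj => ?_, le_norm_geom_sum (fun h0 => ?_) h1.le ?_⟩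
  · by_contra hcon
    have := pow_le_pow_right₀ (h n).le (by omega : l + 1 ≤ L)
    linarith
  · rw [norm_pow]
    have := pow_le_pow_right₀ (h n).le hj.le
    linarith
  · have := h n
    rw [h0, norm_one] at this
    exact lt_irrefl _ this
  · have := norm_sub_norm_le (μ n ^ l) 1
    rw [norm_one] at this
    linarith

/-- Here l is the last exponent with ‖μ‖^l ≥ 1 - γ/2. -/
theorem eventually_exists_attracting_time {μ : ℕ → ℂ} (hμ : Tendsto μ atTop (𝓝 1))
    (h : ∀ n, ‖μ n‖ < 1) {γ : ℝ} (hγ : 0 < γ) (hγ1 : γ ≤ 1) (L : ℕ) (T : ℝ) :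
    ∀ᶠ n in atTop, ∃ l ≥ L, 1 - γ / 2 ≤ ‖μ n ^ l‖ ∧ ‖μ n ^ l‖ ≤ 1 - γ / 4 ∧
      (∀ j < l, ‖μ n ^ j‖ ≤ 2) ∧ T ≤ ‖∑ t ∈ Finset.range l, μ n ^ t‖ := by
  have hn : Tendsto (fun n => ‖μ n‖) atTop (𝓝 1) := by simpa using hμ.norm
  have hnL := hn.pow L
  rw [one_pow] at hnL
  have hnγ := hn.mul_const (1 - γ / 4)
  filter_upwards [eventually_mul_norm_sub_one_lt hμ T (by positivity : 0 < γ / 4),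
    hnL.eventually_const_lt (by linarith : 1 - γ / 2 < 1),
    hnγ.eventually_const_lt (by linarith : 1 - γ / 2 < 1 * (1 - γ / 4)),
    hn.eventually_const_lt one_pos] with n h1 h2 h3 h4
  obtain ⟨l, hl1, hl2⟩ := exists_nat_pow_near_of_lt_one (by linarith : 0 < 1 - γ / 2)
    (by linarith) h4 (h n)
  have hup : ‖μ n ^ l‖ ≤ 1 - γ / 4 := by
    rw [norm_pow]
    rw [pow_succ] at hl1
    by_contra hcon
    have : (1 - γ / 4) * ‖μ n‖ ≤ ‖μ n‖ ^ l * ‖μ n‖ := by gcongr; linarith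
    linarith
  refine ⟨l, ?_, by rwa [norm_pow], hup, fun j hj => ?_, le_norm_geom_sum (fun h0 => ?_) h1.le ?_⟩
  · by_contra hcon
    have := pow_le_pow_of_le_one (norm_nonneg _) (h n).le (by omega : l + 1 ≤ L)
    linarith
  · rw [norm_pow]
    have := pow_le_one₀ (n := j) (norm_nonneg _) (h n).le
    linarith
  · have := h n
    rw [h0, norm_one] at this
    exact lt_irrefl _ this
  · have := norm_sub_norm_le 1 (μ n ^ l)
    rw [norm_one, norm_sub_rev] at this
    linarith

theorem exists_sequences {P : ℕ → ℕ → ℂ → Prop}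
    (h : ∀ᶠ n in atTop, ∃ l : ℕ, 1 ≤ l ∧ ∃ b : ℝ, 0 < b ∧ ∀ s : ℂ, ‖s‖ < b → s ≠ 0 → P n l s) :
    ∃ (l : ℕ → ℕ) (β : ℕ → ℂ), (∀ n, 1 ≤ l n) ∧ (∀ n, β n ≠ 0) ∧ Tendsto β atTop (𝓝 0) ∧
      ∃ N : ℕ, ∀ n ≥ N, ∀ a : ℂ, 0 < ‖a‖ → ‖a‖ < 1 → P n (l n) (a * β n) := by
  obtain ⟨N, hN⟩ := eventually_atTop.1 h
  have hch : ∀ n : ℕ, ∃ (l : ℕ) (β : ℂ), 1 ≤ l ∧ β ≠ 0 ∧ ‖β‖ ≤ 1 / ((n : ℝ) + 1) ∧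
      (N ≤ n → ∀ a : ℂ, 0 < ‖a‖ → ‖a‖ < 1 → P n l (a * β)) := by
    intro n
    have hn : 0 < 1 / ((n : ℝ) + 1) := Nat.one_div_pos_of_nat
    by_cases hNn : N ≤ n
    -- β_n is the smaller of the admissible threshold and 1/(n + 1), so β_n → 0 while every a with 0
    -- < |a| < 1 is allowed.
    · obtain ⟨l, hl, b, hb, hP⟩ := hN n hNn
      have hm : 0 < min b (1 / ((n : ℝ) + 1)) := lt_min hb hn
      have hnorm : ‖((min b (1 / ((n : ℝ) + 1)) : ℝ) : ℂ)‖ = min b (1 / ((n : ℝ) + 1)) := by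
        rw [Complex.norm_real, Real.norm_of_nonneg hm.le]
      have hne : ((min b (1 / ((n : ℝ) + 1)) : ℝ) : ℂ) ≠ 0 := Complex.ofReal_ne_zero.2 hm.ne'
      refine ⟨l, ((min b (1 / ((n : ℝ) + 1)) : ℝ) : ℂ), hl, hne,
        hnorm.le.trans (min_le_right _ _), fun _ a ha0 ha1 => hP _ ?_
        (mul_ne_zero (norm_pos_iff.1 ha0) hne)⟩
      rw [norm_mul, hnorm]
      nlinarith [min_le_left b (1 / ((n : ℝ) + 1))]
    · refine ⟨1, ((1 / ((n : ℝ) + 1) : ℝ) : ℂ), le_rfl, Complex.ofReal_ne_zero.2 hn.ne', ?_,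
        fun h => absurd h hNn⟩
      rw [Complex.norm_real, Real.norm_of_nonneg hn.le]
  choose l β hl hβ hβn hP using hch
  exact ⟨l, β, hl, hβ, squeeze_zero_norm hβn tendsto_one_div_add_atTop_nhds_zero_nat, N, hP⟩

/-! ### The base -/

theorem pmap_comp_iterate (q : Polynomial ℂ) (m : ℕ) :
    pmap (q.comp^[m] Polynomial.X) = (pmap q)^[m] := by
  funext z
  rw [pmap, Polynomial.iterate_comp_eval, Polynomial.eval_X]
  rfl

theorem exists_critical_of_multiplier_eq_zero {q : Polynomial ℂ} {n : ℕ} {y : ℂ}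
    (h : multiplier q n y = 0) : ∃ i < n, q.derivative.eval ((pmap q)^[i] y) = 0 := by
  induction n with
  | zero => rw [multiplier_zero] at h; exact absurd h one_ne_zero
  | succ n ih =>
    rw [multiplier_succ, mul_eq_zero] at h
    rcases h with h | h
    · exact ⟨n, Nat.lt_succ_self n, h⟩
    · obtain ⟨i, hi, h⟩ := ih h
      exact ⟨i, Nat.lt_succ_of_lt hi, h⟩

/-- A critical point met at a time i < n would be mapped to r in n - i ≥ 1 steps. -/
theorem multiplier_ne_zero_of_notMem_postcritical {q : Polynomial ℂ} {n : ℕ} {y r : ℂ}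
    (hr : r ∉ postcritical q) (h : (pmap q)^[n] y = r) : multiplier q n y ≠ 0 := by
  intro h0
  obtain ⟨i, hi, hc⟩ := exists_critical_of_multiplier_eq_zero h0
  refine hr ⟨n - i, by omega, _, hc, ?_⟩
  rw [← Function.iterate_add_apply, show n - i + i = n by omega, h]

theorem exists_isBaseSystem_iterate {q : Polynomial ℂ} (hq : 2 ≤ q.natDegree) {m : ℕ} (hm : 0 < m)
    {r : Fin 3 → ℂ} (hr : Function.Injective r) (hper : ∀ j, (pmap q)^[m] (r j) = r j)
    (hrep : ∀ j, 1 < ‖multiplier q m (r j)‖) (hpost : ∀ j, r j ∉ postcritical q) :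
    ∃ η C : ℝ, 0 < η ∧ 0 < C ∧ ∃ L₀ : ℕ, ∀ l ≥ L₀, ∃ V ψ,
      IsBaseSystem (pmap q)^[m] l r V ψ η C := by
  have hQ := pmap_comp_iterate q m
  have hdeg : 2 ≤ (q.comp^[m] Polynomial.X).natDegree := by
    rw [Polynomial.natDegree_iterate_comp, Polynomial.natDegree_X, mul_one]
    calc 2 ≤ q.natDegree ^ 1 := by rwa [pow_one]
      _ ≤ _ := Nat.pow_le_pow_right (by omega) hm
  have h := exists_isBaseSystem hdeg hr (fun j => ?_) (fun j => ?_) (fun j k y hy => ?_)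
  · rwa [hQ] at h
  · have h1 := congrFun hQ (r j)
    rw [hper j] at h1
    exact h1
  · rw [← Polynomial.deriv]
    have : (fun z => (q.comp^[m] Polynomial.X).eval z) = (pmap q)^[m] := hQ
    rw [this]
    exact hrep j
  · rw [hQ, ← Function.iterate_mul] at hy ⊢
    exact multiplier_ne_zero_of_notMem_postcritical (hpost j) hy

end Blender

end

/-! ### The theorem: choice of constants, then of times and couplings. -/

theorem theorem3
    {E : Type*} [NormedAddCommGroup E] [NormedSpace ℂ E] [FiniteDimensional ℂ E]
    {M : Type*} [TopologicalSpace M] [ChartedSpace E M] [IsManifold 𝓘(ℂ, E) ω M]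
    (d : ℕ) (hd : 2 ≤ d)
    (p : M → Polynomial ℂ) (hp_deg : ∀ t, (p t).natDegree = d)
    (hp_hol : ∀ k : ℕ, MDifferentiable 𝓘(ℂ, E) 𝓘(ℂ) (fun t => (p t).coeff k))
    (m₀ : ℕ) (hm₀ : 0 < m₀)
    (hper : ∀ t, Function.IsPeriodicPt (Blender.pmap (p t)) m₀ 0)
    (lam₀ : M) (t₀ : ℕ) (ht₀ : 0 < t₀)
    (hroot : IsPrimitiveRoot (Blender.multiplier (p lam₀) m₀ 0) t₀)
    (q : Polynomial ℂ) (hq_deg : q.natDegree = d)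
    (r : Fin 3 → ℂ)
    (hr_per : ∀ j, Function.IsPeriodicPt (Blender.pmap q) (m₀ * t₀) (r j))
    (hr_rep : ∀ j, 1 < ‖Blender.multiplier q (m₀ * t₀) (r j)‖)
    (hr_post : ∀ j, r j ∉ Blender.postcritical q)
    (hc_align : ¬ Collinear ℝ
      (Set.range fun j : Fin 3 => Blender.cValue (p lam₀) q (m₀ * t₀) (r j)))
    (hc_sum : ∑ j : Fin 3, Blender.cValue (p lam₀) q (m₀ * t₀) (r j) = 0)
    (lam : ℕ → M) (hlam : Filter.Tendsto lam Filter.atTop (nhds lam₀)) :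
    ((∀ n, 1 < ‖Blender.multiplier (p (lam n)) m₀ 0‖) →
      ∃ (l : ℕ → ℕ) (β : ℕ → ℂ), (∀ n, 1 ≤ l n) ∧ (∀ n, β n ≠ 0) ∧
        Filter.Tendsto β Filter.atTop (nhds 0) ∧
        ∃ N : ℕ, ∀ n ≥ N, ∀ a : ℂ, 0 < ‖a‖ → ‖a‖ < 1 →
          ∃ Λ : Set (ℂ × ℂ),
            Blender.IsRepellingBlender ((Blender.pmap q)^[m₀ * t₀ * l n]) r
              ((Blender.skew (p (lam n)) q (a * β n))^[m₀ * t₀ * l n]) Λ) ∧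
    ((∀ n, ‖Blender.multiplier (p (lam n)) m₀ 0‖ < 1) →
      ∃ (l : ℕ → ℕ) (β : ℕ → ℂ), (∀ n, 1 ≤ l n) ∧ (∀ n, β n ≠ 0) ∧
        Filter.Tendsto β Filter.atTop (nhds 0) ∧
        ∃ N : ℕ, ∀ n ≥ N, ∀ a : ℂ, 0 < ‖a‖ → ‖a‖ < 1 →
          ∃ Λ : Set (ℂ × ℂ),
            Blender.IsSaddleBlender (d ^ (m₀ * t₀ * l n))
              ((Blender.skew (p (lam n)) q (a * β n))^[m₀ * t₀ * l n]) Λ) := by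
  have hcoeff : ∀ k, Filter.Tendsto (fun n => (p (lam n)).coeff k) Filter.atTop
      (nhds ((p lam₀).coeff k)) := fun k => ((hp_hol k).continuous.tendsto lam₀).comp hlam
  have hm : 0 < m₀ * t₀ := Nat.mul_pos hm₀ ht₀
  have hdeg : ∀ n, (p (lam n)).natDegree ≤ d := fun n => (hp_deg _).le
  have hmul : ∀ t, Blender.multiplier (p t) (m₀ * t₀) 0 = Blender.multiplier (p t) m₀ 0 ^ t₀ :=
    fun t => Blender.multiplier_mul (p t) (hper t) t₀
  have hμ : Filter.Tendsto (fun n => Blender.multiplier (p (lam n)) (m₀ * t₀) 0) Filter.atTop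
      (nhds 1) := by
    have h := Blender.tendsto_multiplier_of_coeff hdeg (hp_deg lam₀).le hcoeff
      (tendsto_const_nhds (x := (0 : ℂ))) (m₀ * t₀)
    rwa [hmul lam₀, hroot.pow_eq_one] at h
  have hper' : ∀ n, (Blender.pmap (p (lam n)))^[m₀ * t₀] 0 = 0 := fun n =>
    (hper (lam n)).mul_const t₀
  -- Non-aligned c_j are affinely independent, hence distinct, and so are the points r_j.
  have hr : Function.Injective r := Function.Injective.of_comp
    (f := fun z => Blender.cValue (p lam₀) q (m₀ * t₀) z)
    (affineIndependent_iff_not_collinear.2 hc_align).injective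
  obtain ⟨η, C, hη, hC, L₀, hbase⟩ := Blender.exists_isBaseSystem_iterate (hq_deg ▸ hd) hm hr
    hr_per hr_rep hr_post
  obtain ⟨R, γ, hR, hγ, hγ4, hcov⟩ := Blender.exists_covering_translations hc_align hc_sum
  have hsum : ∀ (μ s : ℂ) (l : ℕ) {T : ℝ}, 0 < T → T ≤ ‖∑ t ∈ Finset.range l, μ ^ t‖ → s ≠ 0 →
      s * ∑ t ∈ Finset.range l, μ ^ t ≠ 0 := fun μ s l T hT h hs =>
    mul_ne_zero hs (norm_pos_iff.1 (hT.trans_le h))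
  refine ⟨fun hexp => ?_, fun hcon => ?_⟩
  · have hexp' : ∀ n, 1 < ‖Blender.multiplier (p (lam n)) (m₀ * t₀) 0‖ := fun n => by
      rw [hmul, norm_pow]; exact one_lt_pow₀ (hexp n) ht₀.ne'
    obtain ⟨R', ε, hR', hε, hblend⟩ := Blender.exists_isRepellingBlender hR hγ hγ4 hcov hη hC
      (half_pos hγ)
    obtain ⟨T, hT, hmodel⟩ := Blender.eventually_isModelSystem hdeg (hp_deg lam₀).le hcoeff q
      (m₀ * t₀) hper' r hC hR' hε
    refine Blender.exists_sequences (P := fun n l s => ∃ Λ : Set (ℂ × ℂ),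
      Blender.IsRepellingBlender ((Blender.pmap q)^[m₀ * t₀ * l]) r
        ((Blender.skew (p (lam n)) q s)^[m₀ * t₀ * l]) Λ) ?_
    -- The bound max 1 L₀ ensures l ≥ 1 and the existence of the base system. The time l gives 1 +
    -- γ/2 ≤ |A| ≤ 1 + γ, as required by `hblend` with ε₁ = γ/2.
    filter_upwards [hmodel, Blender.eventually_exists_repelling_time hμ hexp' hγ (by linarith)
      (max 1 L₀) T] with n hn ⟨l, hl, hA1, hA2, hpow, hTl⟩
    obtain ⟨V, ψ, hV⟩ := hbase l ((le_max_right _ _).trans hl)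
    obtain ⟨s₀, hs₀, hs⟩ := hn hV hpow hTl
    refine ⟨l, (le_max_left _ _).trans hl, s₀, hs₀, fun s hss hs0 => ?_⟩
    rw [Function.iterate_mul (Blender.pmap q)]
    exact hblend (Blender.differentiable_pmap_iterate q _) hV (hs s hss hs0)
      (hsum _ s l hT hTl hs0) hA1 hA2
  · have hcon' : ∀ n, ‖Blender.multiplier (p (lam n)) (m₀ * t₀) 0‖ < 1 := fun n => by
      rw [hmul, norm_pow]; exact pow_lt_one₀ (norm_nonneg _) (hcon n) ht₀.ne'
    obtain ⟨ε, hε, hsaddle⟩ := Blender.exists_robust_saddle hR hγ hγ4 hcov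
      (by positivity : 0 < γ / 4)
    obtain ⟨T, hT, hmodel⟩ := Blender.eventually_isModelSystem hdeg (hp_deg lam₀).le hcoeff q
      (m₀ * t₀) hper' r hC hR hε
    refine Blender.exists_sequences (P := fun n l s => ∃ Λ : Set (ℂ × ℂ),
      Blender.IsSaddleBlender (d ^ (m₀ * t₀ * l))
        ((Blender.skew (p (lam n)) q s)^[m₀ * t₀ * l]) Λ) ?_
    filter_upwards [hmodel, Blender.eventually_exists_attracting_time hμ hcon' hγ (by linarith)
      (max 1 L₀) T] with n hn ⟨l, hl, hA1, hA2, hpow, hTl⟩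
    obtain ⟨V, ψ, hV⟩ := hbase l ((le_max_right _ _).trans hl)
    obtain ⟨s₀, hs₀, hs⟩ := hn hV hpow hTl
    refine ⟨l, (le_max_left _ _).trans hl, s₀, hs₀, fun s hss hs0 => ?_⟩
    obtain ⟨Z, hZ, hZn, hZc, hZF, ε', hε', hg⟩ := hsaddle
      (Blender.differentiable_pmap_iterate q _) hV (hs s hss hs0) (hsum _ s l hT hTl hs0) hA1 hA2
    obtain ⟨G, hG⟩ := Blender.exists_isAffineLift_skew hd (hp_deg (lam n)) hq_deg s
    obtain ⟨G', hG'⟩ := hG.exists_iterate (m₀ * t₀ * l)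
    exact ⟨_, hG'.isSaddleBlender hZ hZn hZc hZF hε' hg⟩
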